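/- Let $(M^5,\eta,\xi,\Phi,g)$ be a $5$-dimensional Sasakian manifold, with the conventions $g=\eta\otimes\eta+\tfrac12 d\eta(\cdot,\Phi\,\cdot)$, where $d\eta(X,Y)=X\eta(Y)-Y\eta(X)-\eta([X,Y])$, and $\overline\nabla_X\xi=\Phi X$. The transverse Levi-Civita connection $\nabla^T$ on $\ker\eta$ is $\nabla^T_XY=\pi(\overline\nabla_XY)$ for $X\in\ker\eta$ and $\nabla^T_\xi Y=\pi[\xi,Y]$, where $\pi(X)=X-\eta(X)\xi$; let $\mathrm{Ric}^T$ be its Ricci tensor. Let $\overline\omega$ be a parallel transverse Kähler form: $\overline\omega(X,Y)=g(JX,Y)$, where $J$ is an endomorphism field with $J\xi=0$ and $J^2=-\pi$ that is $g$-orthogonal on $\ker\eta$ and commutes with $\Phi$ ($J\neq\Phi$ is allowed), and $\nabla^T\overline\omega=0$. Let $\Sigma$ be an oriented surface and let $F:\Sigma\times[0,T)\to M$ be a smooth Legendrian mean curvature flow: each $F_t$ is a Legendrian immersion, with induced metric $g_t$, second fundamental form $A$ and mean curvature vector $H=\mathrm{tr}_{g_t}A$, and there is a smooth function $\alpha$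 (the Legendrian angle) on $\Sigma\times[0,T)$ such that $$H=-\nabla^k\alpha\,\Phi(\partial_kF_t),\qquad \frac{d}{dt}F_t=H-2\alpha\,\xi .$$ Let $\Omega_t=*_t F_t^*\overline\omega$, where $*_t$ is the Hodge star of $g_t$. Then $\Omega_t$ is smooth on $\Sigma\times[0,T)$, and for every oriented $g_t$-orthonormal basis $e_1,e_2$ of a tangent plane of $\Sigma$ (identified with its image under $dF_t$), $$\Big(\frac{d}{dt}-\Delta_{g_t}\Big)\Omega_t=\big(2|A|^2-|H|^2\big)\,\Omega_t+(1-\Omega_t^2)\,\mathrm{Ric}^T(Je_1,e_2).$$ As a consequence, if moreover $M$ is $\eta$-Einstein ($\mathrm{Ric}=Kg+(4-K)\,\eta\otimes\eta$ for some constant $K$), $\Sigma$ is compact and $\Omega_0>0$ on $\Sigma$, then $\Omega_t>0$ on $\Sigma$ for all $t\in[0,T)$; in particular $\Sigma_t$ remains (infinitesimally) a graph, that is, its tangent planes meet each of the two subbundles $\ker(J-\Phi)\cap\ker\eta$ and $\ker(J+\Phi)\cap\ker\eta$ of $\ker\eta$ only in $0$. -/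

import Mathlib

open Set Manifold Bundle
open scoped ContDiff

noncomputable section

/-- The model space `ℝⁿ`. -/
abbrev EuSp (n : ℕ) : Type := EuclideanSpace ℝ (Fin n)

namespace LegendrianFlow

/-! ### Riemannian geometry on an open subset of `ℝⁿ`

Tensor fields are functions on `ℝⁿ`; only their values on the open set under consideration matter. -/

section Local

variable {n m : ℕ}

/-- The coordinate vector `∂_i`. -/
def coordVec (i : Fin n) : EuSp n := EuclideanSpace.single i 1

/-- The inverse `(g^{ij})` of the Gram matrix `(g_{ij})` of a bilinear form. -/
def invGram (b : EuSp n →L[ℝ] EuSp n →L[ℝ] ℝ) : Matrix (Fin n) (Fin n) ℝ :=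
  (Matrix.of fun i j : Fin n => b (coordVec i) (coordVec j))⁻¹

/-- The pull-back `b(L ·, L ·)` of a bilinear form under a linear map. -/
def pullForm (b : EuSp m →L[ℝ] EuSp m →L[ℝ] ℝ) (L : EuSp n →L[ℝ] EuSp m) :
    EuSp n →L[ℝ] EuSp n →L[ℝ] ℝ :=
  b.bilinearComp L L

/-- `Γ(u,v) = Γ^k_{ij} u^i v^j ∂_k` with
`Γ^k_{ij} = ½ g^{kl} (∂_i g_{jl} + ∂_j g_{il} - ∂_l g_{ij})`. -/
def christoffel (G : EuSp n → EuSp n →L[ℝ] EuSp n →L[ℝ] ℝ) (y u v : EuSp n) : EuSp n :=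
  ∑ k, (∑ l, invGram (G y) k l * ((1 / 2 : ℝ) *
    (fderiv ℝ G y u v (coordVec l) + fderiv ℝ G y v u (coordVec l)
      - fderiv ℝ G y (coordVec l) u v))) • coordVec k

/-- The Levi-Civita covariant derivative `∇_X Y`. -/
def covDeriv (G : EuSp n → EuSp n →L[ℝ] EuSp n →L[ℝ] ℝ) (X Y : EuSp n → EuSp n) (y : EuSp n) :
    EuSp n :=
  fderiv ℝ Y y (X y) + christoffel G y (X y) (Y y)

/-- The curvature `R(u,v)w = ∇_u ∇_v w - ∇_v ∇_u w`, where the vectors are extended to fields with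
constant components (so that `[u,v] = 0`). -/
def curvature (G : EuSp n → EuSp n →L[ℝ] EuSp n →L[ℝ] ℝ) (y u v w : EuSp n) : EuSp n :=
  covDeriv G (fun _ => u) (covDeriv G (fun _ => v) fun _ => w) y
    - covDeriv G (fun _ => v) (covDeriv G (fun _ => u) fun _ => w) y

/-- `Ric(v,w)`, the trace of `u ↦ R(u,v)w`. -/
def ricci (G : EuSp n → EuSp n →L[ℝ] EuSp n →L[ℝ] ℝ) (y v w : EuSp n) : ℝ :=
  ∑ i, curvature G y (coordVec i) v w i

/-- The gradient `∇^k a ∂_k = g^{kl} ∂_l a ∂_k`. -/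
def gradient (G : EuSp n → EuSp n →L[ℝ] EuSp n →L[ℝ] ℝ) (a : EuSp n → ℝ) (y : EuSp n) : EuSp n :=
  ∑ k, (∑ l, invGram (G y) k l * fderiv ℝ a y (coordVec l)) • coordVec k

/-- The Laplace-Beltrami operator `Δ a = g^{ij} (∂_i ∂_j a - Γ^k_{ij} ∂_k a)`. -/
def laplacian (G : EuSp n → EuSp n →L[ℝ] EuSp n →L[ℝ] ℝ) (a : EuSp n → ℝ) (y : EuSp n) : ℝ :=
  ∑ i, ∑ j, invGram (G y) i j *
    (fderiv ℝ (fun z => fderiv ℝ a z (coordVec j)) y (coordVec i)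
      - fderiv ℝ a y (christoffel G y (coordVec i) (coordVec j)))

/-- The second fundamental form of the map `f` from `(ℝⁿ, G)` to `(ℝᵐ, G')`,
`A(u,v) = D²f(u,v) - Df(Γ(u,v)) + Γ'(Df u, Df v)`; for an isometric immersion this is the normal
part of the ambient covariant derivative. -/
def secondFundLocal (G : EuSp n → EuSp n →L[ℝ] EuSp n →L[ℝ] ℝ)
    (G' : EuSp m → EuSp m →L[ℝ] EuSp m →L[ℝ] ℝ) (f : EuSp n → EuSp m) (y u v : EuSp n) : EuSp m :=
  fderiv ℝ (fun z => fderiv ℝ f z v) y u - fderiv ℝ f y (christoffel G y u v)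
    + christoffel G' (f y) (fderiv ℝ f y u) (fderiv ℝ f y v)

/-- The mean curvature vector `H = g^{ij} A(∂_i, ∂_j)`. -/
def meanCurvLocal (G : EuSp n → EuSp n →L[ℝ] EuSp n →L[ℝ] ℝ)
    (G' : EuSp m → EuSp m →L[ℝ] EuSp m →L[ℝ] ℝ) (f : EuSp n → EuSp m) (y : EuSp n) : EuSp m :=
  ∑ i, ∑ j, invGram (G y) i j • secondFundLocal G G' f y (coordVec i) (coordVec j)

/-- The projection `π(v) = v - η(v) ξ` onto `ker η`. -/
def horiz (η : EuSp n → EuSp n →L[ℝ] ℝ) (ξ : EuSp n → EuSp n) (y v : EuSp n) : EuSp n :=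
  v - η y v • ξ y

/-- The transverse Levi-Civita connection on the bundle `ker η`: for a section `Y` of `ker η`,
`∇ᵀ_X Y = π(∇_X Y)` for horizontal `X`, and `∇ᵀ_ξ Y = π[ξ, Y]`. -/
def covTrans (G : EuSp n → EuSp n →L[ℝ] EuSp n →L[ℝ] ℝ) (η : EuSp n → EuSp n →L[ℝ] ℝ)
    (ξ : EuSp n → EuSp n) (X Y : EuSp n → EuSp n) (y : EuSp n) : EuSp n :=
  horiz η ξ y (covDeriv G (fun z => horiz η ξ z (X z)) Y y)
    + η y (X y) • horiz η ξ y (fderiv ℝ Y y (ξ y) - fderiv ℝ ξ y (Y y))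

/-- The curvature `Rᵀ(u,v)w = ∇ᵀ_u ∇ᵀ_v w - ∇ᵀ_v ∇ᵀ_u w` of the transverse connection; `u`, `v` are
extended with constant components (so that `[u,v] = 0`), and `w` is extended as the section `π(w)`
of `ker η`. -/
def curvTrans (G : EuSp n → EuSp n →L[ℝ] EuSp n →L[ℝ] ℝ) (η : EuSp n → EuSp n →L[ℝ] ℝ)
    (ξ : EuSp n → EuSp n) (y u v w : EuSp n) : EuSp n :=
  covTrans G η ξ (fun _ => u) (covTrans G η ξ (fun _ => v) fun z => horiz η ξ z w) y
    - covTrans G η ξ (fun _ => v) (covTrans G η ξ (fun _ => u) fun z => horiz η ξ z w) y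

/-- The transverse Ricci tensor `Ricᵀ(v,w)`, the trace of `u ↦ Rᵀ(u,v)w` over `ker η`. -/
def ricciTrans (G : EuSp n → EuSp n →L[ℝ] EuSp n →L[ℝ] ℝ) (η : EuSp n → EuSp n →L[ℝ] ℝ)
    (ξ : EuSp n → EuSp n) (y v w : EuSp n) : ℝ :=
  ∑ i, curvTrans G η ξ y (horiz η ξ y (coordVec i)) v w i

end Local

/-! ### Tensor fields on a manifold and their coordinate expressions

Recall that `TangentSpace 𝓘(ℝ, EuSp n) p` is `EuSp n`, a tangent vector at `p` being identified with
its components in the preferred chart at `p`. -/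

section Charts

variable {n : ℕ} {M : Type*} [TopologicalSpace M] [ChartedSpace (EuSp n) M]

/-- The differential at `y` of the inverse of the preferred chart at `p`. -/
def chartInvDiff (p : M) (y : EuSp n) :
    EuSp n →L[ℝ] TangentSpace 𝓘(ℝ, EuSp n) ((extChartAt 𝓘(ℝ, EuSp n) p).symm y) :=
  mfderiv 𝓘(ℝ, EuSp n) 𝓘(ℝ, EuSp n) (extChartAt 𝓘(ℝ, EuSp n) p).symm y

/-- The differential of the preferred chart at `p`, at the point with coordinates `y`. -/
def chartDiff (p : M) (y : EuSp n) :
    TangentSpace 𝓘(ℝ, EuSp n) ((extChartAt 𝓘(ℝ, EuSp n) p).symm y) →L[ℝ] EuSp n :=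
  mfderiv 𝓘(ℝ, EuSp n) 𝓘(ℝ, EuSp n) (extChartAt 𝓘(ℝ, EuSp n) p)
    ((extChartAt 𝓘(ℝ, EuSp n) p).symm y)

/-- A field of bilinear forms in the preferred chart at `p`. -/
def locBilin (B : ∀ q : M, TangentSpace 𝓘(ℝ, EuSp n) q →L[ℝ] TangentSpace 𝓘(ℝ, EuSp n) q →L[ℝ] ℝ)
    (p : M) (y : EuSp n) : EuSp n →L[ℝ] EuSp n →L[ℝ] ℝ :=
  pullForm (B ((extChartAt 𝓘(ℝ, EuSp n) p).symm y)) (chartInvDiff p y)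

/-- A one-form in the preferred chart at `p`. -/
def locForm (η : ∀ q : M, TangentSpace 𝓘(ℝ, EuSp n) q →L[ℝ] ℝ) (p : M) (y : EuSp n) :
    EuSp n →L[ℝ] ℝ :=
  (η ((extChartAt 𝓘(ℝ, EuSp n) p).symm y)).comp (chartInvDiff p y)

/-- A vector field in the preferred chart at `p`. -/
def locVec (V : ∀ q : M, TangentSpace 𝓘(ℝ, EuSp n) q) (p : M) (y : EuSp n) : EuSp n :=
  chartDiff p y (V ((extChartAt 𝓘(ℝ, EuSp n) p).symm y))

/-- A field of endomorphisms in the preferred chart at `p`. -/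
def locEnd (Φ : ∀ q : M, TangentSpace 𝓘(ℝ, EuSp n) q →L[ℝ] TangentSpace 𝓘(ℝ, EuSp n) q)
    (p : M) (y : EuSp n) : EuSp n →L[ℝ] EuSp n :=
  (chartDiff p y).comp ((Φ ((extChartAt 𝓘(ℝ, EuSp n) p).symm y)).comp (chartInvDiff p y))

end Charts

/-! ### Sasakian manifolds -/

section Sasakian

variable (n : ℕ) (M : Type*) [TopologicalSpace M] [ChartedSpace (EuSp n) M]
  [IsManifold 𝓘(ℝ, EuSp n) ∞ M]

/-- A Sasakian structure `(η, ξ, Φ, g)`, with the conventions `g = η ⊗ η + ½ dη(·, Φ ·)`, where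
`dη(X,Y) = X η(Y) - Y η(X) - η([X,Y])`, and `∇_X ξ = Φ X`. A contact metric structure is Sasakian
(that is, `Φ` is integrable, or the cone `dr² + r² g` is Kähler) exactly when
`(∇_X Φ) Y = η(Y) X - g(X,Y) ξ`; this is `nabla_phi`. Equations that involve derivatives are
required in all the preferred charts. -/
structure SasakianStructure where
  /-- the Riemannian metric -/
  g : ContMDiffRiemannianMetric 𝓘(ℝ, EuSp n) ∞ (EuSp n)
    (fun p : M => TangentSpace 𝓘(ℝ, EuSp n) p)
  /-- the contact form -/
  η : ∀ p : M, TangentSpace 𝓘(ℝ, EuSp n) p →L[ℝ] ℝ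
  /-- the Reeb vector field -/
  ξ : ∀ p : M, TangentSpace 𝓘(ℝ, EuSp n) p
  /-- the transverse complex structure, extended by `Φ ξ = 0` -/
  Φ : ∀ p : M, TangentSpace 𝓘(ℝ, EuSp n) p →L[ℝ] TangentSpace 𝓘(ℝ, EuSp n) p
  smooth_η : ContMDiff 𝓘(ℝ, EuSp n) (𝓘(ℝ, EuSp n).prod 𝓘(ℝ, EuSp n →L[ℝ] ℝ)) ∞
    (fun p => TotalSpace.mk' (EuSp n →L[ℝ] ℝ)
      (E := fun q : M => TangentSpace 𝓘(ℝ, EuSp n) q →L[ℝ] ℝ) p (η p))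
  smooth_ξ : ContMDiff 𝓘(ℝ, EuSp n) (𝓘(ℝ, EuSp n).prod 𝓘(ℝ, EuSp n)) ∞
    (fun p => TotalSpace.mk' (EuSp n) (E := fun q : M => TangentSpace 𝓘(ℝ, EuSp n) q) p (ξ p))
  smooth_Φ : ContMDiff 𝓘(ℝ, EuSp n) (𝓘(ℝ, EuSp n).prod 𝓘(ℝ, EuSp n →L[ℝ] EuSp n)) ∞
    (fun p => TotalSpace.mk' (EuSp n →L[ℝ] EuSp n)
      (E := fun q : M => TangentSpace 𝓘(ℝ, EuSp n) q →L[ℝ] TangentSpace 𝓘(ℝ, EuSp n) q) p (Φ p))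
  eta_reeb : ∀ p, η p (ξ p) = 1
  metric_reeb : ∀ p v, g.inner p (ξ p) v = η p v
  phi_sq : ∀ p v, Φ p (Φ p v) = -(v - η p v • ξ p)
  phi_reeb : ∀ p, Φ p (ξ p) = 0
  metric_eq : ∀ (p : M), ∀ y ∈ (extChartAt 𝓘(ℝ, EuSp n) p).target, ∀ u v : EuSp n,
    locBilin g.inner p y u v = locForm η p y u * locForm η p y v
      + (1 / 2 : ℝ) * (fderiv ℝ (locForm η p) y u (locEnd Φ p y v)
          - fderiv ℝ (locForm η p) y (locEnd Φ p y v) u)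
  nabla_phi : ∀ (p : M), ∀ y ∈ (extChartAt 𝓘(ℝ, EuSp n) p).target, ∀ u v : EuSp n,
    covDeriv (locBilin g.inner p) (fun _ => u) (fun z => locEnd Φ p z v) y
        - locEnd Φ p y (covDeriv (locBilin g.inner p) (fun _ => u) (fun _ => v) y)
      = locForm η p y v • u - locBilin g.inner p y u v • locVec ξ p y

variable {n M}

/-- The transverse Ricci tensor at `p`. -/
def SasakianStructure.ricT (𝓢 : SasakianStructure n M) (p : M)
    (v w : TangentSpace 𝓘(ℝ, EuSp n) p) : ℝ :=
  ricciTrans (locBilin 𝓢.g.inner p) (locForm 𝓢.η p) (locVec 𝓢.ξ p)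
    (extChartAt 𝓘(ℝ, EuSp n) p p) v w

/-- `η`-Einstein: `Ric = K g + (n - 1 - K) η ⊗ η`, where `n` is the dimension of `M`. -/
def SasakianStructure.IsEtaEinstein (𝓢 : SasakianStructure n M) (K : ℝ) : Prop :=
  ∀ (p : M) (v w : TangentSpace 𝓘(ℝ, EuSp n) p),
    ricci (locBilin 𝓢.g.inner p) (extChartAt 𝓘(ℝ, EuSp n) p p) v w
      = K * 𝓢.g.inner p v w + ((n : ℝ) - 1 - K) * (𝓢.η p v * 𝓢.η p w)

/-- A parallel transverse Kähler form `ω̄(X,Y) = g(J X, Y)`, given by its complex structure `J` on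
`ker η` (extended by `J ξ = 0`), which is orthogonal for the transverse metric. The form is
`Φ`-invariant, i.e. `J` commutes with `Φ`, but `J` need not be `Φ`; it is parallel for the
transverse Levi-Civita connection, hence basic and closed. -/
structure ParallelTransverseKahlerForm (𝓢 : SasakianStructure n M) where
  J : ∀ p : M, TangentSpace 𝓘(ℝ, EuSp n) p →L[ℝ] TangentSpace 𝓘(ℝ, EuSp n) p
  smooth_J : ContMDiff 𝓘(ℝ, EuSp n) (𝓘(ℝ, EuSp n).prod 𝓘(ℝ, EuSp n →L[ℝ] EuSp n)) ∞
    (fun p => TotalSpace.mk' (EuSp n →L[ℝ] EuSp n)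
      (E := fun q : M => TangentSpace 𝓘(ℝ, EuSp n) q →L[ℝ] TangentSpace 𝓘(ℝ, EuSp n) q) p (J p))
  J_reeb : ∀ p, J p (𝓢.ξ p) = 0
  J_sq : ∀ p v, J p (J p v) = -(v - 𝓢.η p v • 𝓢.ξ p)
  J_orthogonal : ∀ p v w,
    𝓢.g.inner p (J p v) (J p w) = 𝓢.g.inner p v w - 𝓢.η p v * 𝓢.η p w
  J_comm : ∀ p v, J p (𝓢.Φ p v) = 𝓢.Φ p (J p v)
  parallel : ∀ (p : M), ∀ y ∈ (extChartAt 𝓘(ℝ, EuSp n) p).target, ∀ u v w : EuSp n,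
    fderiv ℝ (fun z => locBilin (fun q => (𝓢.g.inner q).comp (J q)) p z
        (horiz (locForm 𝓢.η p) (locVec 𝓢.ξ p) z v) (horiz (locForm 𝓢.η p) (locVec 𝓢.ξ p) z w)) y u
      = locBilin (fun q => (𝓢.g.inner q).comp (J q)) p y
          (covTrans (locBilin 𝓢.g.inner p) (locForm 𝓢.η p) (locVec 𝓢.ξ p) (fun _ => u)
            (fun z => horiz (locForm 𝓢.η p) (locVec 𝓢.ξ p) z v) y)
          (horiz (locForm 𝓢.η p) (locVec 𝓢.ξ p) y w)
        + locBilin (fun q => (𝓢.g.inner q).comp (J q)) p y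
          (horiz (locForm 𝓢.η p) (locVec 𝓢.ξ p) y v)
          (covTrans (locBilin 𝓢.g.inner p) (locForm 𝓢.η p) (locVec 𝓢.ξ p) (fun _ => u)
            (fun z => horiz (locForm 𝓢.η p) (locVec 𝓢.ξ p) z w) y)

/-- The two-form `ω̄(v,w) = g(J v, w)`. -/
def ParallelTransverseKahlerForm.form {𝓢 : SasakianStructure n M}
    (κ : ParallelTransverseKahlerForm 𝓢) (p : M) :
    TangentSpace 𝓘(ℝ, EuSp n) p →L[ℝ] TangentSpace 𝓘(ℝ, EuSp n) p →L[ℝ] ℝ :=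
  (𝓢.g.inner p).comp (κ.J p)

end Sasakian

/-! ### Surfaces in Sasakian manifolds and the Legendrian mean curvature flow -/

section Flow

variable {n : ℕ} {M : Type*} [TopologicalSpace M] [ChartedSpace (EuSp n) M]
  [IsManifold 𝓘(ℝ, EuSp n) ∞ M]
  {S : Type*} [TopologicalSpace S] [ChartedSpace (EuSp 2) S] [IsManifold 𝓘(ℝ, EuSp 2) ∞ S]

/-- The differential of a map `F` from a surface to `M`. -/
abbrev diff (F : S → M) (x : S) :
    TangentSpace 𝓘(ℝ, EuSp 2) x →L[ℝ] TangentSpace 𝓘(ℝ, EuSp n) (F x) :=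
  mfderiv 𝓘(ℝ, EuSp 2) 𝓘(ℝ, EuSp n) F x

/-- The pull-back `F^* B` of a field of bilinear forms. -/
def pullback
    (B : ∀ q : M, TangentSpace 𝓘(ℝ, EuSp n) q →L[ℝ] TangentSpace 𝓘(ℝ, EuSp n) q →L[ℝ] ℝ)
    (F : S → M) (x : S) :
    TangentSpace 𝓘(ℝ, EuSp 2) x →L[ℝ] TangentSpace 𝓘(ℝ, EuSp 2) x →L[ℝ] ℝ :=
  pullForm (B (F x)) (diff F x)

/-- `F` in the preferred charts at `x₀` and `q₀`. -/
def locMap (F : S → M) (x₀ : S) (q₀ : M) (y : EuSp 2) : EuSp n :=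
  extChartAt 𝓘(ℝ, EuSp n) q₀ (F ((extChartAt 𝓘(ℝ, EuSp 2) x₀).symm y))

/-- The second fundamental form `A(u,v)` at `x` of an immersion `F`, for the induced metric. -/
def secondFund (𝓢 : SasakianStructure n M) (F : S → M) (x : S)
    (u v : TangentSpace 𝓘(ℝ, EuSp 2) x) : TangentSpace 𝓘(ℝ, EuSp n) (F x) :=
  secondFundLocal (locBilin (pullback 𝓢.g.inner F) x) (locBilin 𝓢.g.inner (F x))
    (locMap F x (F x)) (extChartAt 𝓘(ℝ, EuSp 2) x x) u v

/-- The Laplacian at `x` of a function on the surface, for the metric induced by `F`. -/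
def surfaceLaplacian (𝓢 : SasakianStructure n M) (F : S → M) (a : S → ℝ) (x : S) : ℝ :=
  laplacian (locBilin (pullback 𝓢.g.inner F) x)
    (fun y => a ((extChartAt 𝓘(ℝ, EuSp 2) x).symm y)) (extChartAt 𝓘(ℝ, EuSp 2) x x)

variable (S) in
/-- A smooth nowhere vanishing two-form on the surface; it represents an orientation. -/
structure AreaForm where
  form : ∀ x : S, TangentSpace 𝓘(ℝ, EuSp 2) x →L[ℝ] TangentSpace 𝓘(ℝ, EuSp 2) x →L[ℝ] ℝ
  smooth : ContMDiff 𝓘(ℝ, EuSp 2) (𝓘(ℝ, EuSp 2).prod 𝓘(ℝ, EuSp 2 →L[ℝ] EuSp 2 →L[ℝ] ℝ)) ∞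
    (fun x => TotalSpace.mk' (EuSp 2 →L[ℝ] EuSp 2 →L[ℝ] ℝ)
      (E := fun z : S => TangentSpace 𝓘(ℝ, EuSp 2) z →L[ℝ] TangentSpace 𝓘(ℝ, EuSp 2) z →L[ℝ] ℝ)
      x (form x))
  alternating : ∀ x v, form x v v = 0
  nonzero : ∀ x, form x ≠ 0

/-- The Hodge star of a two-form `β` on the oriented Euclidean plane `(ℝ², G, μ)`: the quotient of
`β` by the area form `± √(det G) dx¹ ∧ dx²`, the sign being that of `μ`. -/
def hodgeStar (G μ β : EuSp 2 →L[ℝ] EuSp 2 →L[ℝ] ℝ) : ℝ :=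
  β (coordVec 0) (coordVec 1) /
    (Real.sign (μ (coordVec 0) (coordVec 1)) *
      Real.sqrt (G (coordVec 0) (coordVec 0) * G (coordVec 1) (coordVec 1)
        - G (coordVec 0) (coordVec 1) ^ 2))

/-- `Ω = *(F^* ω̄)`, the star being that of the induced metric. -/
def starOmega {𝓢 : SasakianStructure n M} (κ : ParallelTransverseKahlerForm 𝓢) (μ : AreaForm S)
    (F : S → M) (x : S) : ℝ :=
  hodgeStar (pullback 𝓢.g.inner F x) (μ.form x) (pullback κ.form F x)

/-- `(e₁, e₂)` is an oriented orthonormal basis of the tangent plane at `x`, for the metric induced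
by `F`. -/
def IsOrientedFrame (𝓢 : SasakianStructure n M) (μ : AreaForm S) (F : S → M) (x : S)
    (e₁ e₂ : TangentSpace 𝓘(ℝ, EuSp 2) x) : Prop :=
  pullback 𝓢.g.inner F x e₁ e₁ = 1 ∧ pullback 𝓢.g.inner F x e₂ e₂ = 1 ∧
    pullback 𝓢.g.inner F x e₁ e₂ = 0 ∧ 0 < μ.form x e₁ e₂

/-- `|A|²`, computed in an orthonormal frame. -/
def normSqSecondFund (𝓢 : SasakianStructure n M) (F : S → M) (x : S)
    (e₁ e₂ : TangentSpace 𝓘(ℝ, EuSp 2) x) : ℝ :=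
  ∑ i : Fin 2, ∑ j : Fin 2,
    𝓢.g.inner (F x) (secondFund 𝓢 F x (![e₁, e₂] i) (![e₁, e₂] j))
      (secondFund 𝓢 F x (![e₁, e₂] i) (![e₁, e₂] j))

/-- `|H|²` with `H = A(e₁,e₁) + A(e₂,e₂)`, computed in an orthonormal frame. -/
def normSqMeanCurv (𝓢 : SasakianStructure n M) (F : S → M) (x : S)
    (e₁ e₂ : TangentSpace 𝓘(ℝ, EuSp 2) x) : ℝ :=
  𝓢.g.inner (F x) (secondFund 𝓢 F x e₁ e₁ + secondFund 𝓢 F x e₂ e₂)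
    (secondFund 𝓢 F x e₁ e₁ + secondFund 𝓢 F x e₂ e₂)

/-- A smooth Legendrian mean curvature flow `F : S × [0,T) → M` of immersed Legendrian surfaces,
with Legendrian angle `α`: `H = -∇^k α Φ(∂_k F)` and `∂F/∂t = H - 2 α ξ`. The last two equations are
written in coordinates, in all the preferred charts of the surface and of `M`. -/
structure IsLegendrianMCF (𝓢 : SasakianStructure n M) (T : ℝ) (F : ℝ → S → M) (α : ℝ → S → ℝ) :
    Prop where
  smooth : ContMDiffOn (𝓘(ℝ, ℝ).prod 𝓘(ℝ, EuSp 2)) 𝓘(ℝ, EuSp n) ∞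
    (fun q : ℝ × S => F q.1 q.2) (Ico 0 T ×ˢ univ)
  smooth_angle : ContMDiffOn (𝓘(ℝ, ℝ).prod 𝓘(ℝ, EuSp 2)) 𝓘(ℝ, ℝ) ∞
    (fun q : ℝ × S => α q.1 q.2) (Ico 0 T ×ˢ univ)
  immersion : ∀ t ∈ Ico 0 T, ∀ x, Function.Injective (diff (n := n) (F t) x)
  legendrian : ∀ t ∈ Ico 0 T, ∀ x v, 𝓢.η (F t x) (diff (F t) x v) = 0
  angle : ∀ t ∈ Ico 0 T, ∀ (x₀ : S) (q₀ : M), ∀ y ∈ (extChartAt 𝓘(ℝ, EuSp 2) x₀).target,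
    F t ((extChartAt 𝓘(ℝ, EuSp 2) x₀).symm y) ∈ (extChartAt 𝓘(ℝ, EuSp n) q₀).source →
    meanCurvLocal (locBilin (pullback 𝓢.g.inner (F t)) x₀) (locBilin 𝓢.g.inner q₀)
        (locMap (F t) x₀ q₀) y
      = -locEnd 𝓢.Φ q₀ (locMap (F t) x₀ q₀ y) (fderiv ℝ (locMap (F t) x₀ q₀) y
          (gradient (locBilin (pullback 𝓢.g.inner (F t)) x₀)
            (fun z => α t ((extChartAt 𝓘(ℝ, EuSp 2) x₀).symm z)) y))
  evolves : ∀ t ∈ Ico 0 T, ∀ (x₀ : S) (q₀ : M), ∀ y ∈ (extChartAt 𝓘(ℝ, EuSp 2) x₀).target,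
    F t ((extChartAt 𝓘(ℝ, EuSp 2) x₀).symm y) ∈ (extChartAt 𝓘(ℝ, EuSp n) q₀).source →
    derivWithin (fun s => locMap (F s) x₀ q₀ y) (Ico 0 T) t
      = meanCurvLocal (locBilin (pullback 𝓢.g.inner (F t)) x₀) (locBilin 𝓢.g.inner q₀)
          (locMap (F t) x₀ q₀) y
        - (2 * α t ((extChartAt 𝓘(ℝ, EuSp 2) x₀).symm y)) •
            locVec 𝓢.ξ q₀ (locMap (F t) x₀ q₀ y)

/-- The surface is, infinitesimally, a graph over each of the two factors `ker (J - Φ)` and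
`ker (J + Φ)` of `ker η`: its tangent planes meet both of them trivially. -/
def IsTransverseGraph {𝓢 : SasakianStructure n M} (κ : ParallelTransverseKahlerForm 𝓢)
    (F : S → M) : Prop :=
  ∀ x, ∀ v : TangentSpace 𝓘(ℝ, EuSp 2) x, v ≠ 0 →
    κ.J (F x) (diff F x v) ≠ 𝓢.Φ (F x) (diff F x v) ∧
      κ.J (F x) (diff F x v) ≠ -𝓢.Φ (F x) (diff F x v)

end Flow

end LegendrianFlow

end

/-!
The evolution equation is a computation with the Tanaka-Webster connection `D` of the Sasakian
manifold (`webster`). It leaves `g`, `ξ`, `η` and `Φ` parallel, its torsion is a multiple of `ξ`,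
and on `ker η` it is the transverse Levi-Civita connection (`covTrans_eq`). Hence `J` is parallel
for it too, and the transverse curvature is the curvature `R` of `D` (`curvTrans_eq`). This
replaces the transverse geometry by that of an honest connection on the tangent bundle whose
torsion is explicit.

For a Legendrian immersion `f` the derivatives `V₁, V₂` are horizontal, `g(Φ V₁, V₂) = 0`, and the
Hessian `D df` is symmetric and horizontal, with `g(D df(u, v), Φ df(w))` totally symmetric
(`hess_phi`): `f` behaves as a Lagrangian immersion into a Kähler surface. In a chart
`Ω = g(J V₁, V₂) / √(area²)`. Along the flow, the Reeb part `-2αξ` of the velocity and the torsion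
only contribute multiples of `ξ` to the derivative of `df`, and `g(J ·, ·)` and the pairing with
`df` do not see these; so `∂Ω/∂t` is the linearization of `Ω` in the direction `D H`
(`evolution_local`). On the other side, since `g` and `J` are parallel, `ΔΩ` is expressed by `D df`
and its first derivatives. The Ricci identity (`covAlong_hess`) rewrites `D H` in the same
quantities, at the cost of curvature terms. What remains is an identity in the Legendrian frame
`V₁, V₂, Φ V₁, Φ V₂, ξ` (`evolution_identity`, `linearized_omega`). The quadratic terms collapse
because `J` commutes with `Φ`, so that `g(J ·, ·)` has only four components in the frame, bound by
the relations that come from `J² = -1` on `ker η`. The curvature terms become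
`(1 - Ω²) Ricᵀ(J V₁, V₂)` (`curvature_relations`): the pair symmetry and the Bianchi identity of
`R` express the Ricci form by the trace of `J R(V₁, V₂)`, and `R(V₁, V₂)` commutes with both `J`
and `Φ`, so that its traceless part is a multiple of `J` unless `J = ±Φ`.

If `M` is `η`-Einstein, then `Ricᵀ = (K + 2) g` on `ker η`, because `Ric = Ricᵀ - 2 g` there
(`ricci_eq`), and the last term of the evolution equation is `(K + 2)(1 - Ω²) Ω`. As `2|A|² ≥ |H|²`
and `Ω² ≤ 1`, the time derivative of `Ω` at a positive spatial minimum is bounded below by a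
constant multiple of `Ω`; the scalar maximum principle (`pos_of_deriv_at_min`) then keeps `Ω`
positive. Finally, if a tangent vector `v` satisfied `J v = ± Φ v`, the form `g(J ·, ·)` would
agree with `± g(Φ ·, ·)` in a frame that contains `v`; the latter vanishes on Legendrian planes, so
that `Ω` would be zero (`isTransverseGraph`).
-/

open Set Manifold Bundle
open scoped ContDiff

noncomputable section

set_option synthInstance.maxHeartbeats 200000

namespace LegendrianFlow

/-! ### Inner products on `ℝⁿ` and Christoffel symbols -/

section LinearAlgebra

variable {n : ℕ}

lemma sum_smul_coordVec (v : EuSp n) : ∑ i, v i • coordVec i = v := by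
  ext j
  simp [coordVec, Finset.sum_apply, Pi.single_apply]

/-- A symmetric positive definite bilinear form. -/
structure IsInner (b : EuSp n →L[ℝ] EuSp n →L[ℝ] ℝ) : Prop where
  symm : ∀ u v, b u v = b v u
  pos : ∀ v, v ≠ 0 → 0 < b v v

lemma IsInner.ext {b : EuSp n →L[ℝ] EuSp n →L[ℝ] ℝ} (hb : IsInner b) {u v : EuSp n}
    (h : ∀ w, b u w = b v w) : u = v := by
  by_contra hne
  have h1 := hb.pos (u - v) (sub_ne_zero.2 hne)
  have h2 := h (u - v)
  simp only [map_sub, sub_apply] at h1 h2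
  linarith

lemma IsInner.det_ne_zero {b : EuSp n →L[ℝ] EuSp n →L[ℝ] ℝ} (hb : IsInner b) :
    (Matrix.of fun i j : Fin n => b (coordVec i) (coordVec j)).det ≠ 0 := by
  intro h
  obtain ⟨v, hv, h0⟩ := Matrix.exists_mulVec_eq_zero_iff.2 h
  set w : EuSp n := ∑ j, v j • coordVec j with hw
  have hwv : ∀ j, w j = v j := by
    intro j; simp [hw, coordVec, Finset.sum_apply, Pi.single_apply]
  have hb0 : w = 0 := by
    refine hb.ext fun u => ?_
    rw [← sum_smul_coordVec u]
    simp only [map_sum, map_smul, map_zero, zero_apply, smul_eq_mul, mul_zero,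
      Finset.sum_const_zero]
    refine Finset.sum_eq_zero fun i _ => ?_
    have := congrFun h0 i
    simp only [Matrix.mulVec, dotProduct, Matrix.of_apply, Pi.zero_apply] at this
    rw [hb.symm, hw]
    simp only [map_sum, map_smul, smul_eq_mul]
    rw [show ∑ j, v j * b (coordVec i) (coordVec j) = 0 by rw [← this]; simp [mul_comm], mul_zero]
  apply hv
  ext j
  rw [← hwv, hb0]; rfl

/-- Raising an index: `g^{kl} φ_l ∂_k` is the vector that represents the linear form `φ`. -/
lemma IsInner.invGram_solve {b : EuSp n →L[ℝ] EuSp n →L[ℝ] ℝ} (hb : IsInner b)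
    (φ : EuSp n →ₗ[ℝ] ℝ) (w : EuSp n) :
    b (∑ k, (∑ l, invGram b k l * φ (coordVec l)) • coordVec k) w = φ w := by
  have key : ∀ j, b (∑ k, (∑ l, invGram b k l * φ (coordVec l)) • coordVec k) (coordVec j)
      = φ (coordVec j) := by
    intro j
    have h1 : ∀ l, ∑ k, invGram b k l * b (coordVec k) (coordVec j)
        = if j = l then 1 else 0 := by
      intro l
      have := congrFun (congrFun (Matrix.mul_nonsing_inv
        (Matrix.of fun i j : Fin n => b (coordVec i) (coordVec j)) hb.det_ne_zero.isUnit) j) l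
      rw [Matrix.one_apply, Matrix.mul_apply] at this
      rw [← this]
      refine Finset.sum_congr rfl fun k _ => ?_
      rw [hb.symm, mul_comm]; rfl
    simp only [map_sum, map_smul, sum_apply, smul_apply,
      smul_eq_mul, Finset.sum_mul]
    rw [Finset.sum_comm]
    calc ∑ l, ∑ k, invGram b k l * φ (coordVec l) * b (coordVec k) (coordVec j)
        = ∑ l, φ (coordVec l) * ∑ k, invGram b k l * b (coordVec k) (coordVec j) := by
          refine Finset.sum_congr rfl fun l _ => ?_
          rw [Finset.mul_sum]
          exact Finset.sum_congr rfl fun k _ => by ring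
      _ = φ (coordVec j) := by simp [h1]
  conv_lhs => rw [← sum_smul_coordVec w]
  conv_rhs => rw [← sum_smul_coordVec w]
  simp only [map_sum, map_smul] at key ⊢
  exact Finset.sum_congr rfl fun j _ => by rw [key]

/-- A frame that is orthonormal for a bilinear form, as a basis. -/
def frameBasis [NeZero n] {b : EuSp n →L[ℝ] EuSp n →L[ℝ] ℝ} {e : Fin n → EuSp n}
    (he : ∀ i j, b (e i) (e j) = if i = j then 1 else 0) : Module.Basis (Fin n) ℝ (EuSp n) :=
  basisOfLinearIndependentOfCardEqFinrank (b := e)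
    (by
      rw [Fintype.linearIndependent_iff]
      intro c hc i
      have : b (∑ j, c j • e j) (e i) = 0 := by rw [hc]; simp
      simpa [map_sum, he] using this) (by simp)

lemma frameBasis_apply [NeZero n] {b : EuSp n →L[ℝ] EuSp n →L[ℝ] ℝ} {e : Fin n → EuSp n}
    (he : ∀ i j, b (e i) (e j) = if i = j then 1 else 0) (i : Fin n) : frameBasis he i = e i := by
  simp [frameBasis]

lemma frameBasis_repr [NeZero n] {b : EuSp n →L[ℝ] EuSp n →L[ℝ] ℝ} {e : Fin n → EuSp n}
    (he : ∀ i j, b (e i) (e j) = if i = j then 1 else 0) (v : EuSp n) (i : Fin n) :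
    (frameBasis he).repr v i = b v (e i) := by
  conv_rhs => rw [← (frameBasis he).sum_repr v]
  simp [map_sum, frameBasis_apply, he]

lemma frame_expansion [NeZero n] {b : EuSp n →L[ℝ] EuSp n →L[ℝ] ℝ} {e : Fin n → EuSp n}
    (he : ∀ i j, b (e i) (e j) = if i = j then 1 else 0) (v : EuSp n) :
    v = ∑ i, b v (e i) • e i := by
  conv_lhs => rw [← (frameBasis he).sum_repr v]
  simp [frameBasis_repr, frameBasis_apply]

/-- The trace of an endomorphism in coordinates and in an orthonormal frame. -/
lemma sum_coord_eq_sum_frame [NeZero n] {b : EuSp n →L[ℝ] EuSp n →L[ℝ] ℝ} {e : Fin n → EuSp n}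
    (he : ∀ i j, b (e i) (e j) = if i = j then 1 else 0) (A : EuSp n →ₗ[ℝ] EuSp n) :
    ∑ i, A (coordVec i) i = ∑ i, b (A (e i)) (e i) := by
  have h1 : LinearMap.trace ℝ _ A = ∑ i, b (A (e i)) (e i) := by
    rw [LinearMap.trace_eq_matrix_trace ℝ (frameBasis he), Matrix.trace]
    simp [LinearMap.toMatrix_apply, frameBasis_apply, frameBasis_repr]
  rw [← h1, LinearMap.trace_eq_matrix_trace ℝ (EuclideanSpace.basisFun (Fin n) ℝ).toBasis,
    Matrix.trace]
  simp [LinearMap.toMatrix_apply, coordVec]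

end LinearAlgebra

section Christoffel

variable {n : ℕ} {P : Type*} [NormedAddCommGroup P] [NormedSpace ℝ P]

lemma contDiffOn_det {s : Set P} {A : P → Matrix (Fin n) (Fin n) ℝ} {k : WithTop ℕ∞}
    (hA : ∀ i j, ContDiffOn ℝ k (fun p => A p i j) s) : ContDiffOn ℝ k (fun p => (A p).det) s := by
  simp only [Matrix.det_apply]
  exact ContDiffOn.sum fun σ _ => (contDiffOn_prod fun i _ => hA _ _).const_smul _

lemma contDiffOn_invGram {s : Set P} {G : P → EuSp n →L[ℝ] EuSp n →L[ℝ] ℝ} {k : WithTop ℕ∞}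
    (hG : ContDiffOn ℝ k G s) (hpos : ∀ p ∈ s, IsInner (G p)) (i j : Fin n) :
    ContDiffOn ℝ k (fun p => invGram (G p) i j) s := by
  have hent : ∀ i j, ContDiffOn ℝ k (fun p => (Matrix.of fun i j : Fin n =>
      G p (coordVec i) (coordVec j)) i j) s := fun i j =>
    (hG.clm_apply contDiffOn_const).clm_apply contDiffOn_const
  simp only [invGram, Matrix.inv_def, Matrix.smul_apply, Ring.inverse_eq_inv', smul_eq_mul]
  refine ((contDiffOn_det hent).inv fun p hp => (hpos p hp).det_ne_zero).mul ?_
  simp only [Matrix.adjugate_apply]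
  refine contDiffOn_det fun a b => ?_
  by_cases h : a = j
  · subst h; simpa using contDiffOn_const
  · simpa [Matrix.updateRow_ne h] using hent a b

/-- The Koszul formula. -/
lemma christoffel_spec {G : EuSp n → EuSp n →L[ℝ] EuSp n →L[ℝ] ℝ} {y : EuSp n}
    (hG : IsInner (G y)) (u v w : EuSp n) :
    G y (christoffel G y u v) w = (1 / 2 : ℝ) *
      (fderiv ℝ G y u v w + fderiv ℝ G y v u w - fderiv ℝ G y w u v) := by
  unfold christoffel
  generalize fderiv ℝ G y = D
  exact hG.invGram_solve ((1 / 2 : ℝ) • ((D u v : EuSp n →ₗ[ℝ] ℝ) + (D v u : EuSp n →ₗ[ℝ] ℝ)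
    - (((D : EuSp n →L[ℝ] EuSp n →L[ℝ] EuSp n →L[ℝ] ℝ).flip u).flip v : EuSp n →ₗ[ℝ] ℝ))) w

lemma christoffel_add_left (G : EuSp n → EuSp n →L[ℝ] EuSp n →L[ℝ] ℝ) (y u u' v : EuSp n) :
    christoffel G y (u + u') v = christoffel G y u v + christoffel G y u' v := by
  unfold christoffel
  generalize fderiv ℝ G y = D
  simp only [← Finset.sum_add_distrib, ← add_smul, ← mul_add, map_add, add_apply]
  refine Finset.sum_congr rfl fun k _ => ?_
  congr 1
  exact Finset.sum_congr rfl fun l _ => by ring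

lemma christoffel_smul_left (G : EuSp n → EuSp n →L[ℝ] EuSp n →L[ℝ] ℝ) (y : EuSp n) (c : ℝ)
    (u v : EuSp n) : christoffel G y (c • u) v = c • christoffel G y u v := by
  unfold christoffel
  generalize fderiv ℝ G y = D
  simp only [Finset.smul_sum, smul_smul, Finset.mul_sum, map_smul, smul_apply, smul_eq_mul]
  refine Finset.sum_congr rfl fun k _ => ?_
  congr 1
  exact Finset.sum_congr rfl fun l _ => by ring

lemma christoffel_add_right (G : EuSp n → EuSp n →L[ℝ] EuSp n →L[ℝ] ℝ) (y u v v' : EuSp n) :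
    christoffel G y u (v + v') = christoffel G y u v + christoffel G y u v' := by
  unfold christoffel
  generalize fderiv ℝ G y = D
  simp only [← Finset.sum_add_distrib, ← add_smul, ← mul_add, map_add, add_apply]
  refine Finset.sum_congr rfl fun k _ => ?_
  congr 1
  exact Finset.sum_congr rfl fun l _ => by ring

lemma christoffel_smul_right (G : EuSp n → EuSp n →L[ℝ] EuSp n →L[ℝ] ℝ) (y : EuSp n) (c : ℝ)
    (u v : EuSp n) : christoffel G y u (c • v) = c • christoffel G y u v := by
  unfold christoffel
  generalize fderiv ℝ G y = D
  simp only [Finset.smul_sum, smul_smul, Finset.mul_sum, map_smul, smul_apply, smul_eq_mul]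
  refine Finset.sum_congr rfl fun k _ => ?_
  congr 1
  exact Finset.sum_congr rfl fun l _ => by ring

/-- The Christoffel symbols as a bilinear map. -/
def chr (G : EuSp n → EuSp n →L[ℝ] EuSp n →L[ℝ] ℝ) (y : EuSp n) :
    EuSp n →L[ℝ] EuSp n →L[ℝ] EuSp n :=
  LinearMap.toContinuousBilinearMap (LinearMap.mk₂ ℝ (christoffel G y)
    (christoffel_add_left G y) (christoffel_smul_left G y)
    (christoffel_add_right G y) (christoffel_smul_right G y))

lemma chr_apply (G : EuSp n → EuSp n →L[ℝ] EuSp n →L[ℝ] ℝ) (y u v : EuSp n) :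
    chr G y u v = christoffel G y u v := rfl

lemma fderiv_apply₂ {E : Type*} [NormedAddCommGroup E] [NormedSpace ℝ E]
    {G : P → EuSp n →L[ℝ] EuSp n →L[ℝ] E} {y : P}
    (hd : DifferentiableAt ℝ G y) (w : P) (u v : EuSp n) :
    fderiv ℝ G y w u v = fderiv ℝ (fun z => G z u v) y w := by
  rw [fderiv_clm_apply (hd.clm_apply (differentiableAt_const _)) (differentiableAt_const _),
    fderiv_clm_apply hd (differentiableAt_const _)]
  simp

lemma contDiffOn_fderiv_const {E : Type*} [NormedAddCommGroup E] [NormedSpace ℝ E] {U : Set P}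
    (hU : IsOpen U) {f : P → E} (hf : ContDiffOn ℝ ∞ f U) (u : P) :
    ContDiffOn ℝ ∞ (fun z => fderiv ℝ f z u) U :=
  (hf.fderiv_of_isOpen hU (by simp)).clm_apply contDiffOn_const

lemma contDiffOn_christoffel {U : Set (EuSp n)} (hU : IsOpen U)
    {G : EuSp n → EuSp n →L[ℝ] EuSp n →L[ℝ] ℝ} (hG : ContDiffOn ℝ ∞ G U)
    (hpos : ∀ y ∈ U, IsInner (G y)) (u v : EuSp n) :
    ContDiffOn ℝ ∞ (fun y => christoffel G y u v) U := by
  have hd' : ∀ a b c : EuSp n, ContDiffOn ℝ ∞ (fun y => fderiv ℝ G y a b c) U := by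
    intro a b c
    refine (contDiffOn_fderiv_const hU (f := fun y => G y b c)
      ((hG.clm_apply contDiffOn_const).clm_apply contDiffOn_const) a).congr fun y hy => ?_
    exact fderiv_apply₂ ((hG.contDiffAt (hU.mem_nhds hy)).differentiableAt (by simp)) _ _ _
  unfold christoffel
  refine ContDiffOn.sum fun k _ => ?_
  refine ContDiffOn.fun_smul (ContDiffOn.sum fun l _ => ?_) contDiffOn_const
  exact (contDiffOn_invGram hG hpos k l).mul
    (contDiffOn_const.mul (((hd' _ _ _).add (hd' _ _ _)).sub (hd' _ _ _)))

lemma christoffel_congr {G G' : EuSp n → EuSp n →L[ℝ] EuSp n →L[ℝ] ℝ} {y : EuSp n}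
    (h : G =ᶠ[nhds y] G') (u v : EuSp n) : christoffel G y u v = christoffel G' y u v := by
  simp only [christoffel, h.fderiv_eq, h.self_of_nhds]

/-- Symmetry of a field of bilinear forms passes to its derivative. -/
lemma fderiv_symm {G : EuSp n → EuSp n →L[ℝ] EuSp n →L[ℝ] ℝ} {y : EuSp n}
    (hd : DifferentiableAt ℝ G y) (hs : ∀ᶠ z in nhds y, ∀ u v, G z u v = G z v u)
    (w u v : EuSp n) : fderiv ℝ G y w u v = fderiv ℝ G y w v u := by
  rw [fderiv_apply₂ hd, fderiv_apply₂ hd]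
  have : (fun z => G z u v) =ᶠ[nhds y] fun z => G z v u := hs.mono fun z hz => hz u v
  rw [this.fderiv_eq]

lemma christoffel_symm {G : EuSp n → EuSp n →L[ℝ] EuSp n →L[ℝ] ℝ} {y : EuSp n}
    (hG : IsInner (G y)) (hd : DifferentiableAt ℝ G y)
    (hs : ∀ᶠ z in nhds y, ∀ u v, G z u v = G z v u) (u v : EuSp n) :
    christoffel G y u v = christoffel G y v u := by
  refine hG.ext fun w => ?_
  rw [christoffel_spec hG, christoffel_spec hG, fderiv_symm hd hs w u v]
  ring

/-- The Levi-Civita connection is metric. -/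
lemma christoffel_metric {G : EuSp n → EuSp n →L[ℝ] EuSp n →L[ℝ] ℝ} {y : EuSp n}
    (hG : IsInner (G y)) (hd : DifferentiableAt ℝ G y)
    (hs : ∀ᶠ z in nhds y, ∀ u v, G z u v = G z v u) (u v w : EuSp n) :
    fderiv ℝ G y u v w = G y (christoffel G y u v) w + G y v (christoffel G y u w) := by
  rw [hG.symm v, christoffel_spec hG, christoffel_spec hG, fderiv_symm hd hs u w v,
    fderiv_symm hd hs w u v, fderiv_symm hd hs v u w]
  ring

end Christoffel

/-! ### The Tanaka-Webster connection and the calculus of connections on `ℝⁿ` -/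

/-- The coordinate expression, on an open subset `U` of `ℝⁿ`, of a Sasakian structure together with
the complex structure `J` of a parallel transverse Kähler form. -/
structure IsSasakianChart {n : ℕ} (U : Set (EuSp n)) (G : EuSp n → EuSp n →L[ℝ] EuSp n →L[ℝ] ℝ)
    (η : EuSp n → EuSp n →L[ℝ] ℝ) (ξ : EuSp n → EuSp n) (Φ J : EuSp n → EuSp n →L[ℝ] EuSp n) :
    Prop where
  isOpen : IsOpen U
  smooth_G : ContDiffOn ℝ ∞ G U
  smooth_η : ContDiffOn ℝ ∞ η U
  smooth_ξ : ContDiffOn ℝ ∞ ξ U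
  smooth_Φ : ContDiffOn ℝ ∞ Φ U
  smooth_J : ContDiffOn ℝ ∞ J U
  inner : ∀ y ∈ U, IsInner (G y)
  eta_reeb : ∀ y ∈ U, η y (ξ y) = 1
  metric_reeb : ∀ y ∈ U, ∀ v, G y (ξ y) v = η y v
  phi_sq : ∀ y ∈ U, ∀ v, Φ y (Φ y v) = -(v - η y v • ξ y)
  phi_reeb : ∀ y ∈ U, Φ y (ξ y) = 0
  metric_eq : ∀ y ∈ U, ∀ u v, G y u v = η y u * η y v
    + (1 / 2 : ℝ) * (fderiv ℝ η y u (Φ y v) - fderiv ℝ η y (Φ y v) u)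
  nabla_phi : ∀ y ∈ U, ∀ u v,
    covDeriv G (fun _ => u) (fun z => Φ z v) y - Φ y (covDeriv G (fun _ => u) (fun _ => v) y)
      = η y v • u - G y u v • ξ y
  J_reeb : ∀ y ∈ U, J y (ξ y) = 0
  J_sq : ∀ y ∈ U, ∀ v, J y (J y v) = -(v - η y v • ξ y)
  J_orthogonal : ∀ y ∈ U, ∀ v w, G y (J y v) (J y w) = G y v w - η y v * η y w
  J_comm : ∀ y ∈ U, ∀ v, J y (Φ y v) = Φ y (J y v)
  parallel : ∀ y ∈ U, ∀ u v w,
    fderiv ℝ (fun z => G z (J z (horiz η ξ z v)) (horiz η ξ z w)) y u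
      = G y (J y (covTrans G η ξ (fun _ => u) (fun z => horiz η ξ z v) y)) (horiz η ξ y w)
        + G y (J y (horiz η ξ y v)) (covTrans G η ξ (fun _ => u) (fun z => horiz η ξ z w) y)


/-- The Tanaka-Webster connection `D = ∂ + C`, given by its Christoffel symbols
`C(u,v) = Γ(u,v) - η(u) Φ v - η(v) Φ u + g(Φ u, v) ξ`. All the structure tensors are parallel for
it; its torsion is `2 g(Φ u, v) ξ`. -/
def webster {n : ℕ} (G : EuSp n → EuSp n →L[ℝ] EuSp n →L[ℝ] ℝ)
    (η : EuSp n → EuSp n →L[ℝ] ℝ) (ξ : EuSp n → EuSp n) (Φ : EuSp n → EuSp n →L[ℝ] EuSp n)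
    (y : EuSp n) : EuSp n →L[ℝ] EuSp n →L[ℝ] EuSp n :=
  chr G y - (η y).smulRight (Φ y) - ((η y).smulRight (Φ y)).flip
    + (ContinuousLinearMap.compL ℝ (EuSp n) ℝ (EuSp n)
        (ContinuousLinearMap.toSpanSingleton ℝ (ξ y))).comp ((G y).comp (Φ y))


lemma webster_apply {n : ℕ} (G : EuSp n → EuSp n →L[ℝ] EuSp n →L[ℝ] ℝ)
    (η : EuSp n → EuSp n →L[ℝ] ℝ) (ξ : EuSp n → EuSp n) (Φ : EuSp n → EuSp n →L[ℝ] EuSp n)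
    (y u v : EuSp n) : webster G η ξ Φ y u v = christoffel G y u v - η y u • Φ y v - η y v • Φ y u
      + G y (Φ y u) v • ξ y := by
  simp [webster, chr_apply]

/-- The derivative of the field `X` in the constant direction `u`, for the connection with
Christoffel symbols `C`. -/
def dirDeriv {E : Type*} [NormedAddCommGroup E] [NormedSpace ℝ E] (C : E → E →L[ℝ] E →L[ℝ] E)
    (u : E) (X : E → E) (y : E) : E :=
  fderiv ℝ X y u + C y u (X y)

/-- The curvature `R(u,v)w` of the connection with Christoffel symbols `C`. -/
def curvOf {E : Type*} [NormedAddCommGroup E] [NormedSpace ℝ E] (C : E → E →L[ℝ] E →L[ℝ] E)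
    (y u v w : E) : E :=
  fderiv ℝ C y u v w + C y u (C y v w) - (fderiv ℝ C y v u w + C y v (C y u w))

/-- The endomorphism `u ↦ R(u,v)w`. -/
def curvLin {E : Type*} [NormedAddCommGroup E] [NormedSpace ℝ E] (C : E → E →L[ℝ] E →L[ℝ] E)
    (y v w : E) : E →ₗ[ℝ] E :=
  ((ContinuousLinearMap.flip (ContinuousLinearMap.flip (fderiv ℝ C y) v) w
    + (C y).flip (C y v w) - ((fderiv ℝ C y v).flip w + (C y v).comp ((C y).flip w)) : E →L[ℝ] E) :
      E →ₗ[ℝ] E)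

lemma curvLin_apply {E : Type*} [NormedAddCommGroup E] [NormedSpace ℝ E]
    (C : E → E →L[ℝ] E →L[ℝ] E) (y u v w : E) : curvLin C y v w u = curvOf C y u v w := rfl

section Calculus

variable {P E F : Type*} [NormedAddCommGroup P] [NormedSpace ℝ P] [NormedAddCommGroup E]
  [NormedSpace ℝ E] [NormedAddCommGroup F] [NormedSpace ℝ F]

lemma fderiv_fderiv_comm {f : P → F} {y : P} (hf : ContDiffAt ℝ ∞ f y) (u v : P) :
    fderiv ℝ (fun z => fderiv ℝ f z v) y u = fderiv ℝ (fun z => fderiv ℝ f z u) y v := by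
  have hd : DifferentiableAt ℝ (fderiv ℝ f) y :=
    (hf.fderiv_right (m := 1) (by norm_cast)).differentiableAt one_ne_zero
  have key : ∀ a b, fderiv ℝ (fun z => fderiv ℝ f z b) y a = fderiv ℝ (fderiv ℝ f) y a b := by
    intro a b
    rw [fderiv_clm_apply hd (differentiableAt_const _)]
    simp
  rw [key, key]
  exact (hf.isSymmSndFDerivAt (by simp; norm_cast)).eq u v

lemma HasFDerivWithinAt.bilin_apply {B : P → E →L[ℝ] E →L[ℝ] F} {B' : P →L[ℝ] E →L[ℝ] E →L[ℝ] F}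
    {X Y : P → E} {X' Y' : P →L[ℝ] E} {s : Set P} {p : P} (hB : HasFDerivWithinAt B B' s p)
    (hX : HasFDerivWithinAt X X' s p) (hY : HasFDerivWithinAt Y Y' s p) :
    ∃ L : P →L[ℝ] F, HasFDerivWithinAt (fun q => B q (X q) (Y q)) L s p ∧
      ∀ u, L u = B' u (X p) (Y p) + B p (X' u) (Y p) + B p (X p) (Y' u) :=
  ⟨_, (hB.clm_apply hX).clm_apply hY, fun u => by simp; abel⟩

end Calculus

section Curvature

variable {E : Type*} [NormedAddCommGroup E] [NormedSpace ℝ E] {U : Set E}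
  {C : E → E →L[ℝ] E →L[ℝ] E}

lemma dirDeriv_const (u w y : E) : dirDeriv C u (fun _ => w) y = C y u w := by
  simp [dirDeriv]

lemma dirDeriv_congr {X Y : E → E} {y : E} (h : X =ᶠ[nhds y] Y) (u : E) :
    dirDeriv C u X y = dirDeriv C u Y y := by
  rw [dirDeriv, dirDeriv, h.fderiv_eq, h.self_of_nhds]

lemma dirDeriv_contDiffOn (hU : IsOpen U) (hC : ContDiffOn ℝ ∞ C U) {X : E → E}
    (hX : ContDiffOn ℝ ∞ X U) (u : E) : ContDiffOn ℝ ∞ (dirDeriv C u X) U :=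
  (contDiffOn_fderiv_const hU hX u).add ((hC.clm_apply contDiffOn_const).clm_apply hX)

/-- The Ricci identity. -/
lemma dirDeriv_comm (hU : IsOpen U) (hC : ContDiffOn ℝ ∞ C U) {X : E → E}
    (hX : ContDiffOn ℝ ∞ X U) {y : E} (hy : y ∈ U) (u v : E) :
    dirDeriv C u (dirDeriv C v X) y - dirDeriv C v (dirDeriv C u X) y = curvOf C y u v (X y) := by
  have hn := hU.mem_nhds hy
  have hXd := (hX.contDiffAt hn).differentiableAt (by simp)
  have hCd := (hC.contDiffAt hn).differentiableAt (by simp)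
  have key : ∀ a b, dirDeriv C a (dirDeriv C b X) y = fderiv ℝ (fun z => fderiv ℝ X z b) y a
      + (fderiv ℝ C y a b (X y) + C y b (fderiv ℝ X y a))
      + (C y a (fderiv ℝ X y b) + C y a (C y b (X y))) := by
    intro a b
    have h1 : DifferentiableAt ℝ (fun z => fderiv ℝ X z b) y :=
      ((contDiffOn_fderiv_const hU hX b).contDiffAt hn).differentiableAt (by simp)
    have h2 : DifferentiableAt ℝ (fun z => C z b) y := hCd.clm_apply (differentiableAt_const _)
    have h3 : DifferentiableAt ℝ (fun z => C z b (X z)) y := h2.clm_apply hXd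
    have h4 : fderiv ℝ (dirDeriv C b X) y a = fderiv ℝ (fun z => fderiv ℝ X z b) y a
        + fderiv ℝ (fun z => C z b (X z)) y a := by
      change fderiv ℝ (fun z => fderiv ℝ X z b + C z b (X z)) y a = _
      rw [fderiv_fun_add h1 h3]; rfl
    unfold dirDeriv at h4 ⊢
    rw [h4, fderiv_clm_apply h2 hXd, fderiv_clm_apply hCd (differentiableAt_const _)]
    simp
    abel
  rw [key, key, fderiv_fderiv_comm (hX.contDiffAt hn) u v]
  simp only [curvOf]
  abel

/-- An endomorphism field that is parallel on `U` commutes with the covariant derivative. -/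
lemma dirDeriv_end {A : E → E →L[ℝ] E} {X : E → E} {y : E}
    (hA : DifferentiableAt ℝ A y) (hX : DifferentiableAt ℝ X y)
    (hpar : ∀ u v, fderiv ℝ A y u v = A y (C y u v) - C y u (A y v)) (u : E) :
    dirDeriv C u (fun z => A z (X z)) y = A y (dirDeriv C u X y) := by
  unfold dirDeriv
  rw [fderiv_clm_apply hA hX]
  simp only [add_apply, ContinuousLinearMap.comp_apply, ContinuousLinearMap.flip_apply, hpar,
    map_add]
  abel

/-- The curvature commutes with a parallel endomorphism field. -/
lemma curvOf_comm_end (hU : IsOpen U) (hC : ContDiffOn ℝ ∞ C U)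
    {A : E → E →L[ℝ] E} (hA : ContDiffOn ℝ ∞ A U)
    (hpar : ∀ y ∈ U, ∀ u v, fderiv ℝ A y u v = A y (C y u v) - C y u (A y v)) {y : E}
    (hy : y ∈ U) (u v w : E) : curvOf C y u v (A y w) = A y (curvOf C y u v w) := by
  have hn := hU.mem_nhds hy
  have hd : ∀ z ∈ U, DifferentiableAt ℝ A z := fun z hz =>
    (hA.contDiffAt (hU.mem_nhds hz)).differentiableAt (by simp)
  have key : ∀ a b, dirDeriv C a (dirDeriv C b (fun z => A z w)) y
      = A y (dirDeriv C a (dirDeriv C b fun _ => w) y) := by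
    intro a b
    have h1 : dirDeriv C b (fun z => A z w) =ᶠ[nhds y]
        fun z => A z (dirDeriv C b (fun _ => w) z) := by
      filter_upwards [hn] with z hz
      exact dirDeriv_end (hd z hz) (differentiableAt_const _) (hpar z hz) b
    rw [← dirDeriv_end (hd y hy) (((dirDeriv_contDiffOn hU hC contDiffOn_const b).contDiffAt
      hn).differentiableAt (by simp)) (hpar y hy) a]
    exact dirDeriv_congr h1 a
  rw [← dirDeriv_comm hU hC (X := fun z => A z w) (hA.clm_apply contDiffOn_const) hy, key, key,
    ← map_sub, dirDeriv_comm hU hC contDiffOn_const hy]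

/-- The curvature annihilates a parallel vector field. -/
lemma curvOf_parallel (hU : IsOpen U) (hC : ContDiffOn ℝ ∞ C U) {X : E → E}
    (hX : ContDiffOn ℝ ∞ X U) (hpar : ∀ y ∈ U, ∀ u, dirDeriv C u X y = 0) {y : E}
    (hy : y ∈ U) (u v : E) : curvOf C y u v (X y) = 0 := by
  have key : ∀ a b, dirDeriv C a (dirDeriv C b X) y = 0 := by
    intro a b
    have h1 : dirDeriv C b X =ᶠ[nhds y] fun _ => 0 := by
      filter_upwards [hU.mem_nhds hy] with z hz using hpar z hz b
    rw [dirDeriv, h1.fderiv_eq, h1.self_of_nhds]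
    simp
  rw [← dirDeriv_comm hU hC hX hy, key, key, sub_zero]

/-- The product rule for a form that is parallel. -/
lemma fderiv_form {B : E → E →L[ℝ] E →L[ℝ] ℝ} {X Y : E → E} {y : E}
    (hB : DifferentiableAt ℝ B y) (hX : DifferentiableAt ℝ X y) (hY : DifferentiableAt ℝ Y y)
    (hpar : ∀ u v w, fderiv ℝ B y u v w = B y (C y u v) w + B y v (C y u w)) (u : E) :
    fderiv ℝ (fun z => B z (X z) (Y z)) y u
      = B y (dirDeriv C u X y) (Y y) + B y (X y) (dirDeriv C u Y y) := by
  obtain ⟨L, hL, h⟩ := HasFDerivWithinAt.bilin_apply hB.hasFDerivAt.hasFDerivWithinAt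
    hX.hasFDerivAt.hasFDerivWithinAt (s := univ) hY.hasFDerivAt.hasFDerivWithinAt
  rw [(hL.hasFDerivAt_of_univ).fderiv, h, hpar]
  simp only [dirDeriv, map_add, add_apply]
  ring

/-- The curvature is skew for a parallel bilinear form: the second derivatives of `B(w, x)` for
constant `w`, `x` commute. -/
lemma curvOf_skew (hU : IsOpen U) (hC : ContDiffOn ℝ ∞ C U)
    {B : E → E →L[ℝ] E →L[ℝ] ℝ} (hB : ContDiffOn ℝ ∞ B U)
    (hpar : ∀ y ∈ U, ∀ u v w, fderiv ℝ B y u v w = B y (C y u v) w + B y v (C y u w))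
    {y : E} (hy : y ∈ U) (u v w x : E) :
    B y (curvOf C y u v w) x = -B y w (curvOf C y u v x) := by
  have hn := hU.mem_nhds hy
  have hd : ∀ z ∈ U, DifferentiableAt ℝ B z := fun z hz =>
    (hB.contDiffAt (hU.mem_nhds hz)).differentiableAt (by simp)
  have hdd : ∀ a b, DifferentiableAt ℝ (dirDeriv C a fun _ => b) y := fun a b =>
    ((dirDeriv_contDiffOn hU hC contDiffOn_const a).contDiffAt hn).differentiableAt (by simp)
  have key : ∀ a b, fderiv ℝ (fun z => fderiv ℝ (fun z => B z w x) z b) y a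
      = B y (dirDeriv C a (dirDeriv C b fun _ => w) y) x + B y (C y b w) (C y a x)
        + (B y (C y a w) (C y b x) + B y w (dirDeriv C a (dirDeriv C b fun _ => x) y)) := by
    intro a b
    have h1 : (fun z => fderiv ℝ (fun z => B z w x) z b) =ᶠ[nhds y]
        fun z => B z (dirDeriv C b (fun _ => w) z) x + B z w (dirDeriv C b (fun _ => x) z) := by
      filter_upwards [hn] with z hz
      exact fderiv_form (hd z hz) (differentiableAt_const _) (differentiableAt_const _)
        (hpar z hz) b
    rw [h1.fderiv_eq, fderiv_fun_add
      (((hd y hy).clm_apply (hdd _ _)).clm_apply (differentiableAt_const _))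
      (((hd y hy).clm_apply (differentiableAt_const _)).clm_apply (hdd _ _)), add_apply,
      fderiv_form (hd y hy) (hdd _ _) (differentiableAt_const _) (hpar y hy),
      fderiv_form (hd y hy) (differentiableAt_const _) (hdd _ _) (hpar y hy)]
    simp only [dirDeriv_const]
  have hsym := fderiv_fderiv_comm (f := fun z => B z w x) (y := y)
    (((hB.clm_apply contDiffOn_const).clm_apply contDiffOn_const).contDiffAt hn) u v
  rw [key, key] at hsym
  have h1 := dirDeriv_comm hU hC (X := fun _ => w) contDiffOn_const hy u v
  have h2 := dirDeriv_comm hU hC (X := fun _ => x) contDiffOn_const hy u v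
  rw [← h1, ← h2]
  simp only [map_sub, sub_apply]
  linarith

lemma curvOf_antisymm (C : E → E →L[ℝ] E →L[ℝ] E) (y u v w : E) :
    curvOf C y u v w = -curvOf C y v u w := by
  simp only [curvOf]; abel

end Curvature

/-! ### Tensors that are parallel for the Tanaka-Webster connection -/

namespace IsSasakianChart

variable {n : ℕ} {U : Set (EuSp n)} {G : EuSp n → EuSp n →L[ℝ] EuSp n →L[ℝ] ℝ}
  {η : EuSp n → EuSp n →L[ℝ] ℝ} {ξ : EuSp n → EuSp n} {Φ J : EuSp n → EuSp n →L[ℝ] EuSp n}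
  (h : IsSasakianChart U G η ξ Φ J) {y : EuSp n} (hy : y ∈ U)

include h hy

lemma eta_phi (v : EuSp n) : η y (Φ y v) = 0 := by
  have h1 := h.phi_sq y hy (Φ y v)
  rw [h.phi_sq y hy v, map_neg, map_sub, map_smul, h.phi_reeb y hy, smul_zero, sub_zero] at h1
  have h2 : η y (Φ y v) • ξ y = -(Φ y v - η y (Φ y v) • ξ y) + Φ y v := by module
  rw [← h1, neg_add_cancel] at h2
  simpa [h.eta_reeb y hy] using congrArg (η y) h2

lemma eta_J (v : EuSp n) : η y (J y v) = 0 := by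
  have h1 := h.J_sq y hy (J y v)
  rw [h.J_sq y hy v, map_neg, map_sub, map_smul, h.J_reeb y hy, smul_zero, sub_zero] at h1
  have h2 : η y (J y v) • ξ y = -(J y v - η y (J y v) • ξ y) + J y v := by module
  rw [← h1, neg_add_cancel] at h2
  simpa [h.eta_reeb y hy] using congrArg (η y) h2

lemma symm (u v : EuSp n) : G y u v = G y v u := (h.inner y hy).symm u v

lemma metric_reeb' (v : EuSp n) : G y v (ξ y) = η y v := by
  rw [h.symm hy, h.metric_reeb y hy]

/-- By the compatibility of `g` with `dη`, the form `g(·, Φ ·)` is `-½ dη`. -/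
lemma phi_skew (u v : EuSp n) : G y (Φ y u) v = -G y u (Φ y v) := by
  have h0 : ∀ w, fderiv ℝ η y (ξ y) w - fderiv ℝ η y w (ξ y) = 0 := by
    intro w
    have h1 := h.metric_eq y hy (ξ y) (Φ y w)
    rw [h.metric_reeb y hy, h.eta_phi hy, h.phi_sq y hy] at h1
    simp only [map_neg, map_sub, map_smul, neg_apply, sub_apply, smul_apply, smul_eq_mul] at h1
    linarith
  have key : ∀ u v, G y u (Φ y v)
      = -(1 / 2 : ℝ) * (fderiv ℝ η y u v - fderiv ℝ η y v u) := by
    intro u v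
    have h1 := h.metric_eq y hy u (Φ y v)
    rw [h.eta_phi hy, h.phi_sq y hy] at h1
    simp only [map_neg, map_sub, map_smul, neg_apply, sub_apply, smul_apply, smul_eq_mul] at h1
    have := h0 u
    rw [h1]
    linear_combination (-(1 / 2 : ℝ) * η y v) * this
  rw [h.symm hy, key, key]
  ring

lemma J_skew (u v : EuSp n) : G y (J y u) v = -G y u (J y v) := by
  have h1 := h.J_orthogonal y hy u (J y v)
  rw [h.J_sq y hy, h.eta_J hy] at h1
  simp only [map_neg, map_sub, map_smul, smul_eq_mul, h.metric_reeb' hy, h.eta_J hy] at h1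
  linarith

lemma phi_orthogonal (u v : EuSp n) : G y (Φ y u) (Φ y v) = G y u v - η y u * η y v := by
  rw [h.phi_skew hy, h.phi_sq y hy]
  simp only [map_neg, map_sub, map_smul, smul_eq_mul, h.metric_reeb' hy]
  ring

lemma diff_G : DifferentiableAt ℝ G y :=
  (h.smooth_G.contDiffAt (h.isOpen.mem_nhds hy)).differentiableAt (by simp)

lemma diff_η : DifferentiableAt ℝ η y :=
  (h.smooth_η.contDiffAt (h.isOpen.mem_nhds hy)).differentiableAt (by simp)

lemma diff_ξ : DifferentiableAt ℝ ξ y :=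
  (h.smooth_ξ.contDiffAt (h.isOpen.mem_nhds hy)).differentiableAt (by simp)

lemma diff_Φ : DifferentiableAt ℝ Φ y :=
  (h.smooth_Φ.contDiffAt (h.isOpen.mem_nhds hy)).differentiableAt (by simp)

lemma diff_J : DifferentiableAt ℝ J y :=
  (h.smooth_J.contDiffAt (h.isOpen.mem_nhds hy)).differentiableAt (by simp)

lemma eventually_symm : ∀ᶠ z in nhds y, ∀ u v, G z u v = G z v u := by
  filter_upwards [h.isOpen.mem_nhds hy] with z hz using h.symm hz

lemma chr_metric (u v w : EuSp n) :
    fderiv ℝ G y u v w = G y (christoffel G y u v) w + G y v (christoffel G y u w) :=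
  christoffel_metric (h.inner y hy) (h.diff_G hy) (h.eventually_symm hy) u v w

lemma chr_symm (u v : EuSp n) : christoffel G y u v = christoffel G y v u :=
  christoffel_symm (h.inner y hy) (h.diff_G hy) (h.eventually_symm hy) u v

lemma nabla_phi' (u v : EuSp n) : fderiv ℝ Φ y u v
    = Φ y (christoffel G y u v) - christoffel G y u (Φ y v) + η y v • u - G y u v • ξ y := by
  have h1 := h.nabla_phi y hy u v
  simp only [covDeriv] at h1
  rw [fderiv_clm_apply (h.diff_Φ hy) (differentiableAt_const _)] at h1
  simp only [fderiv_const_apply, add_apply, ContinuousLinearMap.comp_apply, zero_apply,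
    map_zero, zero_add, ContinuousLinearMap.flip_apply] at h1
  rw [add_sub_assoc, ← h1]
  abel

/-- `∇_u ξ = Φ u`; this follows from the equation for `∇ Φ` by differentiating `Φ ξ = 0` and
`g(ξ, ξ) = 1`. -/
lemma nabla_reeb (u : EuSp n) : fderiv ℝ ξ y u = Φ y u - christoffel G y u (ξ y) := by
  have hn := h.isOpen.mem_nhds hy
  have hphi : Φ y (fderiv ℝ ξ y u) + fderiv ℝ Φ y u (ξ y) = 0 := by
    have h1 : (fun z => Φ z (ξ z)) =ᶠ[nhds y] fun _ => 0 := by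
      filter_upwards [hn] with z hz using h.phi_reeb z hz
    have h2 := h1.fderiv_eq (𝕜 := ℝ)
    rw [fderiv_clm_apply (h.diff_Φ hy) (h.diff_ξ hy)] at h2
    simpa using congrArg (fun L => L u) h2
  have hunit : G y (fderiv ℝ ξ y u) (ξ y) * 2 + fderiv ℝ G y u (ξ y) (ξ y) = 0 := by
    have h1 : (fun z => G z (ξ z) (ξ z)) =ᶠ[nhds y] fun _ => 1 := by
      filter_upwards [hn] with z hz
      rw [h.metric_reeb z hz, h.eta_reeb z hz]
    have h2 := h1.fderiv_eq (𝕜 := ℝ)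
    obtain ⟨L, hL, hLu⟩ := HasFDerivWithinAt.bilin_apply (s := univ)
      (h.diff_G hy).hasFDerivAt.hasFDerivWithinAt
      (h.diff_ξ hy).hasFDerivAt.hasFDerivWithinAt (h.diff_ξ hy).hasFDerivAt.hasFDerivWithinAt
    rw [hL.hasFDerivAt_of_univ.fderiv] at h2
    have h3 := hLu u
    rw [h2] at h3
    simp only [fderiv_const_apply, zero_apply] at h3
    rw [h.symm hy (ξ y)] at h3
    linarith
  rw [h.chr_metric hy, h.symm hy (ξ y)] at hunit
  rw [h.nabla_phi' hy, h.eta_reeb y hy, h.phi_reeb y hy, h.metric_reeb' hy,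
    show christoffel G y u 0 = 0 from (chr G y u).map_zero] at hphi
  set X := fderiv ℝ ξ y u + christoffel G y u (ξ y) - Φ y u with hX
  have hηX : η y X = 0 := by
    rw [← h.metric_reeb' hy, hX]
    simp only [map_sub, map_add, sub_apply, add_apply]
    rw [h.metric_reeb' hy (Φ y u), h.eta_phi hy]
    linarith
  have hΦX : Φ y X = 0 := by
    rw [hX, map_sub, map_add, h.phi_sq y hy, ← hphi]
    module
  have h0 : X = 0 := by
    have := h.phi_sq y hy X
    rw [hΦX, map_zero, hηX, zero_smul, sub_zero] at this
    exact neg_eq_zero.1 this.symm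
  rw [hX] at h0
  rw [sub_eq_zero] at h0
  rw [← h0]; abel

omit hy in
lemma contDiffOn_webster : ContDiffOn ℝ ∞ (webster G η ξ Φ) U := by
  refine contDiffOn_clm_apply.2 fun u => contDiffOn_clm_apply.2 fun v => ?_
  simp only [webster_apply]
  have hη : ∀ u, ContDiffOn ℝ ∞ (fun z => η z u) U := fun u => h.smooth_η.clm_apply contDiffOn_const
  have hΦ : ∀ u, ContDiffOn ℝ ∞ (fun z => Φ z u) U := fun u => h.smooth_Φ.clm_apply contDiffOn_const
  exact (((contDiffOn_christoffel h.isOpen h.smooth_G h.inner u v).sub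
    ((hη u).fun_smul (hΦ v))).sub ((hη v).fun_smul (hΦ u))).add
    (((h.smooth_G.clm_apply (hΦ u)).clm_apply contDiffOn_const).fun_smul h.smooth_ξ)

/-- The Tanaka-Webster connection is metric. -/
lemma webster_metric (u v w : EuSp n) : fderiv ℝ G y u v w
    = G y (webster G η ξ Φ y u v) w + G y v (webster G η ξ Φ y u w) := by
  rw [h.chr_metric hy]
  simp only [webster_apply, map_add, map_sub, map_smul, add_apply, sub_apply, smul_apply,
    smul_eq_mul, h.metric_reeb y hy, h.metric_reeb' hy]
  rw [h.phi_skew hy v w, h.symm hy v (Φ y u)]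
  ring

lemma webster_reeb (u : EuSp n) : dirDeriv (webster G η ξ Φ) u ξ y = 0 := by
  rw [dirDeriv, webster_apply, h.nabla_reeb hy, h.phi_reeb y hy, h.eta_reeb y hy,
    h.metric_reeb' hy, h.eta_phi hy]
  module

lemma webster_torsion (u v : EuSp n) : webster G η ξ Φ y u v - webster G η ξ Φ y v u
    = (2 * G y (Φ y u) v) • ξ y := by
  rw [webster_apply, webster_apply, h.chr_symm hy u v, h.phi_skew hy v u, h.symm hy v (Φ y u)]
  module

lemma webster_phi (u v : EuSp n) : fderiv ℝ Φ y u v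
    = Φ y (webster G η ξ Φ y u v) - webster G η ξ Φ y u (Φ y v) := by
  rw [h.nabla_phi' hy]
  simp only [webster_apply, map_add, map_sub, map_smul, h.phi_sq y hy, h.phi_reeb y hy,
    h.eta_phi hy, h.phi_orthogonal hy]
  module

lemma webster_eta (u v : EuSp n) : fderiv ℝ η y u v = η y (webster G η ξ Φ y u v) := by
  have h1 : (fun z => η z v) =ᶠ[nhds y] fun z => G z (ξ z) v := by
    filter_upwards [h.isOpen.mem_nhds hy] with z hz using (h.metric_reeb z hz v).symm
  have h2 := h1.fderiv_eq (𝕜 := ℝ)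
  have h3 := fderiv_form (h.diff_G hy) (h.diff_ξ hy) (differentiableAt_const v)
    (h.webster_metric hy) u
  rw [← h2, fderiv_clm_apply (h.diff_η hy) (differentiableAt_const _), h.webster_reeb hy,
    dirDeriv_const, h.metric_reeb y hy] at h3
  simpa using h3

omit h hy in
lemma contDiffOn_horiz {s : Set (EuSp n)} (hη : ContDiffOn ℝ ∞ η s) (hξ : ContDiffOn ℝ ∞ ξ s)
    {X : EuSp n → EuSp n} (hX : ContDiffOn ℝ ∞ X s) :
    ContDiffOn ℝ ∞ (fun z => horiz η ξ z (X z)) s :=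
  hX.sub ((hη.clm_apply hX).fun_smul hξ)

/-- The projection to `ker η` is parallel for the Tanaka-Webster connection. -/
lemma webster_horiz {X : EuSp n → EuSp n} (hX : DifferentiableAt ℝ X y) (u : EuSp n) :
    dirDeriv (webster G η ξ Φ) u (fun z => horiz η ξ z (X z)) y
      = horiz η ξ y (dirDeriv (webster G η ξ Φ) u X y) := by
  have hηX : DifferentiableAt ℝ (fun z => η z (X z)) y := (h.diff_η hy).clm_apply hX
  have h1 : fderiv ℝ (fun z => η z (X z)) y u = η y (dirDeriv (webster G η ξ Φ) u X y) := by
    rw [fderiv_clm_apply (h.diff_η hy) hX]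
    simp only [add_apply, ContinuousLinearMap.comp_apply, ContinuousLinearMap.flip_apply,
      h.webster_eta hy, dirDeriv, map_add]
  have h2 : fderiv ℝ (fun z => horiz η ξ z (X z)) y u
      = fderiv ℝ X y u - (η y (X y) • fderiv ℝ ξ y u
        + η y (dirDeriv (webster G η ξ Φ) u X y) • ξ y) := by
    unfold horiz
    rw [fderiv_fun_sub hX (hηX.fun_smul (h.diff_ξ hy)), fderiv_fun_smul hηX (h.diff_ξ hy)]
    simp only [sub_apply, add_apply, smul_apply, ContinuousLinearMap.smulRight_apply, h1]
  have h3 := h.webster_reeb hy u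
  rw [dirDeriv, h2]
  simp only [horiz, map_sub, map_smul]
  rw [dirDeriv] at h3 ⊢
  rw [eq_neg_of_add_eq_zero_left h3]
  module

/-- The transverse Levi-Civita connection is the restriction of the Tanaka-Webster connection. -/
lemma covTrans_eq {X Y : EuSp n → EuSp n} (hY : DifferentiableAt ℝ Y y)
    (hYη : ∀ᶠ z in nhds y, η z (Y z) = 0) :
    covTrans G η ξ X Y y = dirDeriv (webster G η ξ Φ) (X y) Y y := by
  have hdη : ∀ u, η y (dirDeriv (webster G η ξ Φ) u Y y) = 0 := by
    intro u
    have h1 : (fun z => η z (Y z)) =ᶠ[nhds y] fun _ => 0 := hYη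
    have h2 := congrArg (fun L => L u) (h1.fderiv_eq (𝕜 := ℝ))
    rw [fderiv_clm_apply (h.diff_η hy) hY] at h2
    simpa [h.webster_eta hy, dirDeriv, add_comm] using h2
  have h0 : η y (Y y) = 0 := hYη.self_of_nhds
  have hh : ∀ u, horiz η ξ y (dirDeriv (webster G η ξ Φ) u Y y)
      = dirDeriv (webster G η ξ Φ) u Y y := by
    intro u; rw [horiz, hdη, zero_smul, sub_zero]
  have hhξ : ∀ (c : ℝ) (u : EuSp n), horiz η ξ y (u + c • ξ y) = horiz η ξ y u := by
    intro c u
    simp only [horiz, map_add, map_smul, h.eta_reeb y hy, smul_eq_mul, mul_one]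
    module
  have e1 : ∀ u, η y u = 0 → covDeriv G (fun _ => u) Y y
      = dirDeriv (webster G η ξ Φ) u Y y + (-G y (Φ y u) (Y y)) • ξ y := by
    intro u hu
    simp only [covDeriv, dirDeriv, webster_apply, hu, h0]
    module
  have e2 : fderiv ℝ Y y (ξ y) - fderiv ℝ ξ y (Y y) = dirDeriv (webster G η ξ Φ) (ξ y) Y y := by
    simp only [dirDeriv, webster_apply, h.nabla_reeb hy, h0, h.phi_reeb y hy, h.eta_reeb y hy,
      h.chr_symm hy (Y y) (ξ y), map_zero, zero_apply]
    module
  have hπ : η y (horiz η ξ y (X y)) = 0 := by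
    simp [horiz, h.eta_reeb y hy]
  have e3 : covDeriv G (fun z => horiz η ξ z (X z)) Y y
      = covDeriv G (fun _ => horiz η ξ y (X y)) Y y := rfl
  rw [covTrans, e3, e1 _ hπ, e2, hhξ, hh, hh]
  have e4 : ∀ u v : EuSp n, ∀ c : ℝ, dirDeriv (webster G η ξ Φ) (u + c • v) Y y
      = dirDeriv (webster G η ξ Φ) u Y y + c • dirDeriv (webster G η ξ Φ) v Y y := by
    intro u v c
    simp only [dirDeriv, map_add, map_smul, add_apply, smul_apply]
    module
  rw [← e4]
  congr 1
  simp [horiz]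

lemma eta_horiz (v : EuSp n) : η y (horiz η ξ y v) = 0 := by
  simp [horiz, h.eta_reeb y hy]

lemma J_horiz (v : EuSp n) : J y (horiz η ξ y v) = J y v := by
  simp [horiz, h.J_reeb y hy]

omit h hy in
lemma horiz_of_eta {v : EuSp n} (hv : η y v = 0) : horiz η ξ y v = v := by
  simp [horiz, hv]

lemma form_horiz (v w : EuSp n) : G y (J y v) (horiz η ξ y w) = G y (J y v) w := by
  simp [horiz, h.metric_reeb' hy, h.eta_J hy]

/-- `J` is parallel for the Tanaka-Webster connection. -/
lemma webster_J (u v : EuSp n) : fderiv ℝ J y u v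
    = J y (webster G η ξ Φ y u v) - webster G η ξ Φ y u (J y v) := by
  have hn := h.isOpen.mem_nhds hy
  have hcov : ∀ v, covTrans G η ξ (fun _ => u) (fun z => horiz η ξ z v) y
      = horiz η ξ y (webster G η ξ Φ y u v) := by
    intro v
    have hd : DifferentiableAt ℝ (fun z => horiz η ξ z v) y :=
      ((contDiffOn_horiz h.smooth_η h.smooth_ξ contDiffOn_const).contDiffAt hn).differentiableAt
        (by simp)
    rw [h.covTrans_eq hy hd (by filter_upwards [hn] with z hz using h.eta_horiz hz v),
      h.webster_horiz hy (differentiableAt_const v), dirDeriv_const]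
  refine (h.inner y hy).ext fun w => ?_
  have h1 := h.parallel y hy u v w
  have h2 : (fun z => G z (J z (horiz η ξ z v)) (horiz η ξ z w)) =ᶠ[nhds y]
      fun z => G z (J z v) w := by
    filter_upwards [hn] with z hz
    rw [h.form_horiz hz, h.J_horiz hz]
  have hJv : DifferentiableAt ℝ (fun z => J z v) y :=
    (h.diff_J hy).clm_apply (differentiableAt_const _)
  rw [h2.fderiv_eq, hcov, hcov, h.J_horiz hy, h.J_horiz hy, h.form_horiz hy, h.form_horiz hy,
    fderiv_form (h.diff_G hy) hJv (differentiableAt_const _) (h.webster_metric hy), dirDeriv,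
    dirDeriv_const, fderiv_clm_apply (h.diff_J hy) (differentiableAt_const _)] at h1
  simp only [fderiv_const_apply, add_apply, ContinuousLinearMap.comp_apply, zero_apply,
    map_zero, zero_add, ContinuousLinearMap.flip_apply, map_add] at h1
  simp only [map_sub, sub_apply]
  linarith

end IsSasakianChart

/-! ### The curvature of the Tanaka-Webster connection and the transverse Ricci tensor -/


/-- A bilinear map evaluated on a skew endomorphism: `∑ T(J e, e) = -∑ T(e, J e)`. -/
lemma sum_skew_frame {n : ℕ} [NeZero n] {b : EuSp n →L[ℝ] EuSp n →L[ℝ] ℝ} {e : Fin n → EuSp n}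
    (he : ∀ i j, b (e i) (e j) = if i = j then 1 else 0) (hs : ∀ u v, b u v = b v u)
    {A : EuSp n → EuSp n} (hA : ∀ u v, b (A u) v = -b u (A v))
    (T : EuSp n →ₗ[ℝ] EuSp n →ₗ[ℝ] ℝ) :
    ∑ i, T (A (e i)) (e i) = -∑ i, T (e i) (A (e i)) := by
  have h1 : ∀ i, T (A (e i)) (e i) = ∑ j, b (A (e i)) (e j) * T (e j) (e i) := by
    intro i
    conv_lhs => rw [frame_expansion he (A (e i))]
    simp
  have h2 : ∀ i, T (e i) (A (e i)) = ∑ j, b (A (e i)) (e j) * T (e i) (e j) := by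
    intro i
    conv_lhs => rw [frame_expansion he (A (e i))]
    simp
  simp only [h1, h2]
  rw [Finset.sum_comm, ← Finset.sum_neg_distrib]
  refine Finset.sum_congr rfl fun i _ => ?_
  rw [← Finset.sum_neg_distrib]
  refine Finset.sum_congr rfl fun j _ => ?_
  rw [hA, hs]
  ring

lemma covTrans_congr {n : ℕ} {G : EuSp n → EuSp n →L[ℝ] EuSp n →L[ℝ] ℝ}
    {η : EuSp n → EuSp n →L[ℝ] ℝ} {ξ : EuSp n → EuSp n} {y : EuSp n} {X Y Z : EuSp n → EuSp n}
    (hYZ : Y =ᶠ[nhds y] Z) : covTrans G η ξ X Y y = covTrans G η ξ X Z y := by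
  simp only [covTrans, covDeriv, hYZ.fderiv_eq, hYZ.self_of_nhds]

namespace IsSasakianChart

variable {n : ℕ} {U : Set (EuSp n)} {G : EuSp n → EuSp n →L[ℝ] EuSp n →L[ℝ] ℝ}
  {η : EuSp n → EuSp n →L[ℝ] ℝ} {ξ : EuSp n → EuSp n} {Φ J : EuSp n → EuSp n →L[ℝ] EuSp n}
  (h : IsSasakianChart U G η ξ Φ J) {y : EuSp n} (hy : y ∈ U)

include h hy

lemma curv_skew (u v w x : EuSp n) : G y (curvOf (webster G η ξ Φ) y u v w) x
    = -G y w (curvOf (webster G η ξ Φ) y u v x) :=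
  curvOf_skew h.isOpen h.contDiffOn_webster h.smooth_G (fun _ hz => h.webster_metric hz) hy u v w x

lemma curv_phi (u v w : EuSp n) : curvOf (webster G η ξ Φ) y u v (Φ y w)
    = Φ y (curvOf (webster G η ξ Φ) y u v w) :=
  curvOf_comm_end h.isOpen h.contDiffOn_webster h.smooth_Φ (fun _ hz => h.webster_phi hz) hy u v w

lemma curv_J (u v w : EuSp n) : curvOf (webster G η ξ Φ) y u v (J y w)
    = J y (curvOf (webster G η ξ Φ) y u v w) :=
  curvOf_comm_end h.isOpen h.contDiffOn_webster h.smooth_J (fun _ hz => h.webster_J hz) hy u v w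

lemma curv_reeb (u v : EuSp n) : curvOf (webster G η ξ Φ) y u v (ξ y) = 0 :=
  curvOf_parallel h.isOpen h.contDiffOn_webster h.smooth_ξ (fun _ hz => h.webster_reeb hz) hy u v

lemma eta_curv (u v w : EuSp n) : η y (curvOf (webster G η ξ Φ) y u v w) = 0 := by
  rw [← h.metric_reeb' hy, h.curv_skew hy, h.curv_reeb hy, map_zero, neg_zero]

/-- The first Bianchi identity. The torsion `T(u,v) = 2 g(Φ u, v) ξ` does not contribute, since it
is parallel and `T(T(u,v), w) = 0`. -/
lemma bianchi (u v w : EuSp n) : curvOf (webster G η ξ Φ) y u v w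
    + curvOf (webster G η ξ Φ) y v w u + curvOf (webster G η ξ Φ) y w u v = 0 := by
  have hn := h.isOpen.mem_nhds hy
  have hCd : DifferentiableAt ℝ (webster G η ξ Φ) y :=
    (h.contDiffOn_webster.contDiffAt hn).differentiableAt (by simp)
  have hC2 : ∀ v w, DifferentiableAt ℝ (fun z => webster G η ξ Φ z v w) y := fun v w =>
    (hCd.clm_apply (differentiableAt_const _)).clm_apply (differentiableAt_const _)
  have key : ∀ u v w, fderiv ℝ (webster G η ξ Φ) y u v w - fderiv ℝ (webster G η ξ Φ) y u w v
      + (webster G η ξ Φ y u (webster G η ξ Φ y v w) - webster G η ξ Φ y u (webster G η ξ Φ y w v))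
      = (2 * (G y (webster G η ξ Φ y u w) (Φ y v) - G y (webster G η ξ Φ y u v) (Φ y w))) •
        ξ y := by
    intro u v w
    have hΦv : DifferentiableAt ℝ (fun z => Φ z v) y :=
      (h.diff_Φ hy).clm_apply (differentiableAt_const _)
    have h1 : (fun z => webster G η ξ Φ z v w - webster G η ξ Φ z w v)
        =ᶠ[nhds y] fun z => (2 * G z (Φ z v) w) • ξ z := by
      filter_upwards [hn] with z hz using h.webster_torsion hz v w
    have h2 := congrArg (fun L => L u) (h1.fderiv_eq (𝕜 := ℝ))
    have hs : DifferentiableAt ℝ (fun z => G z (Φ z v) w) y :=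
      ((h.diff_G hy).clm_apply hΦv).clm_apply (differentiableAt_const _)
    have h4 := fderiv_form (h.diff_G hy) hΦv (differentiableAt_const w) (h.webster_metric hy) u
    have h5 := h.webster_reeb hy u
    rw [dirDeriv_end (h.diff_Φ hy) (differentiableAt_const v) (h.webster_phi hy), dirDeriv_const,
      dirDeriv_const, h.phi_skew hy, h.symm hy (Φ y v)] at h4
    rw [fderiv_fun_sub (hC2 v w) (hC2 w v), sub_apply, ← fderiv_apply₂ hCd, ← fderiv_apply₂ hCd,
      fderiv_fun_smul (hs.const_mul 2) (h.diff_ξ hy), fderiv_const_mul hs] at h2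
    simp only [add_apply, smul_apply, ContinuousLinearMap.smulRight_apply, smul_eq_mul, h4] at h2
    rw [h2, ← map_sub, h.webster_torsion hy v w, map_smul]
    rw [dirDeriv] at h5
    rw [eq_neg_of_add_eq_zero_left h5]
    module
  have k1 := key u v w
  have k2 := key v w u
  have k3 := key w u v
  have t : ∀ a b c, G y (webster G η ξ Φ y a b) (Φ y c) = G y (webster G η ξ Φ y b a) (Φ y c) := by
    intro a b c
    have := congrArg (fun x => G y x (Φ y c)) (h.webster_torsion hy a b)
    simp only [map_sub, sub_apply, map_smul, smul_apply, h.metric_reeb y hy, h.eta_phi hy,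
      smul_zero] at this
    linarith
  rw [t u w v, t u v w] at k1
  rw [t v w u] at k2
  have hsum := congrArg₂ (· + ·) (congrArg₂ (· + ·) k1 k2) k3
  have e : curvOf (webster G η ξ Φ) y u v w
    + curvOf (webster G η ξ Φ) y v w u + curvOf (webster G η ξ Φ) y w u v
      = (2 * (G y (webster G η ξ Φ y w u) (Φ y v) - G y (webster G η ξ Φ y v u) (Φ y w))) • ξ y
       + (2 * (G y (webster G η ξ Φ y v u) (Φ y w) - G y (webster G η ξ Φ y w v) (Φ y u))) • ξ y
       + (2 * (G y (webster G η ξ Φ y w v) (Φ y u) - G y (webster G η ξ Φ y w u) (Φ y v))) •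
        ξ y := by
    rw [← hsum]
    simp only [curvOf]
    abel
  rw [e]
  module

/-- Pair symmetry, which follows as for the Levi-Civita connection from the skew symmetries and the
first Bianchi identity. -/
lemma curv_pair (a b c d : EuSp n) : G y (curvOf (webster G η ξ Φ) y a b c) d
    = G y (curvOf (webster G η ξ Φ) y c d a) b := by
  have hB : ∀ a b c d, G y (curvOf (webster G η ξ Φ) y a b c) d
      + G y (curvOf (webster G η ξ Φ) y b c a) d
      + G y (curvOf (webster G η ξ Φ) y c a b) d = 0 := by
    intro a b c d
    have := congrArg (fun x => G y x d) (h.bianchi hy a b c)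
    simpa using this
  have hA : ∀ a b c d, G y (curvOf (webster G η ξ Φ) y a b c) d
      = -G y (curvOf (webster G η ξ Φ) y b a c) d := by
    intro a b c d
    rw [curvOf_antisymm]; simp
  have hS : ∀ a b c d, G y (curvOf (webster G η ξ Φ) y a b c) d
      = -G y (curvOf (webster G η ξ Φ) y a b d) c := by
    intro a b c d
    rw [h.curv_skew hy, h.symm hy]
  have b1 := hB a b c d
  have b2 := hB b c d a
  have b3 := hB c d a b
  have b4 := hB d a b c
  have s1 := hS b c d a
  have s2 := hS c d b a
  have s3 := hS d b c a
  have s4 := hS c d a b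
  have s5 := hS d a c b
  have s6 := hS a c d b
  have s7 := hS d a b c
  have s8 := hS a b d c
  have s9 := hS b d a c
  have a1 := hA d b a c
  have a2 := hA c a b d
  have a3 := hA d b c a
  have a4 := hA a c d b
  linarith

lemma curv_reeb_left (v w : EuSp n) : curvOf (webster G η ξ Φ) y (ξ y) v w = 0 := by
  refine (h.inner y hy).ext fun x => ?_
  rw [h.curv_pair hy, h.curv_reeb hy, map_zero]; simp

/-- The transverse curvature is the curvature of the Tanaka-Webster connection; the latter
annihilates `ξ`, so that the horizontal extension of `w` does not matter. -/
lemma curvTrans_eq (u v w : EuSp n) :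
    curvTrans G η ξ y u v w = curvOf (webster G η ξ Φ) y u v w := by
  have hn := h.isOpen.mem_nhds hy
  have key : ∀ u v, covTrans G η ξ (fun _ => u) (covTrans G η ξ (fun _ => v) fun z =>
      horiz η ξ z w) y
      = horiz η ξ y (dirDeriv (webster G η ξ Φ) u (dirDeriv (webster G η ξ Φ) v fun _ => w) y) := by
    intro u v
    have hsm := dirDeriv_contDiffOn h.isOpen h.contDiffOn_webster
      (contDiffOn_const (c := w) (s := U) (n := ∞)) v
    have h1 : covTrans G η ξ (fun _ => v) (fun z => horiz η ξ z w) =ᶠ[nhds y]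
        fun z => horiz η ξ z (dirDeriv (webster G η ξ Φ) v (fun _ => w) z) := by
      filter_upwards [hn] with z hz
      have hn' := h.isOpen.mem_nhds hz
      rw [h.covTrans_eq hz (((contDiffOn_horiz h.smooth_η h.smooth_ξ contDiffOn_const).contDiffAt
        hn').differentiableAt (by simp)) (by filter_upwards [hn'] with x hx using h.eta_horiz hx w),
        h.webster_horiz hz (differentiableAt_const w)]
    rw [covTrans_congr h1, h.covTrans_eq hy (((contDiffOn_horiz h.smooth_η h.smooth_ξ
      hsm).contDiffAt hn).differentiableAt (by simp))
      (by filter_upwards [hn] with x hx using h.eta_horiz hx _),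
      h.webster_horiz hy ((hsm.contDiffAt hn).differentiableAt (by simp))]
  rw [curvTrans, key, key]
  have h2 := dirDeriv_comm h.isOpen h.contDiffOn_webster (X := fun _ => w) contDiffOn_const hy u v
  have h3 : ∀ a b, horiz η ξ y a - horiz η ξ y b = horiz η ξ y (a - b) := by
    intro a b; simp only [horiz, map_sub]; module
  rw [h3, h2, horiz_of_eta (h.eta_curv hy u v w)]

/-- The trace over `ker η` is the trace over all vectors, because `R(ξ, ·) = 0`. -/
lemma ricciTrans_eq [NeZero n] {e : Fin n → EuSp n}
    (he : ∀ i j, G y (e i) (e j) = if i = j then 1 else 0) (v w : EuSp n) :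
    ricciTrans G η ξ y v w = ∑ i, G y (curvOf (webster G η ξ Φ) y (e i) v w) (e i) := by
  have h1 : ∀ u, curvOf (webster G η ξ Φ) y (horiz η ξ y u) v w
      = curvOf (webster G η ξ Φ) y u v w := by
    intro u
    rw [← curvLin_apply, horiz, map_sub, map_smul, curvLin_apply, curvLin_apply,
      h.curv_reeb_left hy, smul_zero, sub_zero]
  simp only [ricciTrans, h.curvTrans_eq hy, h1]
  exact sum_coord_eq_sum_frame he (curvLin (webster G η ξ Φ) y v w)

/-- The Ricci form of a parallel complex structure is half the trace of `J R`, as on a Kähler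
manifold. -/
lemma ricciTrans_J [NeZero n] {e : Fin n → EuSp n}
    (he : ∀ i j, G y (e i) (e j) = if i = j then 1 else 0) (v w : EuSp n) :
    2 * ricciTrans G η ξ y (J y v) w
      = ∑ i, G y (J y (curvOf (webster G η ξ Φ) y v w (e i))) (e i) := by
  set R := curvOf (webster G η ξ Φ) y with hR
  have hanti : ∀ a b c d, G y (R a b c) d = -G y (R b a c) d := by
    intro a b c d
    rw [hR, curvOf_antisymm]; simp
  have hJ : ∀ a b c d, G y (R (J y a) b c) d = -G y (R a (J y b) c) d := by
    intro a b c d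
    rw [hR, h.curv_pair hy (J y a), h.curv_J hy, h.J_skew hy, h.curv_pair hy c]
  let T : EuSp n →ₗ[ℝ] EuSp n →ₗ[ℝ] ℝ := LinearMap.mk₂ ℝ (fun a b => G y (R a v w) b)
    (by intro a b c; rw [hR, ← curvLin_apply, map_add]; simp [curvLin_apply])
    (by intro a b c; rw [hR, ← curvLin_apply, map_smul]; simp [curvLin_apply])
    (by intro a b c; simp) (by intro a b c; simp)
  have hT : ∀ a b, T a b = G y (R a v w) b := fun _ _ => rfl
  have hS := sum_skew_frame he (h.symm hy) (h.J_skew hy) T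
  simp only [hT] at hS
  have e0 : ricciTrans G η ξ y (J y v) w = -∑ i, G y (R (J y (e i)) v w) (e i) := by
    rw [h.ricciTrans_eq hy he, ← Finset.sum_neg_distrib]
    exact Finset.sum_congr rfl fun i _ => by rw [hJ]; ring
  have e1 : ∀ i, G y (J y (R v w (e i))) (e i)
      = G y (R (e i) v w) (J y (e i)) - G y (R (J y (e i)) v w) (e i) := by
    intro i
    have hB := congrArg (fun x => G y x (J y (e i))) (h.bianchi hy (e i) v w)
    simp only [map_add, add_apply, map_zero, zero_apply] at hB
    rw [← hR] at hB
    have p1 : G y (R w (e i) v) (J y (e i)) = -G y (R (J y (e i)) v w) (e i) := by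
      have q1 : G y (R (e i) w v) (J y (e i)) = G y (R v (J y (e i)) (e i)) w :=
        h.curv_pair hy _ _ _ _
      have q2 : G y (R (J y (e i)) v (e i)) w = -G y (e i) (R (J y (e i)) v w) :=
        h.curv_skew hy _ _ _ _
      rw [hanti, q1, hanti, q2, h.symm hy, neg_neg]
    rw [h.J_skew hy]
    linarith
  rw [Finset.sum_congr rfl fun i _ => e1 i, Finset.sum_sub_distrib, two_mul]
  linarith

end IsSasakianChart

/-- The difference `∇ - D` of the Levi-Civita and the Tanaka-Webster connection. -/
def diffTensor {n : ℕ} (G : EuSp n → EuSp n →L[ℝ] EuSp n →L[ℝ] ℝ)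
    (η : EuSp n → EuSp n →L[ℝ] ℝ) (ξ : EuSp n → EuSp n) (Φ : EuSp n → EuSp n →L[ℝ] EuSp n)
    (y u v : EuSp n) : EuSp n :=
  η y u • Φ y v + η y v • Φ y u - G y (Φ y u) v • ξ y

lemma dirDeriv_smul {n : ℕ} {C : EuSp n → EuSp n →L[ℝ] EuSp n →L[ℝ] EuSp n} {a : EuSp n → ℝ}
    {X : EuSp n → EuSp n} {y : EuSp n} (ha : DifferentiableAt ℝ a y) (hX : DifferentiableAt ℝ X y)
    (u : EuSp n) : dirDeriv C u (fun z => a z • X z) y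
      = fderiv ℝ a y u • X y + a y • dirDeriv C u X y := by
  rw [dirDeriv, dirDeriv, fderiv_fun_smul ha hX]
  simp only [add_apply, smul_apply, ContinuousLinearMap.smulRight_apply, map_smul]
  module

lemma dirDeriv_add {n : ℕ} {C : EuSp n → EuSp n →L[ℝ] EuSp n →L[ℝ] EuSp n}
    {X Y : EuSp n → EuSp n} {y : EuSp n} (hX : DifferentiableAt ℝ X y)
    (hY : DifferentiableAt ℝ Y y) (u : EuSp n) : dirDeriv C u (fun z => X z + Y z) y
      = dirDeriv C u X y + dirDeriv C u Y y := by
  rw [dirDeriv, dirDeriv, dirDeriv, fderiv_fun_add hX hY]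
  simp only [add_apply, map_add]
  abel

lemma dirDeriv_sub {n : ℕ} {C : EuSp n → EuSp n →L[ℝ] EuSp n →L[ℝ] EuSp n}
    {X Y : EuSp n → EuSp n} {y : EuSp n} (hX : DifferentiableAt ℝ X y)
    (hY : DifferentiableAt ℝ Y y) (u : EuSp n) : dirDeriv C u (fun z => X z - Y z) y
      = dirDeriv C u X y - dirDeriv C u Y y := by
  rw [dirDeriv, dirDeriv, dirDeriv, fderiv_fun_sub hX hY]
  simp only [sub_apply, map_sub]
  abel

namespace IsSasakianChart

variable {n : ℕ} {U : Set (EuSp n)} {G : EuSp n → EuSp n →L[ℝ] EuSp n →L[ℝ] ℝ}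
  {η : EuSp n → EuSp n →L[ℝ] ℝ} {ξ : EuSp n → EuSp n} {Φ J : EuSp n → EuSp n →L[ℝ] EuSp n}
  (h : IsSasakianChart U G η ξ Φ J) {y : EuSp n} (hy : y ∈ U)

include h

/-- The difference of the two connections is parallel. -/
lemma dirDeriv_diffTensor (hy : y ∈ U) (u v w : EuSp n) :
    DifferentiableAt ℝ (fun z => diffTensor G η ξ Φ z v w) y ∧
    dirDeriv (webster G η ξ Φ) u (fun z => diffTensor G η ξ Φ z v w) y
      = diffTensor G η ξ Φ y (webster G η ξ Φ y u v) w
        + diffTensor G η ξ Φ y v (webster G η ξ Φ y u w) := by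
  have hη : ∀ v, DifferentiableAt ℝ (fun z => η z v) y := fun v =>
    (h.diff_η hy).clm_apply (differentiableAt_const _)
  have hΦ : ∀ v, DifferentiableAt ℝ (fun z => Φ z v) y := fun v =>
    (h.diff_Φ hy).clm_apply (differentiableAt_const _)
  have hs : DifferentiableAt ℝ (fun z => G z (Φ z v) w) y :=
    ((h.diff_G hy).clm_apply (hΦ v)).clm_apply (differentiableAt_const _)
  have d1 := (hη v).fun_smul (hΦ w)
  have d2 := (hη w).fun_smul (hΦ v)
  have d3 := hs.fun_smul (h.diff_ξ hy)
  have d12 := d1.fun_add d2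
  refine ⟨d12.fun_sub d3, ?_⟩
  have fη : ∀ v, fderiv ℝ (fun z => η z v) y u = η y (webster G η ξ Φ y u v) := by
    intro v
    rw [← h.webster_eta hy, fderiv_clm_apply (h.diff_η hy) (differentiableAt_const _)]
    simp
  have fΦ : ∀ v, dirDeriv (webster G η ξ Φ) u (fun z => Φ z v) y
      = Φ y (webster G η ξ Φ y u v) := by
    intro v
    rw [dirDeriv_end (h.diff_Φ hy) (differentiableAt_const v) (h.webster_phi hy), dirDeriv_const]
  have fs := fderiv_form (h.diff_G hy) (hΦ v) (differentiableAt_const w) (h.webster_metric hy) u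
  unfold diffTensor
  rw [dirDeriv_sub d12 d3, dirDeriv_add d1 d2, dirDeriv_smul (hη v) (hΦ w),
    dirDeriv_smul (hη w) (hΦ v), dirDeriv_smul hs (h.diff_ξ hy), fη, fη, fΦ, fΦ, fs, fΦ,
    dirDeriv_const, h.webster_reeb hy]
  module

omit h in
lemma covDeriv_eq (X : EuSp n → EuSp n) (u : EuSp n) : covDeriv G (fun _ => u) X y
    = dirDeriv (webster G η ξ Φ) u X y + diffTensor G η ξ Φ y u (X y) := by
  simp only [covDeriv, dirDeriv, diffTensor, webster_apply]
  module

/-- The Riemannian curvature in terms of that of the Tanaka-Webster connection. -/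
lemma curvature_eq (hy : y ∈ U) (u v w : EuSp n) :
    curvature G y u v w = curvOf (webster G η ξ Φ) y u v w + (2 * G y (Φ y u) v) • Φ y w
      + (diffTensor G η ξ Φ y u (diffTensor G η ξ Φ y v w)
        - diffTensor G η ξ Φ y v (diffTensor G η ξ Φ y u w)) := by
  have hn := h.isOpen.mem_nhds hy
  have ladd : ∀ a b c, diffTensor G η ξ Φ y a (b + c)
      = diffTensor G η ξ Φ y a b + diffTensor G η ξ Φ y a c := by
    intro a b c; simp only [diffTensor, map_add]; module
  have key : ∀ u v, covDeriv G (fun _ => u) (covDeriv G (fun _ => v) fun _ => w) y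
      = dirDeriv (webster G η ξ Φ) u (dirDeriv (webster G η ξ Φ) v fun _ => w) y
        + (diffTensor G η ξ Φ y (webster G η ξ Φ y u v) w
        + diffTensor G η ξ Φ y v (webster G η ξ Φ y u w))
        + (diffTensor G η ξ Φ y u (webster G η ξ Φ y v w)
          + diffTensor G η ξ Φ y u (diffTensor G η ξ Φ y v w)) := by
    intro u v
    have h1 : covDeriv G (fun _ => v) (fun _ => w) = fun z =>
        dirDeriv (webster G η ξ Φ) v (fun _ => w) z + diffTensor G η ξ Φ z v w := by
      funext z
      rw [covDeriv_eq (y := z)]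
    have hd := dirDeriv_contDiffOn h.isOpen h.contDiffOn_webster
      (contDiffOn_const (c := w) (s := U) (n := ∞)) v
    obtain ⟨h2, h3⟩ := h.dirDeriv_diffTensor hy u v w
    rw [h1, covDeriv_eq, dirDeriv_add ((hd.contDiffAt hn).differentiableAt (by simp)) h2, h3,
      ladd, dirDeriv_const]
  have h4 := dirDeriv_comm h.isOpen h.contDiffOn_webster (X := fun _ => w) contDiffOn_const hy u v
  have h5 : diffTensor G η ξ Φ y (webster G η ξ Φ y u v) w
      - diffTensor G η ξ Φ y (webster G η ξ Φ y v u) w = (2 * G y (Φ y u) v) • Φ y w := by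
    have h6 : diffTensor G η ξ Φ y (webster G η ξ Φ y u v) w
      - diffTensor G η ξ Φ y (webster G η ξ Φ y v u) w
        = diffTensor G η ξ Φ y (webster G η ξ Φ y u v - webster G η ξ Φ y v u) w := by
      simp only [diffTensor, map_sub, sub_apply]; module
    rw [h6, h.webster_torsion hy]
    simp only [diffTensor, map_smul, smul_apply, h.eta_reeb y hy, h.phi_reeb y hy, map_zero,
      zero_apply, smul_eq_mul]
    module
  rw [curvature, key, key, ← h4, ← h5]
  abel

/-- On horizontal vectors `Ric = Ricᵀ - 2 g`. -/
lemma ricci_eq [NeZero n] (hy : y ∈ U) {e : Fin n → EuSp n}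
    (he : ∀ i j, G y (e i) (e j) = if i = j then 1 else 0) {v w : EuSp n} (hv : η y v = 0)
    (hw : η y w = 0) : ricci G y v w = ricciTrans G η ξ y v w - 2 * G y v w := by
  have parseval : ∀ a b, ∑ i, G y (e i) a * G y b (e i) = G y b a := by
    intro a b
    conv_rhs => rw [frame_expansion he b]
    simp [mul_comm]
  have h1 : ∀ u, curvature G y u v w = curvLin (webster G η ξ Φ) y v w u
      + (2 * G y (Φ y u) v) • Φ y w
      + (-G y (Φ y v) w • Φ y u + G y (Φ y u) w • Φ y v
        + (η y u * G y (Φ y v) (Φ y w)) • ξ y) := by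
    intro u
    rw [h.curvature_eq hy, curvLin_apply]
    simp only [diffTensor, hv, hw, zero_smul, zero_add, zero_sub, map_neg, map_smul, map_sub,
      h.eta_reeb y hy, h.phi_reeb y hy, h.metric_reeb' hy, h.eta_phi hy, smul_eq_mul,
      smul_zero, mul_zero, mul_one, sub_zero, add_zero, neg_zero]
    module
  let A : EuSp n →ₗ[ℝ] EuSp n := curvLin (webster G η ξ Φ) y v w
    + (2 : ℝ) • (((G y).flip v).comp (Φ y) : EuSp n →ₗ[ℝ] ℝ).smulRight (Φ y w)
    + ((-G y (Φ y v) w) • (Φ y : EuSp n →ₗ[ℝ] EuSp n)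
        + (((G y).flip w).comp (Φ y) : EuSp n →ₗ[ℝ] ℝ).smulRight (Φ y v)
        + G y (Φ y v) (Φ y w) • ((η y : EuSp n →ₗ[ℝ] ℝ)).smulRight (ξ y))
  have hA : ∀ u, A u = curvature G y u v w := by
    intro u
    rw [h1]
    simp only [A, LinearMap.add_apply, LinearMap.smul_apply, LinearMap.smulRight_apply,
      ContinuousLinearMap.coe_coe, ContinuousLinearMap.comp_apply, ContinuousLinearMap.flip_apply]
    module
  have h2 : ricci G y v w = ∑ i, G y (A (e i)) (e i) := by
    rw [← sum_coord_eq_sum_frame he]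
    simp only [ricci, hA]
  have hΦ0 : ∀ u, G y (Φ y u) u = 0 := by
    intro u
    have := h.phi_skew hy u u
    rw [h.symm hy u] at this
    linarith
  rw [h2, h.ricciTrans_eq hy he]
  have h3 : ∀ i, G y (A (e i)) (e i) = G y (curvOf (webster G η ξ Φ) y (e i) v w) (e i)
      - 2 * (G y (e i) (Φ y v) * G y (Φ y w) (e i)) - G y (e i) (Φ y w) * G y (Φ y v) (e i)
      + G y (Φ y v) (Φ y w) * (G y (e i) (ξ y) * G y (ξ y) (e i)) := by
    intro i
    rw [hA, h1, curvLin_apply]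
    simp only [map_add, map_smul, add_apply, smul_apply, smul_eq_mul, hΦ0,
      h.metric_reeb y hy, h.metric_reeb' hy, h.phi_skew hy (e i)]
    ring
  simp only [h3, Finset.sum_add_distrib, Finset.sum_sub_distrib, ← Finset.mul_sum, parseval]
  rw [h.symm hy (Φ y w), h.phi_orthogonal hy, hv, h.metric_reeb' hy, h.eta_reeb y hy]
  ring

end IsSasakianChart

/-! ### Differentiation along a map -/

/-- The covariant derivative, in the constant direction `u`, of a field `X` along the map `f`, for
the pull-back of the connection with Christoffel symbols `C`. -/
def covAlong {P : Type*} [NormedAddCommGroup P] [NormedSpace ℝ P]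
    {E : Type*} [NormedAddCommGroup E] [NormedSpace ℝ E]
    (C : E → E →L[ℝ] E →L[ℝ] E) (f : P → E) (u : P)
    (X : P → E) (z : P) : E :=
  fderiv ℝ X z u + C (f z) (fderiv ℝ f z u) (X z)

section Along

variable {P : Type*} [NormedAddCommGroup P] [NormedSpace ℝ P]
  {E : Type*} [NormedAddCommGroup E] [NormedSpace ℝ E]
  {C : E → E →L[ℝ] E →L[ℝ] E} {U : Set E} {V : Set P} {f : P → E}

lemma covAlong_congr {X Y : P → E} {z : P} (h : X =ᶠ[nhds z] Y) (u : P) :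
    covAlong C f u X z = covAlong C f u Y z := by
  rw [covAlong, covAlong, h.fderiv_eq, h.self_of_nhds]

lemma covAlong_add {X Y : P → E} {z : P} (hX : DifferentiableAt ℝ X z)
    (hY : DifferentiableAt ℝ Y z) (u : P) :
    covAlong C f u (fun q => X q + Y q) z = covAlong C f u X z + covAlong C f u Y z := by
  simp only [covAlong, fderiv_fun_add hX hY, add_apply, map_add]
  abel

lemma covAlong_sub {X Y : P → E} {z : P} (hX : DifferentiableAt ℝ X z)
    (hY : DifferentiableAt ℝ Y z) (u : P) :
    covAlong C f u (fun q => X q - Y q) z = covAlong C f u X z - covAlong C f u Y z := by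
  simp only [covAlong, fderiv_fun_sub hX hY, sub_apply, map_sub]
  abel

lemma covAlong_smul {a : P → ℝ} {X : P → E} {z : P} (ha : DifferentiableAt ℝ a z)
    (hX : DifferentiableAt ℝ X z) (u : P) : covAlong C f u (fun q => a q • X q) z
      = fderiv ℝ a z u • X z + a z • covAlong C f u X z := by
  simp only [covAlong, fderiv_fun_smul ha hX, add_apply, smul_apply,
    ContinuousLinearMap.smulRight_apply, map_smul]
  module

lemma covAlong_contDiffOn (hV : IsOpen V) (hC : ContDiffOn ℝ ∞ C U) (hf : ContDiffOn ℝ ∞ f V)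
    (hfU : MapsTo f V U) {X : P → E} (hX : ContDiffOn ℝ ∞ X V) (u : P) :
    ContDiffOn ℝ ∞ (covAlong C f u X) V :=
  (contDiffOn_fderiv_const hV hX u).add
    (((hC.comp hf hfU).clm_apply (contDiffOn_fderiv_const hV hf u)).clm_apply hX)

/-- The Ricci identity along a map. -/
lemma covAlong_comm (hU : IsOpen U) (hV : IsOpen V) (hC : ContDiffOn ℝ ∞ C U)
    (hf : ContDiffOn ℝ ∞ f V) (hfU : MapsTo f V U) {X : P → E} (hX : ContDiffOn ℝ ∞ X V)
    {z : P} (hz : z ∈ V) (u v : P) :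
    covAlong C f u (covAlong C f v X) z - covAlong C f v (covAlong C f u X) z
      = curvOf C (f z) (fderiv ℝ f z u) (fderiv ℝ f z v) (X z) := by
  have hn := hV.mem_nhds hz
  have hXd := (hX.contDiffAt hn).differentiableAt (by simp)
  have hfd := (hf.contDiffAt hn).differentiableAt (by simp)
  have hCd := (hC.contDiffAt (hU.mem_nhds (hfU hz))).differentiableAt (by simp)
  have key : ∀ a b, covAlong C f a (covAlong C f b X) z = fderiv ℝ (fun q => fderiv ℝ X q b) z a
      + (fderiv ℝ C (f z) (fderiv ℝ f z a) (fderiv ℝ f z b) (X z)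
        + C (f z) (fderiv ℝ (fun q => fderiv ℝ f q b) z a) (X z)
        + C (f z) (fderiv ℝ f z b) (fderiv ℝ X z a))
      + (C (f z) (fderiv ℝ f z a) (fderiv ℝ X z b)
        + C (f z) (fderiv ℝ f z a) (C (f z) (fderiv ℝ f z b) (X z))) := by
    intro a b
    have h1 : DifferentiableAt ℝ (fun q => fderiv ℝ X q b) z :=
      ((contDiffOn_fderiv_const hV hX b).contDiffAt hn).differentiableAt (by simp)
    have h2 : DifferentiableAt ℝ (fun q => fderiv ℝ f q b) z :=
      ((contDiffOn_fderiv_const hV hf b).contDiffAt hn).differentiableAt (by simp)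
    obtain ⟨L, hL, hLu⟩ := HasFDerivWithinAt.bilin_apply (s := univ)
      (HasFDerivAt.comp (g := C) z hCd.hasFDerivAt hfd.hasFDerivAt).hasFDerivWithinAt
      h2.hasFDerivAt.hasFDerivWithinAt hXd.hasFDerivAt.hasFDerivWithinAt
    have hL' := hL.hasFDerivAt_of_univ
    have h4 : fderiv ℝ (covAlong C f b X) z a = fderiv ℝ (fun q => fderiv ℝ X q b) z a + L a := by
      change fderiv ℝ (fun q => fderiv ℝ X q b + (C ∘ f) q (fderiv ℝ f q b) (X q)) z a = _
      rw [fderiv_fun_add h1 hL'.differentiableAt, hL'.fderiv]; rfl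
    rw [covAlong, h4, hLu, covAlong]
    simp only [ContinuousLinearMap.comp_apply, map_add, Function.comp_apply]
  rw [key, key, fderiv_fderiv_comm (hX.contDiffAt hn) u v,
    fderiv_fderiv_comm (hf.contDiffAt hn) u v]
  simp only [curvOf]
  abel

/-- The product rule, within a set, for a form that is parallel. -/
lemma hasFDerivWithinAt_form {B : E → E →L[ℝ] E →L[ℝ] ℝ} {X Y : P → E} {z : P}
    {s : Set P} {f' X' Y' : P →L[ℝ] E} (hB : DifferentiableAt ℝ B (f z))
    (hpar : ∀ u v w, fderiv ℝ B (f z) u v w = B (f z) (C (f z) u v) w + B (f z) v (C (f z) u w))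
    (hf : HasFDerivWithinAt f f' s z) (hX : HasFDerivWithinAt X X' s z)
    (hY : HasFDerivWithinAt Y Y' s z) :
    ∃ L : P →L[ℝ] ℝ, HasFDerivWithinAt (fun q => B (f q) (X q) (Y q)) L s z ∧
      ∀ u, L u = B (f z) (X' u + C (f z) (f' u) (X z)) (Y z)
        + B (f z) (X z) (Y' u + C (f z) (f' u) (Y z)) := by
  obtain ⟨L, hL, hLu⟩ := HasFDerivWithinAt.bilin_apply
    (HasFDerivAt.comp_hasFDerivWithinAt (g := B) z hB.hasFDerivAt hf) hX hY
  refine ⟨L, hL, fun u => ?_⟩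
  rw [hLu]
  simp only [ContinuousLinearMap.comp_apply, hpar, map_add, add_apply, Function.comp_apply]
  ring

lemma fderiv_form_along {B : E → E →L[ℝ] E →L[ℝ] ℝ} {X Y : P → E} {z : P}
    (hB : DifferentiableAt ℝ B (f z))
    (hpar : ∀ u v w, fderiv ℝ B (f z) u v w = B (f z) (C (f z) u v) w + B (f z) v (C (f z) u w))
    (hf : DifferentiableAt ℝ f z) (hX : DifferentiableAt ℝ X z) (hY : DifferentiableAt ℝ Y z)
    (u : P) : fderiv ℝ (fun q => B (f q) (X q) (Y q)) z u
      = B (f z) (covAlong C f u X z) (Y z) + B (f z) (X z) (covAlong C f u Y z) := by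
  obtain ⟨L, hL, hLu⟩ := hasFDerivWithinAt_form (s := univ) hB hpar
    hf.hasFDerivAt.hasFDerivWithinAt hX.hasFDerivAt.hasFDerivWithinAt
    hY.hasFDerivAt.hasFDerivWithinAt
  rw [hL.hasFDerivAt_of_univ.fderiv, hLu]
  rfl

lemma covAlong_end {A : E → E →L[ℝ] E} {X : P → E} {z : P}
    (hA : DifferentiableAt ℝ A (f z))
    (hpar : ∀ u v, fderiv ℝ A (f z) u v = A (f z) (C (f z) u v) - C (f z) u (A (f z) v))
    (hf : DifferentiableAt ℝ f z) (hX : DifferentiableAt ℝ X z) (u : P) :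
    covAlong C f u (fun q => A (f q) (X q)) z = A (f z) (covAlong C f u X z) := by
  have h1 := (HasFDerivAt.comp (g := A) z hA.hasFDerivAt hf.hasFDerivAt).clm_apply hX.hasFDerivAt
  have h2 : fderiv ℝ (fun q => A (f q) (X q)) z = _ := h1.fderiv
  rw [covAlong, h2, covAlong]
  simp only [add_apply, ContinuousLinearMap.comp_apply, ContinuousLinearMap.flip_apply, hpar,
    map_add, Function.comp_apply]
  abel

/-- The second derivative of the scalar function `a` in the constant direction `u`. -/
def second (a : P → ℝ) (u : P) (z : P) : ℝ := fderiv ℝ (fun q => fderiv ℝ a q u) z u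

lemma second_mul {a b : P → ℝ} {z : P} (ha : ContDiffAt ℝ ∞ a z) (hb : ContDiffAt ℝ ∞ b z)
    (u : P) : second (fun q => a q * b q) u z
      = second a u z * b z + 2 * (fderiv ℝ a z u * fderiv ℝ b z u) + a z * second b u z := by
  have hev : ∀ {a : P → ℝ}, ContDiffAt ℝ ∞ a z → ∀ᶠ q in nhds z, DifferentiableAt ℝ a q := by
    intro a ha
    filter_upwards [(ha.of_le (m := 1) (by norm_cast)).eventually (by simp)] with q hq
    exact hq.differentiableAt one_ne_zero
  have hd : ∀ {a : P → ℝ}, ContDiffAt ℝ ∞ a z → DifferentiableAt ℝ (fun q => fderiv ℝ a q u) z :=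
    fun ha => (((ha.fderiv_right (m := 1) (by norm_cast)).clm_apply
      contDiffAt_const).differentiableAt one_ne_zero)
  have h1 : (fun q => fderiv ℝ (fun q => a q * b q) q u) =ᶠ[nhds z]
      fun q => a q * fderiv ℝ b q u + b q * fderiv ℝ a q u := by
    filter_upwards [hev ha, hev hb] with q h1 h2
    rw [fderiv_fun_mul h1 h2]
    simp
  have da := (hev ha).self_of_nhds
  have db := (hev hb).self_of_nhds
  rw [second, h1.fderiv_eq, fderiv_fun_add (da.fun_mul (hd hb)) (db.fun_mul (hd ha)),
    fderiv_fun_mul da (hd hb), fderiv_fun_mul db (hd ha)]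
  simp only [add_apply, smul_apply, smul_eq_mul, second]
  ring

lemma second_congr {a b : P → ℝ} {z : P} (h : a =ᶠ[nhds z] b) (u : P) :
    second a u z = second b u z := by
  have h1 : (fun q => fderiv ℝ a q u) =ᶠ[nhds z] fun q => fderiv ℝ b q u := by
    filter_upwards [h.fderiv (𝕜 := ℝ)] with q hq
    rw [hq]
  rw [second, second, h1.fderiv_eq]

/-- The second derivative of `B(X, Y)` along a map, for a parallel form `B`. -/
lemma second_form_along {B : E → E →L[ℝ] E →L[ℝ] ℝ} (hV : IsOpen V) (hU : IsOpen U)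
    (hC : ContDiffOn ℝ ∞ C U) (hf : ContDiffOn ℝ ∞ f V) (hfU : MapsTo f V U)
    (hB : ContDiffOn ℝ ∞ B U)
    (hpar : ∀ p ∈ U, ∀ u v w, fderiv ℝ B p u v w = B p (C p u v) w + B p v (C p u w))
    {X Y : P → E} (hX : ContDiffOn ℝ ∞ X V) (hY : ContDiffOn ℝ ∞ Y V) {z : P} (hz : z ∈ V)
    (u : P) : second (fun q => B (f q) (X q) (Y q)) u z
      = B (f z) (covAlong C f u (covAlong C f u X) z) (Y z)
        + 2 * B (f z) (covAlong C f u X z) (covAlong C f u Y z)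
        + B (f z) (X z) (covAlong C f u (covAlong C f u Y) z) := by
  have hd : ∀ {X : P → E}, ContDiffOn ℝ ∞ X V → ∀ q ∈ V, DifferentiableAt ℝ X q :=
    fun hX q hq => (hX.contDiffAt (hV.mem_nhds hq)).differentiableAt (by simp)
  have hBd : ∀ q ∈ V, DifferentiableAt ℝ B (f q) := fun q hq =>
    (hB.contDiffAt (hU.mem_nhds (hfU hq))).differentiableAt (by simp)
  have h1 : (fun q => fderiv ℝ (fun q => B (f q) (X q) (Y q)) q u) =ᶠ[nhds z]
      fun q => B (f q) (covAlong C f u X q) (Y q) + B (f q) (X q) (covAlong C f u Y q) := by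
    filter_upwards [hV.mem_nhds hz] with q hq
    exact fderiv_form_along (hBd q hq) (hpar _ (hfU hq)) (hd hf q hq) (hd hX q hq) (hd hY q hq) u
  have hDX := hd (covAlong_contDiffOn hV hC hf hfU hX u) z hz
  have hDY := hd (covAlong_contDiffOn hV hC hf hfU hY u) z hz
  have hBf : DifferentiableAt ℝ (fun q => B (f q)) z :=
    DifferentiableAt.comp (g := B) z (hBd z hz) (hd hf z hz)
  rw [second, h1.fderiv_eq, fderiv_fun_add ((hBf.clm_apply hDX).clm_apply (hd hY z hz))
    ((hBf.clm_apply (hd hX z hz)).clm_apply hDY), add_apply,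
    fderiv_form_along (hBd z hz) (hpar _ (hfU hz)) (hd hf z hz) hDX (hd hY z hz),
    fderiv_form_along (hBd z hz) (hpar _ (hfU hz)) (hd hf z hz) (hd hX z hz) hDY]
  ring

end Along

section Planar

/-- The trace of a bilinear map with respect to an inner product on the plane, in terms of an
arbitrary basis `(e₁, e₂)`. -/
lemma trace_two {W : Type*} [AddCommGroup W] [Module ℝ W] {b : EuSp 2 →L[ℝ] EuSp 2 →L[ℝ] ℝ}
    (hb : IsInner b) {e₁ e₂ : EuSp 2} (hspan : ∀ w : EuSp 2, ∃ p q : ℝ, w = p • e₁ + q • e₂)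
    (hd : b e₁ e₁ * b e₂ e₂ - b e₁ e₂ ^ 2 ≠ 0) (T : EuSp 2 →ₗ[ℝ] EuSp 2 →ₗ[ℝ] W) :
    ∑ i, ∑ j, invGram b i j • T (coordVec i) (coordVec j)
      = (b e₁ e₁ * b e₂ e₂ - b e₁ e₂ ^ 2)⁻¹ •
        (b e₂ e₂ • T e₁ e₁ - b e₁ e₂ • (T e₁ e₂ + T e₂ e₁) + b e₁ e₁ • T e₂ e₂) := by
  set d := b e₁ e₁ * b e₂ e₂ - b e₁ e₂ ^ 2 with hd'
  have hinv : ∀ i j, invGram b i j = d⁻¹ * (b e₂ e₂ * (e₁ i * e₁ j)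
      - b e₁ e₂ * (e₁ i * e₂ j + e₂ i * e₁ j) + b e₁ e₁ * (e₂ i * e₂ j)) := by
    intro i j
    let φ : EuSp 2 →ₗ[ℝ] ℝ := (EuclideanSpace.proj j : EuSp 2 →L[ℝ] ℝ)
    have hφ : ∀ w, φ w = w j := fun _ => rfl
    have h1 : (∑ k, (∑ l, invGram b k l * φ (coordVec l)) • coordVec k : EuSp 2)
        = (d⁻¹ * (b e₂ e₂ * e₁ j - b e₁ e₂ * e₂ j)) • e₁
          + (d⁻¹ * (b e₁ e₁ * e₂ j - b e₁ e₂ * e₁ j)) • e₂ := by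
      refine hb.ext fun w => ?_
      rw [hb.invGram_solve φ]
      obtain ⟨p, q, rfl⟩ := hspan w
      simp only [hφ, PiLp.add_apply,
        PiLp.smul_apply, smul_eq_mul, map_add, map_smul, add_apply, smul_apply, hb.symm e₂ e₁]
      field_simp
      rw [hd']
      ring
    have h2 := congrArg (fun x : EuSp 2 => x i) h1
    simp only [PiLp.add_apply, PiLp.smul_apply, smul_eq_mul] at h2
    have h3 : (∑ k, (∑ l, invGram b k l * φ (coordVec l)) • coordVec k : EuSp 2) i
        = invGram b i j := by
      fin_cases i <;> fin_cases j <;> simp [hφ, coordVec]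
    rw [← h3, h2]
    ring
  have hT : ∀ u v : EuSp 2, T u v = ∑ i, ∑ j, (u i * v j) • T (coordVec i) (coordVec j) := by
    intro u v
    conv_lhs => rw [← sum_smul_coordVec u, ← sum_smul_coordVec v]
    simp only [map_sum, map_smul, LinearMap.sum_apply, LinearMap.smul_apply, Finset.smul_sum,
      smul_smul]
    rw [Finset.sum_comm]
    simp only [mul_comm]
  rw [hT e₁ e₁, hT e₁ e₂, hT e₂ e₁, hT e₂ e₂]
  simp only [hinv, Fin.sum_univ_two]
  module

end Planar

/-! ### The evolution equation as an identity in a Legendrian frame -/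

/-- An orthonormal basis `(v₁, v₂)` of a Legendrian plane at the point `p`. -/
structure IsLegendrianFrame {n : ℕ} (G : EuSp n → EuSp n →L[ℝ] EuSp n →L[ℝ] ℝ)
    (η : EuSp n → EuSp n →L[ℝ] ℝ) (Φ : EuSp n → EuSp n →L[ℝ] EuSp n) (p v₁ v₂ : EuSp n) :
    Prop where
  norm₁ : G p v₁ v₁ = 1
  norm₂ : G p v₂ v₂ = 1
  orth : G p v₁ v₂ = 0
  horiz₁ : η p v₁ = 0
  horiz₂ : η p v₂ = 0
  lagr : G p (Φ p v₁) v₂ = 0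

namespace IsLegendrianFrame

variable {U : Set (EuSp 5)} {G : EuSp 5 → EuSp 5 →L[ℝ] EuSp 5 →L[ℝ] ℝ}
  {η : EuSp 5 → EuSp 5 →L[ℝ] ℝ} {ξ : EuSp 5 → EuSp 5} {Φ J : EuSp 5 → EuSp 5 →L[ℝ] EuSp 5}
  (h : IsSasakianChart U G η ξ Φ J) {p : EuSp 5} (hp : p ∈ U) {v₁ v₂ : EuSp 5}
  (hv : IsLegendrianFrame G η Φ p v₁ v₂)

include h hp hv

/-- A Legendrian frame extends to an orthonormal frame `v₁, v₂, Φ v₁, Φ v₂, ξ`. -/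
lemma frame (i j : Fin 5) : G p ((![v₁, v₂, Φ p v₁, Φ p v₂, ξ p] : Fin 5 → EuSp 5) i)
    ((![v₁, v₂, Φ p v₁, Φ p v₂, ξ p] : Fin 5 → EuSp 5) j) = if i = j then 1 else 0 := by
  have hΦ0 : ∀ u, G p (Φ p u) u = 0 := by
    intro u
    have := h.phi_skew hp u u
    rw [h.symm hp u] at this
    linarith
  have l1 := hv.lagr
  have l2 : G p (Φ p v₂) v₁ = 0 := by rw [h.phi_skew hp, h.symm hp, l1, neg_zero]
  fin_cases i <;> fin_cases j <;>
    simp [h.phi_orthogonal hp, h.metric_reeb p hp, h.metric_reeb' hp, h.eta_phi hp, hv.norm₁,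
      hv.norm₂, hv.orth, hv.horiz₁, hv.horiz₂, h.symm hp v₂ v₁, h.symm hp v₁ (Φ p _),
      h.symm hp v₂ (Φ p _), hΦ0, l1, l2, h.eta_reeb p hp]

lemma expansion (X : EuSp 5) : X = G p X v₁ • v₁ + G p X v₂ • v₂ + G p X (Φ p v₁) • Φ p v₁
    + G p X (Φ p v₂) • Φ p v₂ + η p X • ξ p := by
  have h1 := frame_expansion (frame h hp hv) X
  rw [Fin.sum_univ_five] at h1
  simpa [h.metric_reeb' hp] using h1

lemma inner_frame (X Y : EuSp 5) : G p X Y = G p X v₁ * G p Y v₁ + G p X v₂ * G p Y v₂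
    + G p X (Φ p v₁) * G p Y (Φ p v₁) + G p X (Φ p v₂) * G p Y (Φ p v₂) + η p X * η p Y := by
  conv_lhs => rw [expansion h hp hv X]
  simp only [map_add, map_smul, add_apply, smul_apply, smul_eq_mul, h.metric_reeb p hp,
    h.symm hp v₁, h.symm hp v₂, h.symm hp (Φ p _)]

omit hv in
lemma form_self (u : EuSp 5) : G p (J p u) u = 0 := by
  have := h.J_skew hp u u
  rw [h.symm hp u] at this
  linarith

/-- The form `g(J ·, ·)` in a Legendrian frame. Since `J` commutes with `Φ`, it is determined by the
four numbers `Ω`, `a`, `b`, `c`. -/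
lemma form_frame {Ω a b c : ℝ} (hΩ : G p (J p v₁) v₂ = Ω) (ha : G p (J p v₁) (Φ p v₁) = a)
    (hb : G p (J p v₁) (Φ p v₂) = b) (hc : G p (J p v₂) (Φ p v₂) = c) (X Y : EuSp 5) :
    G p (J p X) Y = Ω * (G p X v₁ * G p Y v₂ - G p X v₂ * G p Y v₁
        + G p X (Φ p v₁) * G p Y (Φ p v₂) - G p X (Φ p v₂) * G p Y (Φ p v₁))
      + a * (G p X v₁ * G p Y (Φ p v₁) - G p X (Φ p v₁) * G p Y v₁)
      + b * (G p X v₁ * G p Y (Φ p v₂) - G p X (Φ p v₂) * G p Y v₁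
        + G p X v₂ * G p Y (Φ p v₁) - G p X (Φ p v₁) * G p Y v₂)
      + c * (G p X v₂ * G p Y (Φ p v₂) - G p X (Φ p v₂) * G p Y v₂) := by
  have sk : ∀ u w, G p (J p u) w = -G p (J p w) u := fun u w => by
    rw [h.J_skew hp, h.symm hp]
  have hb' : G p (J p v₂) (Φ p v₁) = b := by
    rw [← hb, sk, h.J_comm p hp, h.phi_skew hp, neg_neg]
  have hΩ' : G p (J p v₂) v₁ = -Ω := by rw [sk, hΩ]
  have hΦ : ∀ u w, G p (J p (Φ p u)) (Φ p w) = G p (J p u) w := by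
    intro u w
    rw [h.J_comm p hp, h.phi_orthogonal hp, h.eta_J hp]; ring
  have hΦ2 : ∀ u w, G p (J p (Φ p u)) w = -G p (J p u) (Φ p w) := by
    intro u w
    rw [h.J_comm p hp, h.phi_skew hp]
  have s0 := form_self h hp
  conv_lhs => rw [expansion h hp hv X, expansion h hp hv Y]
  simp only [map_add, map_smul, add_apply, smul_apply, smul_eq_mul, h.J_reeb p hp, zero_apply,
    h.metric_reeb' hp, h.eta_J hp, hΦ, hΦ2, hΩ, hΩ', ha, hb, hb', hc, s0, map_zero]
  ring

/-- The consequences of `J² = -1` for the components of `J` in a Legendrian frame. -/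
lemma J_relations {Ω a b c : ℝ} (hΩ : G p (J p v₁) v₂ = Ω) (ha : G p (J p v₁) (Φ p v₁) = a)
    (hb : G p (J p v₁) (Φ p v₂) = b) (hc : G p (J p v₂) (Φ p v₂) = c) :
    Ω ^ 2 + a ^ 2 + b ^ 2 = 1 ∧ Ω * (a + c) = 0 := by
  have F := form_frame h hp hv hΩ ha hb hc
  have n1 : G p (J p v₁) (J p v₁) = 1 := by
    rw [h.J_orthogonal p hp, hv.norm₁, hv.horiz₁]; ring
  have n2 : G p (J p v₁) (J p (Φ p v₂)) = 0 := by
    rw [h.J_orthogonal p hp, hv.horiz₁, h.symm hp, h.phi_skew hp, h.symm hp, hv.lagr]; ring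
  have i1 := inner_frame h hp hv (J p v₁) (J p v₁)
  have i2 := inner_frame h hp hv (J p v₁) (J p (Φ p v₂))
  have e : ∀ w, G p (J p (Φ p v₂)) w = -G p (J p v₂) (Φ p w) := fun w => by
    rw [h.J_comm p hp, h.phi_skew hp]
  have hb' : G p (J p v₂) (Φ p v₁) = b := by
    rw [← hb, h.J_skew hp v₂, h.J_comm p hp, h.symm hp v₂, h.phi_skew hp, neg_neg]
  have e2 : G p (J p v₂) v₁ = -Ω := by rw [h.J_skew hp, h.symm hp, hΩ]
  have e3 : ∀ w, G p (J p v₂) (Φ p (Φ p w)) = -G p (J p v₂) w := fun w => by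
    rw [h.phi_sq p hp]
    simp [h.metric_reeb' hp, h.eta_J hp]
  have s0 := form_self h hp
  rw [n1, s0, hΩ, ha, hb, h.eta_J hp] at i1
  rw [n2, e, e, e, e, e3, e3, hb', hc, e2, s0, s0, hΩ, ha, hb, h.eta_J hp] at i2
  constructor <;> linarith

/-- The transverse Ricci form in a Legendrian frame, and the algebraic identity by which
`J R J⁻¹ = R` constrains the curvature `R(v₁,v₂)`: if `J` is not `±Φ` at the point, then the
traceless part of `R(v₁,v₂)`, as a skew-hermitian endomorphism of `(ker η, Φ)`, is a multiple of
`J`. -/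
lemma curvature_relations : ricciTrans G η ξ p (J p v₁) v₂
      = G p (J p (curvOf (webster G η ξ Φ) p v₁ v₂ v₁)) v₁
        + G p (J p (curvOf (webster G η ξ Φ) p v₁ v₂ v₂)) v₂ ∧
    G p (J p v₁) v₂ * (2 * G p (curvOf (webster G η ξ Φ) p v₁ v₂ v₁) v₂
      + G p (J p v₁) v₂ * ricciTrans G η ξ p (J p v₁) v₂) = 0 := by
  set R := curvOf (webster G η ξ Φ) p v₁ v₂ with hR
  have sR : ∀ u w, G p (R u) w = -G p (R w) u := fun u w => by
    rw [hR, h.curv_skew hp, h.symm hp]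
  have ΦR : ∀ u, R (Φ p u) = Φ p (R u) := fun u => h.curv_phi hp _ _ _
  have JR : ∀ u, R (J p u) = J p (R u) := fun u => h.curv_J hp _ _ _
  have ηR : ∀ u, η p (R u) = 0 := fun u => h.eta_curv hp _ _ _
  have e1 : ricciTrans G η ξ p (J p v₁) v₂ = G p (J p (R v₁)) v₁ + G p (J p (R v₂)) v₂ := by
    have h1 := h.ricciTrans_J hp (frame h hp hv) v₁ v₂
    rw [Fin.sum_univ_five, ← hR] at h1
    have h2 : ∀ u, G p (J p (R (Φ p u))) (Φ p u) = G p (J p (R u)) u := by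
      intro u
      rw [ΦR, h.J_comm p hp, h.phi_orthogonal hp, h.eta_J hp]; ring
    simp only [Matrix.cons_val_zero, Matrix.cons_val_one, Matrix.cons_val, h2] at h1
    rw [h.metric_reeb' hp, h.eta_J hp] at h1
    linarith
  refine ⟨e1, ?_⟩
  obtain ⟨r1, r2⟩ := J_relations h hp hv rfl rfl rfl rfl
  have F := form_frame h hp hv (J := J) rfl rfl rfl rfl
  set Ω := G p (J p v₁) v₂ with hΩ
  set a := G p (J p v₁) (Φ p v₁) with ha
  set b := G p (J p v₁) (Φ p v₂) with hb
  set c := G p (J p v₂) (Φ p v₂) with hc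
  have w11 : G p (R v₁) v₁ = 0 := by have := sR v₁ v₁; linarith
  have w22 : G p (R v₂) v₂ = 0 := by have := sR v₂ v₂; linarith
  have w21 : G p (R v₂) v₁ = -G p (R v₁) v₂ := sR _ _
  have p21 : G p (R v₂) (Φ p v₁) = G p (R v₁) (Φ p v₂) := by
    rw [sR, ΦR, h.phi_skew hp, neg_neg]
  have hRR : ∀ w, G p (R (J p v₁)) w = -(G p (J p v₁) v₁ * G p (R w) v₁
      + G p (J p v₁) v₂ * G p (R w) v₂ + G p (J p v₁) (Φ p v₁) * G p (R w) (Φ p v₁)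
      + G p (J p v₁) (Φ p v₂) * G p (R w) (Φ p v₂)) := by
    intro w
    rw [sR, h.symm hp, inner_frame h hp hv, ηR]
    ring
  have s0 := form_self h hp
  have k1 := F (R v₁) (Φ p v₁)
  have k2 := F (R v₁) (Φ p v₂)
  rw [← JR, hRR, ΦR] at k1 k2
  have o : ∀ u w, G p (Φ p u) (Φ p w) = G p u w - η p u * η p w := h.phi_orthogonal hp
  have sk : ∀ u w, G p (Φ p u) w = -G p u (Φ p w) := h.phi_skew hp
  have lag : ∀ i j : Fin 2, G p (Φ p ((![v₁, v₂] : Fin 2 → EuSp 5) i))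
      ((![v₁, v₂] : Fin 2 → EuSp 5) j) = 0 := by
    have fr := frame h hp hv
    intro i j
    fin_cases i <;> fin_cases j
    · simpa using fr 2 0
    · simpa using fr 2 1
    · simpa using fr 3 0
    · simpa using fr 3 1
  have l11 : G p (Φ p v₁) v₁ = 0 := lag 0 0
  have l12 : G p (Φ p v₁) v₂ = 0 := lag 0 1
  have l21 : G p (Φ p v₂) v₁ = 0 := lag 1 0
  have l22 : G p (Φ p v₂) v₂ = 0 := lag 1 1
  have n21 : G p v₂ v₁ = 0 := by rw [h.symm hp, hv.orth]
  simp only [s0, o, ηR, hv.horiz₁, hv.horiz₂, hv.norm₁, hv.norm₂, hv.orth, n21, w11, w22, w21,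
    p21, sk (R _), l11, l12, l21, l22, ← hΩ, ← ha, ← hb] at k1 k2
  rw [e1, F, F]
  simp only [hv.norm₁, hv.norm₂, hv.orth, n21, w11, w22, w21, p21, h.symm hp v₁ (Φ p _),
    h.symm hp v₂ (Φ p _), l11, l12, l21, l22]
  linear_combination (-2 * G p (R v₁) v₂ * Ω) * r1 - Ω * b * k1 + Ω * a * k2
    + (a * G p (R v₁) v₂ - Ω * G p (R v₂) (Φ p v₂)) * r2


set_option maxHeartbeats 4000000 in
/-- The algebraic identity behind the evolution equation of `Ω`, for a Legendrian immersion with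
tangent vectors `Vᵢ = vᵢ` at the point. Here `Bᵢⱼ = Dᵢ Vⱼ`, `Qᵢⱼ = Dⱼ Bᵢᵢ`, `Xᵢ = Dᵢ H`, `dᵢ` is the
derivative of the squared area density, `Oᵢ`, `Oᵢᵢ` are the derivatives of `Ω`, `c₁`, `c₂` are the
components of the trace of the Christoffel symbols, `ρ = Ricᵀ(J v₁, v₂)`, and `tᵢⱼ` are the
components of an unspecified tangential term, which does not contribute because the linearization of
`Ω` at tangential variations is zero. The Ricci identity turns `Dᵢ Bᵢⱼ` into `Dⱼ Bᵢᵢ` plus a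
curvature term. -/
lemma evolution_identity {B₁₁ B₁₂ B₂₂ Q₁₁ Q₁₂ Q₂₁ Q₂₂ X₁ X₂ : EuSp 5}
    {Ω O₁ O₂ O₁₁ O₂₂ c₁ c₂ t₁₁ t₁₂ t₂₁ t₂₂ d₁ d₂ ρ : ℝ}
    (hB₁₁ : η p B₁₁ = 0) (hB₁₂ : η p B₁₂ = 0) (hB₂₂ : η p B₂₂ = 0)
    (hs₁ : G p B₁₁ (Φ p v₂) = G p B₁₂ (Φ p v₁)) (hs₂ : G p B₁₂ (Φ p v₂) = G p B₂₂ (Φ p v₁))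
    (hΩ : G p (J p v₁) v₂ = Ω) (hρ : ricciTrans G η ξ p (J p v₁) v₂ = ρ)
    (hc₁ : c₁ = G p B₁₁ v₁ + G p B₂₂ v₁) (hc₂ : c₂ = G p B₁₁ v₂ + G p B₂₂ v₂)
    (hd₁ : d₁ = 2 * G p B₁₁ v₁ + 2 * G p B₁₂ v₂) (hd₂ : d₂ = 2 * G p B₁₂ v₁ + 2 * G p B₂₂ v₂)
    (hO₁ : O₁ = G p (J p B₁₁) v₂ + G p (J p v₁) B₁₂ - Ω * (d₁ / 2))
    (hO₂ : O₂ = G p (J p B₁₂) v₂ + G p (J p v₁) B₂₂ - Ω * (d₂ / 2))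
    (hO₁₁ : O₁₁ = G p (J p Q₁₁) v₂ + 2 * G p (J p B₁₁) B₁₂
      + G p (J p v₁) (Q₁₂ + curvOf (webster G η ξ Φ) p v₁ v₂ v₁) - O₁ * d₁
      - Ω * ((2 * G p Q₁₁ v₁ + 2 * G p B₁₁ B₁₁
        + (2 * G p (Q₁₂ + curvOf (webster G η ξ Φ) p v₁ v₂ v₁) v₂ + 2 * G p B₁₂ B₁₂)
        + 2 * (2 * G p B₁₁ v₁ * (2 * G p B₁₂ v₂)) - 2 * (G p B₁₁ v₂ + G p B₁₂ v₁) ^ 2) / 2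
        - d₁ ^ 2 / 4))
    (hO₂₂ : O₂₂ = G p (J p (Q₂₁ - curvOf (webster G η ξ Φ) p v₁ v₂ v₂)) v₂
      + 2 * G p (J p B₁₂) B₂₂ + G p (J p v₁) Q₂₂ - O₂ * d₂
      - Ω * ((2 * G p (Q₂₁ - curvOf (webster G η ξ Φ) p v₁ v₂ v₂) v₁ + 2 * G p B₁₂ B₁₂
        + (2 * G p Q₂₂ v₂ + 2 * G p B₂₂ B₂₂)
        + 2 * (2 * G p B₁₂ v₁ * (2 * G p B₂₂ v₂)) - 2 * (G p B₁₂ v₂ + G p B₂₂ v₁) ^ 2) / 2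
        - d₂ ^ 2 / 4))
    (hX₁ : X₁ = Q₁₁ + Q₂₁ - (2 * G p B₁₁ v₁) • (B₁₁ - G p B₁₁ v₁ • v₁ - G p B₁₁ v₂ • v₂)
      - (2 * (G p B₁₁ v₂ + G p B₁₂ v₁)) • (B₁₂ - G p B₁₂ v₁ • v₁ - G p B₁₂ v₂ • v₂)
      - (2 * G p B₁₂ v₂) • (B₂₂ - G p B₂₂ v₁ • v₁ - G p B₂₂ v₂ • v₂)
      - c₁ • B₁₁ - c₂ • B₁₂ - (t₁₁ • v₁ + t₁₂ • v₂))
    (hX₂ : X₂ = Q₁₂ + Q₂₂ - (2 * G p B₁₂ v₁) • (B₁₁ - G p B₁₁ v₁ • v₁ - G p B₁₁ v₂ • v₂)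
      - (2 * (G p B₁₂ v₂ + G p B₂₂ v₁)) • (B₁₂ - G p B₁₂ v₁ • v₁ - G p B₁₂ v₂ • v₂)
      - (2 * G p B₂₂ v₂) • (B₂₂ - G p B₂₂ v₁ • v₁ - G p B₂₂ v₂ • v₂)
      - c₁ • B₁₂ - c₂ • B₂₂ - (t₂₁ • v₁ + t₂₂ • v₂))
    {A₁₁ A₁₂ A₂₂ : EuSp 5} (hA₁₁ : A₁₁ = B₁₁ - G p B₁₁ v₁ • v₁ - G p B₁₁ v₂ • v₂)
    (hA₁₂ : A₁₂ = B₁₂ - G p B₁₂ v₁ • v₁ - G p B₁₂ v₂ • v₂)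
    (hA₂₂ : A₂₂ = B₂₂ - G p B₂₂ v₁ • v₁ - G p B₂₂ v₂ • v₂) :
    G p (J p X₁) v₂ + G p (J p v₁) X₂ - Ω * (G p X₁ v₁ + G p X₂ v₂)
      = O₁₁ + O₂₂ - (c₁ * O₁ + c₂ * O₂)
        + (2 * (G p A₁₁ A₁₁ + 2 * G p A₁₂ A₁₂ + G p A₂₂ A₂₂) - G p (A₁₁ + A₂₂) (A₁₁ + A₂₂)) * Ω
        + (1 - Ω ^ 2) * ρ := by
  obtain ⟨e1, e2⟩ := curvature_relations h hp hv (J := J)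
  rw [hρ] at e1 e2
  rw [hΩ] at e2
  obtain ⟨a, ha⟩ : ∃ a, G p (J p v₁) (Φ p v₁) = a := ⟨_, rfl⟩
  obtain ⟨b, hb⟩ : ∃ b, G p (J p v₁) (Φ p v₂) = b := ⟨_, rfl⟩
  obtain ⟨c, hc⟩ : ∃ c, G p (J p v₂) (Φ p v₂) = c := ⟨_, rfl⟩
  have F := form_frame h hp hv hΩ ha hb hc
  have I := inner_frame h hp hv
  have fr := frame h hp hv
  have m11 : G p v₁ (Φ p v₁) = 0 := by simpa using fr 0 2
  have m12 : G p v₁ (Φ p v₂) = 0 := by simpa using fr 0 3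
  have m21 : G p v₂ (Φ p v₁) = 0 := by simpa using fr 1 2
  have m22 : G p v₂ (Φ p v₂) = 0 := by simpa using fr 1 3
  have n21 : G p v₂ v₁ = 0 := by rw [h.symm hp, hv.orth]
  have w11 : G p (curvOf (webster G η ξ Φ) p v₁ v₂ v₁) v₁ = 0 := by
    have := h.curv_skew hp v₁ v₂ v₁ v₁
    rw [h.symm hp v₁] at this; linarith
  have w22 : G p (curvOf (webster G η ξ Φ) p v₁ v₂ v₂) v₂ = 0 := by
    have := h.curv_skew hp v₁ v₂ v₂ v₂
    rw [h.symm hp v₂] at this; linarith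
  have w21 : G p (curvOf (webster G η ξ Φ) p v₁ v₂ v₂) v₁
      = -G p (curvOf (webster G η ξ Φ) p v₁ v₂ v₁) v₂ := by
    rw [h.curv_skew hp, h.symm hp]
  have p21 : G p (curvOf (webster G η ξ Φ) p v₁ v₂ v₂) (Φ p v₁)
      = G p (curvOf (webster G η ξ Φ) p v₁ v₂ v₁) (Φ p v₂) := by
    rw [h.curv_skew hp, h.curv_phi hp, h.symm hp, h.phi_skew hp, neg_neg]
  generalize curvOf (webster G η ξ Φ) p v₁ v₂ v₁ = W₁ at *
  generalize curvOf (webster G η ξ Φ) p v₁ v₂ v₂ = W₂ at *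
  rw [I B₁₁ B₁₁, I B₁₂ B₁₂] at hO₁₁
  rw [I B₂₂ B₂₂, I B₁₂ B₁₂] at hO₂₂
  simp only [F] at hO₁ hO₂ hO₁₁ hO₂₂ e1
  rw [F X₁, F v₁ X₂, I A₁₁ A₁₁, I A₁₂ A₁₂, I A₂₂ A₂₂, I (A₁₁ + A₂₂)]
  have hηA : ∀ B : EuSp 5, η p B = 0 → η p (B - G p B v₁ • v₁ - G p B v₂ • v₂) = 0 := by
    intro B hB
    simp [hB, hv.horiz₁, hv.horiz₂]
  rw [← hA₁₁, ← hA₁₂, ← hA₂₂] at hX₁ hX₂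
  have a11 := hηA _ hB₁₁
  have a12 := hηA _ hB₁₂
  have a22 := hηA _ hB₂₂
  rw [← hA₁₁] at a11
  rw [← hA₁₂] at a12
  rw [← hA₂₂] at a22
  have A1 : ∀ B A : EuSp 5, A = B - G p B v₁ • v₁ - G p B v₂ • v₂ → G p A v₁ = 0 ∧ G p A v₂ = 0 ∧
      G p A (Φ p v₁) = G p B (Φ p v₁) ∧ G p A (Φ p v₂) = G p B (Φ p v₂) := by
    rintro B A rfl
    simp [hv.norm₁, hv.norm₂, hv.orth, n21, m11, m12, m21, m22]
  obtain ⟨q1, q2, q3, q4⟩ := A1 _ _ hA₁₁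
  obtain ⟨q5, q6, q7, q8⟩ := A1 _ _ hA₁₂
  obtain ⟨q9, q10, q11, q12⟩ := A1 _ _ hA₂₂
  rw [hX₁, hX₂]
  simp only [map_add, map_sub, map_smul, add_apply, sub_apply, smul_apply, smul_eq_mul, hv.norm₁,
    hv.norm₂, hv.orth, n21, m11, m12, m21, m22, w11, w22, w21, p21, hB₁₁, hB₁₂,
    hB₂₂, hs₁, hs₂, a11, a12, a22, q1, q2, q3, q4, q5, q6, q7, q8, q9, q10, q11, q12]
    at hO₁ hO₂ hO₁₁ hO₂₂ e1 ⊢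
  rw [hO₁₁, hO₂₂, hO₁, hO₂, hc₁, hc₂, hd₁, hd₂]
  -- The terms without curvature cancel identically; only `curvature_relations` remains.
  linear_combination (-1 : ℝ) * e1 + e2

end IsLegendrianFrame

/-! ### Legendrian immersions in coordinates -/

namespace IsSasakianChart

variable {n : ℕ} {U : Set (EuSp n)} {G : EuSp n → EuSp n →L[ℝ] EuSp n →L[ℝ] ℝ}
  {η : EuSp n → EuSp n →L[ℝ] ℝ} {ξ : EuSp n → EuSp n} {Φ J : EuSp n → EuSp n →L[ℝ] EuSp n}
  (h : IsSasakianChart U G η ξ Φ J) {y : EuSp n} (hy : y ∈ U)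

include h

lemma contDiffOn_form : ContDiffOn ℝ ∞ (fun p => (G p).comp (J p)) U :=
  h.smooth_G.clm_comp h.smooth_J

include hy in
/-- The form `g(J·,·)` is parallel for the Tanaka-Webster connection. -/
lemma webster_form (u v w : EuSp n) : fderiv ℝ (fun p => (G p).comp (J p)) y u v w
    = (G y).comp (J y) (webster G η ξ Φ y u v) w + (G y).comp (J y) v (webster G η ξ Φ y u w) := by
  have hd : DifferentiableAt ℝ (fun p => (G p).comp (J p)) y :=
    (h.contDiffOn_form.contDiffAt (h.isOpen.mem_nhds hy)).differentiableAt (by simp)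
  have hJv : DifferentiableAt ℝ (fun z => J z v) y :=
    (h.diff_J hy).clm_apply (differentiableAt_const _)
  have h1 := fderiv_form (h.diff_G hy) hJv (differentiableAt_const w) (h.webster_metric hy) u
  rw [dirDeriv_const, dirDeriv, fderiv_clm_apply (h.diff_J hy) (differentiableAt_const _)] at h1
  simp only [fderiv_const_apply, add_apply, ContinuousLinearMap.comp_apply, zero_apply,
    map_zero, zero_add, ContinuousLinearMap.flip_apply, h.webster_J hy, sub_add_cancel] at h1
  rw [fderiv_apply₂ hd]
  exact h1

end IsSasakianChart

/-- A Legendrian immersion `f` of the open subset `V` of `ℝ²` into a Sasakian coordinate domain. -/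
structure IsLegendrianChart (V : Set (EuSp 2)) (U : Set (EuSp 5))
    (G : EuSp 5 → EuSp 5 →L[ℝ] EuSp 5 →L[ℝ] ℝ) (η : EuSp 5 → EuSp 5 →L[ℝ] ℝ) (ξ : EuSp 5 → EuSp 5)
    (Φ J : EuSp 5 → EuSp 5 →L[ℝ] EuSp 5) (f : EuSp 2 → EuSp 5) : Prop where
  chart : IsSasakianChart U G η ξ Φ J
  isOpen : IsOpen V
  smooth : ContDiffOn ℝ ∞ f V
  mapsTo : MapsTo f V U
  legendrian : ∀ z ∈ V, ∀ u, η (f z) (fderiv ℝ f z u) = 0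
  injective : ∀ z ∈ V, Function.Injective (fderiv ℝ f z)

/-- The covariant derivative `D_u (df v)` along `f` of a constant vector `v`, for the
Tanaka-Webster connection. -/
def hess (G : EuSp 5 → EuSp 5 →L[ℝ] EuSp 5 →L[ℝ] ℝ) (η : EuSp 5 → EuSp 5 →L[ℝ] ℝ)
    (ξ : EuSp 5 → EuSp 5) (Φ : EuSp 5 → EuSp 5 →L[ℝ] EuSp 5) (f : EuSp 2 → EuSp 5)
    (u v : EuSp 2) (z : EuSp 2) : EuSp 5 :=
  covAlong (webster G η ξ Φ) f u (fun q => fderiv ℝ f q v) z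

/-- The metric induced by `f` on the parameter domain. -/
def induced (G : EuSp 5 → EuSp 5 →L[ℝ] EuSp 5 →L[ℝ] ℝ) (f : EuSp 2 → EuSp 5) (z : EuSp 2) :
    EuSp 2 →L[ℝ] EuSp 2 →L[ℝ] ℝ :=
  pullForm (G (f z)) (fderiv ℝ f z)

lemma induced_apply (G : EuSp 5 → EuSp 5 →L[ℝ] EuSp 5 →L[ℝ] ℝ) (f : EuSp 2 → EuSp 5)
    (z u v : EuSp 2) : induced G f z u v = G (f z) (fderiv ℝ f z u) (fderiv ℝ f z v) := rfl

namespace IsLegendrianChart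

variable {V : Set (EuSp 2)} {U : Set (EuSp 5)} {G : EuSp 5 → EuSp 5 →L[ℝ] EuSp 5 →L[ℝ] ℝ}
  {η : EuSp 5 → EuSp 5 →L[ℝ] ℝ} {ξ : EuSp 5 → EuSp 5} {Φ J : EuSp 5 → EuSp 5 →L[ℝ] EuSp 5}
  {f : EuSp 2 → EuSp 5} (h : IsLegendrianChart V U G η ξ Φ J f) {z : EuSp 2} (hz : z ∈ V)

include h

lemma contDiffOn_tangent (u : EuSp 2) : ContDiffOn ℝ ∞ (fun q => fderiv ℝ f q u) V :=
  contDiffOn_fderiv_const h.isOpen h.smooth u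

lemma contDiffOn_covAlong {X : EuSp 2 → EuSp 5} (hX : ContDiffOn ℝ ∞ X V) (u : EuSp 2) :
    ContDiffOn ℝ ∞ (covAlong (webster G η ξ Φ) f u X) V :=
  covAlong_contDiffOn h.isOpen h.chart.contDiffOn_webster h.smooth h.mapsTo hX u

lemma contDiffOn_hess (u v : EuSp 2) : ContDiffOn ℝ ∞ (hess G η ξ Φ f u v) V :=
  h.contDiffOn_covAlong (h.contDiffOn_tangent v) u

lemma contDiffOn_induced : ContDiffOn ℝ ∞ (induced G f) V :=
  contDiffOn_clm_apply.2 fun u => contDiffOn_clm_apply.2 fun v =>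
    ((h.chart.smooth_G.comp h.smooth h.mapsTo).clm_apply (h.contDiffOn_tangent u)).clm_apply
      (h.contDiffOn_tangent v)

include hz

lemma diffAt {W : Type*} [NormedAddCommGroup W] [NormedSpace ℝ W] {X : EuSp 2 → W}
    (hX : ContDiffOn ℝ ∞ X V) : DifferentiableAt ℝ X z :=
  (hX.contDiffAt (h.isOpen.mem_nhds hz)).differentiableAt (by simp)

lemma eta_covAlong {X : EuSp 2 → EuSp 5} (hX : DifferentiableAt ℝ X z) (u : EuSp 2) :
    η (f z) (covAlong (webster G η ξ Φ) f u X z) = fderiv ℝ (fun q => η (f q) (X q)) z u := by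
  have h1 := (HasFDerivAt.comp (g := η) z (h.chart.diff_η (h.mapsTo hz)).hasFDerivAt
    (h.diffAt hz h.smooth).hasFDerivAt).clm_apply hX.hasFDerivAt
  have h2 : fderiv ℝ (fun q => η (f q) (X q)) z = _ := h1.fderiv
  rw [h2]
  simp only [add_apply, ContinuousLinearMap.comp_apply, ContinuousLinearMap.flip_apply, covAlong,
    h.chart.webster_eta (h.mapsTo hz), map_add, Function.comp_apply]

lemma eta_covAlong_eq_zero {X : EuSp 2 → EuSp 5} (hX : DifferentiableAt ℝ X z)
    (hη : ∀ q ∈ V, η (f q) (X q) = 0) (u : EuSp 2) :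
    η (f z) (covAlong (webster G η ξ Φ) f u X z) = 0 := by
  have h1 : (fun q => η (f q) (X q)) =ᶠ[nhds z] fun _ => 0 := by
    filter_upwards [h.isOpen.mem_nhds hz] with q hq using hη q hq
  rw [h.eta_covAlong hz hX, h1.fderiv_eq]
  simp

lemma eta_hess (u v : EuSp 2) : η (f z) (hess G η ξ Φ f u v z) = 0 :=
  h.eta_covAlong_eq_zero hz (h.diffAt hz (h.contDiffOn_tangent v))
    (fun q hq => h.legendrian q hq v) u

/-- The torsion of `D` along the immersion. -/
lemma hess_sub (u v : EuSp 2) : hess G η ξ Φ f u v z - hess G η ξ Φ f v u z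
    = (2 * G (f z) (Φ (f z) (fderiv ℝ f z u)) (fderiv ℝ f z v)) • ξ (f z) := by
  rw [hess, hess, covAlong, covAlong,
    fderiv_fderiv_comm (h.smooth.contDiffAt (h.isOpen.mem_nhds hz)) u v,
    ← h.chart.webster_torsion (h.mapsTo hz)]
  abel

/-- A Legendrian immersion is Lagrangian for `dη`: the torsion along it is a multiple of `ξ`, and
the Hessian has no `ξ` component. -/
lemma lagrangian (u v : EuSp 2) :
    G (f z) (Φ (f z) (fderiv ℝ f z u)) (fderiv ℝ f z v) = 0 := by
  have h1 := congrArg (η (f z)) (h.hess_sub hz u v)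
  rw [map_sub, h.eta_hess hz, h.eta_hess hz, map_smul, h.chart.eta_reeb _ (h.mapsTo hz)] at h1
  simp only [smul_eq_mul] at h1
  linarith

lemma hess_symm (u v : EuSp 2) : hess G η ξ Φ f u v z = hess G η ξ Φ f v u z := by
  have := h.hess_sub hz u v
  rwa [h.lagrangian hz, mul_zero, zero_smul, sub_eq_zero] at this

lemma fderiv_metric {X Y : EuSp 2 → EuSp 5} (hX : DifferentiableAt ℝ X z)
    (hY : DifferentiableAt ℝ Y z) (u : EuSp 2) : fderiv ℝ (fun q => G (f q) (X q) (Y q)) z u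
      = G (f z) (covAlong (webster G η ξ Φ) f u X z) (Y z)
        + G (f z) (X z) (covAlong (webster G η ξ Φ) f u Y z) :=
  fderiv_form_along (h.chart.diff_G (h.mapsTo hz)) (h.chart.webster_metric (h.mapsTo hz))
    (h.diffAt hz h.smooth) hX hY u

/-- The total symmetry of the second fundamental form of a Legendrian immersion. -/
lemma hess_phi (u v w : EuSp 2) :
    G (f z) (hess G η ξ Φ f u v z) (Φ (f z) (fderiv ℝ f z w))
      = G (f z) (hess G η ξ Φ f u w z) (Φ (f z) (fderiv ℝ f z v)) := by
  have hp := h.mapsTo hz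
  have h1 : (fun q => G (f q) (Φ (f q) (fderiv ℝ f q v)) (fderiv ℝ f q w)) =ᶠ[nhds z]
      fun _ => 0 := by
    filter_upwards [h.isOpen.mem_nhds hz] with q hq using h.lagrangian hq v w
  have hv := h.diffAt hz (h.contDiffOn_tangent v)
  have hΦv : DifferentiableAt ℝ (fun q => Φ (f q) (fderiv ℝ f q v)) z :=
    h.diffAt hz ((h.chart.smooth_Φ.comp h.smooth h.mapsTo).clm_apply (h.contDiffOn_tangent v))
  have h2 := h.fderiv_metric hz hΦv (h.diffAt hz (h.contDiffOn_tangent w)) u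
  rw [h1.fderiv_eq, covAlong_end (h.chart.diff_Φ hp) (h.chart.webster_phi hp)
    (h.diffAt hz h.smooth) hv, h.chart.phi_skew hp, h.chart.symm hp (Φ (f z) _)] at h2
  simp only [fderiv_const_apply, zero_apply] at h2
  change 0 = -G (f z) (hess G η ξ Φ f u v z) _ + G (f z) (hess G η ξ Φ f u w z) _ at h2
  linarith

lemma induced_inner : IsInner (induced G f z) where
  symm _ _ := h.chart.symm (h.mapsTo hz) _ _
  pos _ hu := (h.chart.inner _ (h.mapsTo hz)).pos _ fun h0 =>
    hu (h.injective z hz (h0.trans (map_zero _).symm))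

lemma fderiv_induced (u v w : EuSp 2) : fderiv ℝ (induced G f) z u v w
    = G (f z) (hess G η ξ Φ f u v z) (fderiv ℝ f z w)
      + G (f z) (fderiv ℝ f z v) (hess G η ξ Φ f u w z) := by
  rw [fderiv_apply₂ (h.diffAt hz h.contDiffOn_induced)]
  exact h.fderiv_metric hz (h.diffAt hz (h.contDiffOn_tangent v))
    (h.diffAt hz (h.contDiffOn_tangent w)) u

/-- The Levi-Civita connection of the induced metric is the tangential part of `D`. -/
lemma induced_christoffel (u v w : EuSp 2) :
    G (f z) (fderiv ℝ f z (christoffel (induced G f) z u v)) (fderiv ℝ f z w)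
      = G (f z) (hess G η ξ Φ f u v z) (fderiv ℝ f z w) := by
  have hp := h.mapsTo hz
  rw [← induced_apply, christoffel_spec (h.induced_inner hz), h.fderiv_induced hz,
    h.fderiv_induced hz, h.fderiv_induced hz, h.hess_symm hz v u, h.hess_symm hz w u,
    h.hess_symm hz w v, h.chart.symm hp (fderiv ℝ f z v) (hess G η ξ Φ f u w z),
    h.chart.symm hp (fderiv ℝ f z u) (hess G η ξ Φ f v w z)]
  ring

lemma secondFundLocal_eq (u v : EuSp 2) : secondFundLocal (induced G f) G f z u v
    = hess G η ξ Φ f u v z - fderiv ℝ f z (christoffel (induced G f) z u v) := by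
  rw [secondFundLocal, hess, covAlong, webster_apply, h.legendrian z hz, h.legendrian z hz,
    h.lagrangian hz]
  module

omit h hz in
lemma hess_add_left (u u' v : EuSp 2) : hess G η ξ Φ f (u + u') v z
    = hess G η ξ Φ f u v z + hess G η ξ Φ f u' v z := by
  simp only [hess, covAlong, map_add, add_apply]; abel

omit h hz in
lemma hess_smul_left (c : ℝ) (u v : EuSp 2) : hess G η ξ Φ f (c • u) v z
    = c • hess G η ξ Φ f u v z := by
  simp only [hess, covAlong, map_smul, smul_apply, smul_add]

/-- `hess` as a bilinear map. -/
lemma exists_hess_bilin : ∃ T : EuSp 2 →ₗ[ℝ] EuSp 2 →ₗ[ℝ] EuSp 5,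
    ∀ u v, T u v = hess G η ξ Φ f u v z :=
  ⟨LinearMap.mk₂ ℝ (fun u v => hess G η ξ Φ f u v z) (hess_add_left) (hess_smul_left)
    (fun u v v' => by simp only [h.hess_symm hz u, hess_add_left])
    (fun c u v => by simp only [h.hess_symm hz u, hess_smul_left]), fun _ _ => rfl⟩

/-- The covariant derivative of the tangential field `df θ`. -/
lemma covAlong_tangent {θ : EuSp 2 → EuSp 2} (hθ : DifferentiableAt ℝ θ z) (u : EuSp 2) :
    covAlong (webster G η ξ Φ) f u (fun q => fderiv ℝ f q (θ q)) z
      = hess G η ξ Φ f u (θ z) z + fderiv ℝ f z (fderiv ℝ θ z u) := by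
  have hd : DifferentiableAt ℝ (fderiv ℝ f) z :=
    h.diffAt hz (h.smooth.fderiv_of_isOpen h.isOpen (by simp))
  rw [hess, covAlong, covAlong, fderiv_clm_apply hd hθ,
    fderiv_clm_apply hd (differentiableAt_const _)]
  simp only [fderiv_const_apply, add_apply, ContinuousLinearMap.comp_apply, zero_apply,
    map_zero, zero_add, ContinuousLinearMap.flip_apply]
  abel

/-- Codazzi's equation. -/
lemma covAlong_hess (u v : EuSp 2) : covAlong (webster G η ξ Φ) f u (hess G η ξ Φ f u v) z
    = covAlong (webster G η ξ Φ) f v (hess G η ξ Φ f u u) z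
      + curvOf (webster G η ξ Φ) (f z) (fderiv ℝ f z u) (fderiv ℝ f z v) (fderiv ℝ f z u) := by
  have h1 := covAlong_comm h.chart.isOpen h.isOpen h.chart.contDiffOn_webster h.smooth h.mapsTo
    (h.contDiffOn_tangent u) hz u v
  have h2 : hess G η ξ Φ f u v =ᶠ[nhds z] hess G η ξ Φ f v u := by
    filter_upwards [h.isOpen.mem_nhds hz] with q hq using h.hess_symm hq u v
  rw [covAlong_congr h2, ← h1]
  change _ = _ + (covAlong _ f u (hess G η ξ Φ f v u) z - covAlong _ f v (hess G η ξ Φ f u u) z)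
  abel

end IsLegendrianChart

/-! ### The Laplacian and the mean curvature vector in a frame -/

section Calculus

variable {P : Type*} [NormedAddCommGroup P] [NormedSpace ℝ P]

lemma second_sub {a b : P → ℝ} {z : P} (ha : ContDiffAt ℝ ∞ a z) (hb : ContDiffAt ℝ ∞ b z)
    (u : P) : second (fun q => a q - b q) u z = second a u z - second b u z := by
  have hev : ∀ {a : P → ℝ}, ContDiffAt ℝ ∞ a z → ∀ᶠ q in nhds z, DifferentiableAt ℝ a q := by
    intro a ha
    filter_upwards [(ha.of_le (m := 1) (by norm_cast)).eventually (by simp)] with q hq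
    exact hq.differentiableAt one_ne_zero
  have hd : ∀ {a : P → ℝ}, ContDiffAt ℝ ∞ a z → DifferentiableAt ℝ (fun q => fderiv ℝ a q u) z :=
    fun ha => (((ha.fderiv_right (m := 1) (by norm_cast)).clm_apply
      contDiffAt_const).differentiableAt one_ne_zero)
  have h1 : (fun q => fderiv ℝ (fun q => a q - b q) q u) =ᶠ[nhds z]
      fun q => fderiv ℝ a q u - fderiv ℝ b q u := by
    filter_upwards [hev ha, hev hb] with q h1 h2
    rw [fderiv_fun_sub h1 h2, sub_apply]
  rw [second, h1.fderiv_eq, fderiv_fun_sub (hd ha) (hd hb), sub_apply]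
  rfl

/-- The first two derivatives of a quotient `N / √d` at a point where `d = 1`. -/
lemma deriv_div_sqrt {Ω N d : P → ℝ} {z : P} (hN : ContDiffAt ℝ ∞ N z) (hd : ContDiffAt ℝ ∞ d z)
    (hd1 : d z = 1) (hΩ : Ω =ᶠ[nhds z] fun q => N q / Real.sqrt (d q)) (u : P) :
    fderiv ℝ Ω z u = fderiv ℝ N z u - Ω z * (fderiv ℝ d z u / 2) ∧
    second Ω u z = second N u z - fderiv ℝ Ω z u * fderiv ℝ d z u
      - Ω z * (second d u z / 2 - fderiv ℝ d z u ^ 2 / 4) := by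
  set r : P → ℝ := fun q => Real.sqrt (d q) with hr
  have hrs : ContDiffAt ℝ ∞ r z := hd.sqrt (by rw [hd1]; norm_num)
  have hr1 : r z = 1 := by simp [hr, hd1]
  have hpos : ∀ᶠ q in nhds z, 0 < d q :=
    hd.continuousAt.eventually (lt_mem_nhds (by rw [hd1]; norm_num))
  have hΩs : ContDiffAt ℝ ∞ Ω z :=
    (hN.div hrs (by rw [hr1]; norm_num)).congr_of_eventuallyEq hΩ
  have hrr : d =ᶠ[nhds z] fun q => r q * r q := by
    filter_upwards [hpos] with q hq using (Real.mul_self_sqrt hq.le).symm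
  have hNr : N =ᶠ[nhds z] fun q => Ω q * r q := by
    filter_upwards [hpos, hΩ] with q hq h1
    rw [h1, div_mul_cancel₀ _ (Real.sqrt_pos.2 hq).ne']
  have hΩd := hΩs.differentiableAt (by simp)
  have hrd := hrs.differentiableAt (by simp)
  have d1 : fderiv ℝ d z u = 2 * fderiv ℝ r z u := by
    rw [hrr.fderiv_eq, fderiv_fun_mul hrd hrd, hr1]
    simp only [one_smul, add_apply]; ring
  have d2 : second d u z = 2 * second r u z + 2 * fderiv ℝ r z u ^ 2 := by
    rw [second_congr hrr, second_mul hrs hrs, hr1]; ring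
  have n1 : fderiv ℝ N z u = fderiv ℝ Ω z u + Ω z * fderiv ℝ r z u := by
    rw [hNr.fderiv_eq, fderiv_fun_mul hΩd hrd, hr1]
    simp only [one_smul, add_apply, smul_apply, smul_eq_mul]; ring
  have n2 : second N u z = second Ω u z + 2 * (fderiv ℝ Ω z u * fderiv ℝ r z u)
      + Ω z * second r u z := by
    rw [second_congr hNr, second_mul hΩs hrs, hr1]; ring
  constructor
  · rw [n1, d1]; ring
  · rw [n2, d2, d1]; ring

end Calculus

/-- The area density of the metric `b` with respect to the basis `(e₁, e₂)`, squared. -/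
def areaSq (b : EuSp 2 →L[ℝ] EuSp 2 →L[ℝ] ℝ) (e₁ e₂ : EuSp 2) : ℝ :=
  b e₁ e₁ * b e₂ e₂ - b e₁ e₂ ^ 2

lemma span_of_orthonormal {b : EuSp 2 →L[ℝ] EuSp 2 →L[ℝ] ℝ} (hb : IsInner b) {e₁ e₂ : EuSp 2}
    (h₁ : b e₁ e₁ = 1) (h₂ : b e₂ e₂ = 1) (h₁₂ : b e₁ e₂ = 0) (w : EuSp 2) :
    w = b w e₁ • e₁ + b w e₂ • e₂ := by
  have := frame_expansion (b := b) (e := ![e₁, e₂]) (by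
    intro i j
    fin_cases i <;> fin_cases j <;> simp [h₁, h₂, h₁₂, hb.symm e₂ e₁]) w
  simpa using this

/-- The coefficients `g^{ij} T(∂ᵢ, ∂ⱼ)` of the trace, at a point where `(e₁, e₂)` is orthonormal. -/
lemma trace_orthonormal {W : Type*} [AddCommGroup W] [Module ℝ W]
    {b : EuSp 2 →L[ℝ] EuSp 2 →L[ℝ] ℝ} (hb : IsInner b) {e₁ e₂ : EuSp 2}
    (h₁ : b e₁ e₁ = 1) (h₂ : b e₂ e₂ = 1) (h₁₂ : b e₁ e₂ = 0) (T : EuSp 2 →ₗ[ℝ] EuSp 2 →ₗ[ℝ] W) :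
    ∑ i, ∑ j, invGram b i j • T (coordVec i) (coordVec j) = T e₁ e₁ + T e₂ e₂ := by
  rw [trace_two hb (fun w => ⟨_, _, span_of_orthonormal hb h₁ h₂ h₁₂ w⟩)
    (by rw [h₁, h₂, h₁₂]; norm_num), h₁, h₂, h₁₂]
  simp

/-- The trace of the Hessian of a function for the induced metric. -/
lemma laplacian_orthonormal {y e₁ e₂ : EuSp 2} {b : EuSp 2 → EuSp 2 →L[ℝ] EuSp 2 →L[ℝ] ℝ}
    (hb : IsInner (b y))
    (h₁ : b y e₁ e₁ = 1) (h₂ : b y e₂ e₂ = 1) (h₁₂ : b y e₁ e₂ = 0)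
    {a : EuSp 2 → ℝ} (ha : DifferentiableAt ℝ (fderiv ℝ a) y) :
    laplacian b a y = second a e₁ y + second a e₂ y
      - fderiv ℝ a y (christoffel b y e₁ e₁ + christoffel b y e₂ e₂) := by
  have hs : ∀ u v, fderiv ℝ (fun z => fderiv ℝ a z v) y u = fderiv ℝ (fderiv ℝ a) y u v := by
    intro u v
    rw [fderiv_clm_apply ha (differentiableAt_const _)]
    simp
  let T : EuSp 2 →ₗ[ℝ] EuSp 2 →ₗ[ℝ] ℝ := LinearMap.mk₂ ℝ
    (fun u v => fderiv ℝ (fderiv ℝ a) y u v - fderiv ℝ a y (christoffel b y u v))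
    (fun u u' v => by simp only [map_add, add_apply, christoffel_add_left]; ring)
    (fun c u v => by simp only [map_smul, smul_apply, christoffel_smul_left, smul_eq_mul]; ring)
    (fun u v v' => by simp only [map_add, christoffel_add_right]; ring)
    (fun c u v => by simp only [map_smul, christoffel_smul_right, smul_eq_mul]; ring)
  have hT : ∀ u v, T u v = fderiv ℝ (fderiv ℝ a) y u v - fderiv ℝ a y (christoffel b y u v) :=
    fun _ _ => rfl
  have h := trace_orthonormal hb h₁ h₂ h₁₂ T
  simp only [hT, smul_eq_mul] at h
  rw [laplacian]
  simp only [hs, h, second, map_add]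
  ring

namespace IsLegendrianChart

variable {V : Set (EuSp 2)} {U : Set (EuSp 5)} {G : EuSp 5 → EuSp 5 →L[ℝ] EuSp 5 →L[ℝ] ℝ}
  {η : EuSp 5 → EuSp 5 →L[ℝ] ℝ} {ξ : EuSp 5 → EuSp 5} {Φ J : EuSp 5 → EuSp 5 →L[ℝ] EuSp 5}
  {f : EuSp 2 → EuSp 5} (h : IsLegendrianChart V U G η ξ Φ J f) {y : EuSp 2} (hy : y ∈ V)
  {e₁ e₂ : EuSp 2}

include h

/-- The mean curvature vector in an arbitrary basis. -/
lemma meanCurvLocal_eq {z : EuSp 2} (hz : z ∈ V)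
    (hspan : ∀ w : EuSp 2, ∃ p q : ℝ, w = p • e₁ + q • e₂)
    (hd : areaSq (induced G f z) e₁ e₂ ≠ 0) :
    meanCurvLocal (induced G f) G f z = (areaSq (induced G f z) e₁ e₂)⁻¹ •
        (induced G f z e₂ e₂ • hess G η ξ Φ f e₁ e₁ z
          - (2 * induced G f z e₁ e₂) • hess G η ξ Φ f e₁ e₂ z
          + induced G f z e₁ e₁ • hess G η ξ Φ f e₂ e₂ z)
      - fderiv ℝ f z ((areaSq (induced G f z) e₁ e₂)⁻¹ •
        (induced G f z e₂ e₂ • christoffel (induced G f) z e₁ e₁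
          - (2 * induced G f z e₁ e₂) • christoffel (induced G f) z e₁ e₂
          + induced G f z e₁ e₁ • christoffel (induced G f) z e₂ e₂)) := by
  obtain ⟨T, hT⟩ := h.exists_hess_bilin hz
  let T' : EuSp 2 →ₗ[ℝ] EuSp 2 →ₗ[ℝ] EuSp 5 := T - LinearMap.mk₂ ℝ
    (fun u v => fderiv ℝ f z (christoffel (induced G f) z u v))
    (fun u u' v => by rw [christoffel_add_left, map_add])
    (fun c u v => by rw [christoffel_smul_left, map_smul])
    (fun u v v' => by rw [christoffel_add_right, map_add])
    (fun c u v => by rw [christoffel_smul_right, map_smul])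
  have hT' : ∀ u v, T' u v = hess G η ξ Φ f u v z
      - fderiv ℝ f z (christoffel (induced G f) z u v) := by
    intro u v; rw [← hT]; rfl
  have key := trace_two (h.induced_inner hz) hspan hd T'
  simp only [hT'] at key
  have hsymm : christoffel (induced G f) z e₂ e₁ = christoffel (induced G f) z e₁ e₂ :=
    christoffel_symm (h.induced_inner hz) (h.diffAt hz h.contDiffOn_induced) (by
      filter_upwards [h.isOpen.mem_nhds hz] with q hq using (h.induced_inner hq).symm) _ _
  rw [meanCurvLocal]
  simp only [h.secondFundLocal_eq hz]
  rw [key, h.hess_symm hz e₂ e₁, hsymm, areaSq]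
  simp only [map_smul, map_add, map_sub]
  module

include hy

/-- The covariant derivative of the mean curvature vector, up to tangential terms. -/
lemma covAlong_meanCurv (h₁ : induced G f y e₁ e₁ = 1) (h₂ : induced G f y e₂ e₂ = 1)
    (h₁₂ : induced G f y e₁ e₂ = 0) {c₁ c₂ : ℝ}
    (hc : christoffel (induced G f) y e₁ e₁ + christoffel (induced G f) y e₂ e₂
      = c₁ • e₁ + c₂ • e₂) (u : EuSp 2) :
    ∃ t₁ t₂ : ℝ, covAlong (webster G η ξ Φ) f u (meanCurvLocal (induced G f) G f) y
      = covAlong (webster G η ξ Φ) f u (hess G η ξ Φ f e₁ e₁) y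
        + covAlong (webster G η ξ Φ) f u (hess G η ξ Φ f e₂ e₂) y
        - fderiv ℝ (fun z => induced G f z e₁ e₁) y u • hess G η ξ Φ f e₁ e₁ y
        - (2 * fderiv ℝ (fun z => induced G f z e₁ e₂) y u) • hess G η ξ Φ f e₁ e₂ y
        - fderiv ℝ (fun z => induced G f z e₂ e₂) y u • hess G η ξ Φ f e₂ e₂ y
        - c₁ • hess G η ξ Φ f e₁ u y - c₂ • hess G η ξ Φ f e₂ u y
        - (t₁ • fderiv ℝ f y e₁ + t₂ • fderiv ℝ f y e₂) := by
  have hspan := span_of_orthonormal (h.induced_inner hy) h₁ h₂ h₁₂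
  have hI := h.contDiffOn_induced
  have hIab : ∀ a b, ContDiffOn ℝ ∞ (fun z => induced G f z a b) V := fun a b =>
    (hI.clm_apply contDiffOn_const).clm_apply contDiffOn_const
  have hA : ContDiffOn ℝ ∞ (fun z => areaSq (induced G f z) e₁ e₂) V :=
    ((hIab _ _).mul (hIab _ _)).sub ((hIab _ _).pow 2)
  have hA1 : areaSq (induced G f y) e₁ e₂ = 1 := by rw [areaSq, h₁, h₂, h₁₂]; norm_num
  have hAd := h.diffAt hy hA
  have hIAd : DifferentiableAt ℝ (fun z => (areaSq (induced G f z) e₁ e₂)⁻¹) y :=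
    hAd.fun_inv (by rw [hA1]; norm_num)
  have hdI : ∀ a b, DifferentiableAt ℝ (fun z => induced G f z a b) y := fun a b =>
    h.diffAt hy (hIab a b)
  have hdB : ∀ a b, DifferentiableAt ℝ (hess G η ξ Φ f a b) y := fun a b =>
    h.diffAt hy (h.contDiffOn_hess a b)
  have hdγ : ∀ a b, DifferentiableAt ℝ (fun z => christoffel (induced G f) z a b) y := fun a b =>
    h.diffAt hy (contDiffOn_christoffel h.isOpen hI (fun q hq => h.induced_inner hq) a b)
  have dA : fderiv ℝ (fun z => areaSq (induced G f z) e₁ e₂) y u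
      = fderiv ℝ (fun z => induced G f z e₁ e₁) y u
        + fderiv ℝ (fun z => induced G f z e₂ e₂) y u := by
    have h3 : (fun z => areaSq (induced G f z) e₁ e₂) = fun z =>
        induced G f z e₁ e₁ * induced G f z e₂ e₂ - induced G f z e₁ e₂ * induced G f z e₁ e₂ := by
      funext z; rw [areaSq]; ring
    rw [h3, fderiv_fun_sub ((hdI _ _).fun_mul (hdI _ _)) ((hdI _ _).fun_mul (hdI _ _)),
      fderiv_fun_mul (hdI _ _) (hdI _ _), fderiv_fun_mul (hdI _ _) (hdI _ _), h₁, h₂, h₁₂]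
    simp only [one_smul, zero_smul, sub_apply, add_apply, zero_apply]
    ring
  have dIA : fderiv ℝ (fun z => (areaSq (induced G f z) e₁ e₂)⁻¹) y u
      = -(fderiv ℝ (fun z => induced G f z e₁ e₁) y u
        + fderiv ℝ (fun z => induced G f z e₂ e₂) y u) := by
    have h3 := (hasDerivAt_inv (show areaSq (induced G f y) e₁ e₂ ≠ 0 by
      rw [hA1]; norm_num)).comp_hasFDerivAt y hAd.hasFDerivAt
    have h4 : fderiv ℝ (fun z => (areaSq (induced G f z) e₁ e₂)⁻¹) y = _ := h3.fderiv
    rw [← dA, h4, hA1]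
    simp
  set θ : EuSp 2 → EuSp 2 := fun z => (areaSq (induced G f z) e₁ e₂)⁻¹ •
        (induced G f z e₂ e₂ • christoffel (induced G f) z e₁ e₁
          - (2 * induced G f z e₁ e₂) • christoffel (induced G f) z e₁ e₂
          + induced G f z e₁ e₁ • christoffel (induced G f) z e₂ e₂) with hθ
  have hd12 : DifferentiableAt ℝ (fun z => 2 * induced G f z e₁ e₂) y := (hdI _ _).const_mul 2
  have hθd : DifferentiableAt ℝ θ y := hIAd.fun_smul
    ((((hdI _ _).fun_smul (hdγ _ _)).fun_sub (hd12.fun_smul (hdγ _ _))).fun_add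
      ((hdI _ _).fun_smul (hdγ _ _)))
  have hθy : θ y = c₁ • e₁ + c₂ • e₂ := by
    rw [← hc, hθ]; simp [hA1, h₁, h₂, h₁₂]
  have hev : meanCurvLocal (induced G f) G f =ᶠ[nhds y] fun z =>
      (areaSq (induced G f z) e₁ e₂)⁻¹ •
        (induced G f z e₂ e₂ • hess G η ξ Φ f e₁ e₁ z
          - (2 * induced G f z e₁ e₂) • hess G η ξ Φ f e₁ e₂ z
          + induced G f z e₁ e₁ • hess G η ξ Φ f e₂ e₂ z) - fderiv ℝ f z (θ z) := by
    filter_upwards [h.isOpen.mem_nhds hy, hAd.continuousAt.eventually_ne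
      (show areaSq (induced G f y) e₁ e₂ ≠ 0 by rw [hA1]; norm_num)] with z hz hz0
    exact h.meanCurvLocal_eq hz (fun w => ⟨_, _, hspan w⟩) hz0
  have hS : DifferentiableAt ℝ (fun z => induced G f z e₂ e₂ • hess G η ξ Φ f e₁ e₁ z
          - (2 * induced G f z e₁ e₂) • hess G η ξ Φ f e₁ e₂ z
          + induced G f z e₁ e₁ • hess G η ξ Φ f e₂ e₂ z) y :=
    (((hdI _ _).fun_smul (hdB _ _)).fun_sub (hd12.fun_smul (hdB _ _))).fun_add
      ((hdI _ _).fun_smul (hdB _ _))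
  have hVθ : DifferentiableAt ℝ (fun z => fderiv ℝ f z (θ z)) y :=
    (h.diffAt hy (h.smooth.fderiv_of_isOpen h.isOpen (by simp))).clm_apply hθd
  refine ⟨induced G f y (fderiv ℝ θ y u) e₁, induced G f y (fderiv ℝ θ y u) e₂, ?_⟩
  have hV : fderiv ℝ f y (fderiv ℝ θ y u)
      = induced G f y (fderiv ℝ θ y u) e₁ • fderiv ℝ f y e₁
        + induced G f y (fderiv ℝ θ y u) e₂ • fderiv ℝ f y e₂ := by
    conv_lhs => rw [hspan (fderiv ℝ θ y u)]
    rw [map_add, map_smul, map_smul]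
  have hBθ : hess G η ξ Φ f u (θ y) y
      = c₁ • hess G η ξ Φ f e₁ u y + c₂ • hess G η ξ Φ f e₂ u y := by
    rw [hθy, h.hess_symm hy, hess_add_left, hess_smul_left, hess_smul_left]
  rw [covAlong_congr hev, covAlong_sub (hIAd.fun_smul hS) hVθ, h.covAlong_tangent hy hθd, hV, hBθ,
    covAlong_smul hIAd hS, dIA, hA1,
    covAlong_add (((hdI _ _).fun_smul (hdB _ _)).fun_sub (hd12.fun_smul (hdB _ _)))
      ((hdI _ _).fun_smul (hdB _ _)),
    covAlong_sub ((hdI _ _).fun_smul (hdB _ _)) (hd12.fun_smul (hdB _ _)),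
    covAlong_smul (hdI _ _) (hdB _ _), covAlong_smul (hdI _ _) (hdB _ _),
    covAlong_smul hd12 (hdB _ _), fderiv_const_mul (hdI _ _), h₁, h₂, h₁₂]
  simp only [smul_apply, smul_eq_mul]
  module

end IsLegendrianChart

/-! ### The linearization of `Ω` along the mean curvature vector -/

namespace IsLegendrianChart

variable {V : Set (EuSp 2)} {U : Set (EuSp 5)} {G : EuSp 5 → EuSp 5 →L[ℝ] EuSp 5 →L[ℝ] ℝ}
  {η : EuSp 5 → EuSp 5 →L[ℝ] ℝ} {ξ : EuSp 5 → EuSp 5} {Φ J : EuSp 5 → EuSp 5 →L[ℝ] EuSp 5}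
  {f : EuSp 2 → EuSp 5} (h : IsLegendrianChart V U G η ξ Φ J f) {y : EuSp 2} (hy : y ∈ V)
  {e₁ e₂ : EuSp 2}

include h hy

/-- The linearization of `Ω` in the direction of the mean curvature vector, expressed through the
Laplacian of `Ω`. Both sides are computed from the Tanaka-Webster derivatives of `f` and compared by
`IsLegendrianFrame.evolution_identity`. -/
theorem linearized_omega (h₁ : induced G f y e₁ e₁ = 1) (h₂ : induced G f y e₂ e₂ = 1)
    (h₁₂ : induced G f y e₁ e₂ = 0) {Ω : EuSp 2 → ℝ}
    (hΩ : Ω =ᶠ[nhds y] fun q => G (f q) (J (f q) (fderiv ℝ f q e₁)) (fderiv ℝ f q e₂)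
      / Real.sqrt (areaSq (induced G f q) e₁ e₂)) {A₁₁ A₁₂ A₂₂ X₁ X₂ : EuSp 5}
    (hA₁₁ : A₁₁ = secondFundLocal (induced G f) G f y e₁ e₁)
    (hA₁₂ : A₁₂ = secondFundLocal (induced G f) G f y e₁ e₂)
    (hA₂₂ : A₂₂ = secondFundLocal (induced G f) G f y e₂ e₂)
    (hX₁ : X₁ = covAlong (webster G η ξ Φ) f e₁ (meanCurvLocal (induced G f) G f) y)
    (hX₂ : X₂ = covAlong (webster G η ξ Φ) f e₂ (meanCurvLocal (induced G f) G f) y) :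
    G (f y) (J (f y) X₁) (fderiv ℝ f y e₂) + G (f y) (J (f y) (fderiv ℝ f y e₁)) X₂
        - Ω y * (G (f y) X₁ (fderiv ℝ f y e₁) + G (f y) X₂ (fderiv ℝ f y e₂))
      = laplacian (induced G f) Ω y
        + (2 * (G (f y) A₁₁ A₁₁ + 2 * G (f y) A₁₂ A₁₂ + G (f y) A₂₂ A₂₂)
          - G (f y) (A₁₁ + A₂₂) (A₁₁ + A₂₂)) * Ω y
        + (1 - Ω y ^ 2) * ricciTrans G η ξ (f y) (J (f y) (fderiv ℝ f y e₁)) (fderiv ℝ f y e₂) := by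
  have hp := h.mapsTo hy
  have hspan := span_of_orthonormal (h.induced_inner hy) h₁ h₂ h₁₂
  have hn := h.isOpen.mem_nhds hy
  have hI := h.contDiffOn_induced
  have hIab : ∀ a b, ContDiffOn ℝ ∞ (fun z => induced G f z a b) V := fun a b =>
    (hI.clm_apply contDiffOn_const).clm_apply contDiffOn_const
  have hA : ContDiffOn ℝ ∞ (fun z => areaSq (induced G f z) e₁ e₂) V :=
    ((hIab _ _).mul (hIab _ _)).sub ((hIab _ _).pow 2)
  have hA1 : areaSq (induced G f y) e₁ e₂ = 1 := by rw [areaSq, h₁, h₂, h₁₂]; norm_num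
  have hT := h.contDiffOn_tangent
  have hN : ContDiffOn ℝ ∞
      (fun q => (G (f q)).comp (J (f q)) (fderiv ℝ f q e₁) (fderiv ℝ f q e₂)) V :=
    ((h.chart.contDiffOn_form.comp h.smooth h.mapsTo).clm_apply (hT _)).clm_apply (hT _)
  have hC := h.chart.contDiffOn_webster
  -- The forms `g` and `g(J ·, ·)` are parallel, so that the derivatives of the entries of the
  -- induced metric and of the numerator of `Ω` only involve the covariant derivatives of `df`.
  have dI : ∀ a b u, fderiv ℝ (fun z => induced G f z a b) y u
      = G (f y) (hess G η ξ Φ f u a y) (fderiv ℝ f y b)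
        + G (f y) (fderiv ℝ f y a) (hess G η ξ Φ f u b y) := fun a b u =>
    h.fderiv_metric hy (h.diffAt hy (hT a)) (h.diffAt hy (hT b)) u
  have ddI : ∀ a b u, second (fun z => induced G f z a b) u y
      = G (f y) (covAlong (webster G η ξ Φ) f u (hess G η ξ Φ f u a) y) (fderiv ℝ f y b)
        + 2 * G (f y) (hess G η ξ Φ f u a y) (hess G η ξ Φ f u b y)
        + G (f y) (fderiv ℝ f y a) (covAlong (webster G η ξ Φ) f u (hess G η ξ Φ f u b) y) :=
    fun a b u => second_form_along h.isOpen h.chart.isOpen hC h.smooth h.mapsTo h.chart.smooth_G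
      (fun p hp => h.chart.webster_metric hp) (hT a) (hT b) hy u
  have dN : ∀ u,
      fderiv ℝ (fun q => (G (f q)).comp (J (f q)) (fderiv ℝ f q e₁) (fderiv ℝ f q e₂)) y u
      = G (f y) (J (f y) (hess G η ξ Φ f u e₁ y)) (fderiv ℝ f y e₂)
        + G (f y) (J (f y) (fderiv ℝ f y e₁)) (hess G η ξ Φ f u e₂ y) := fun u =>
    fderiv_form_along (B := fun p => (G p).comp (J p))
      ((h.chart.contDiffOn_form.contDiffAt (h.chart.isOpen.mem_nhds hp)).differentiableAt (by simp))
      (h.chart.webster_form hp) (h.diffAt hy h.smooth) (h.diffAt hy (hT _)) (h.diffAt hy (hT _)) u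
  have ddN : ∀ u, second
      (fun q => (G (f q)).comp (J (f q)) (fderiv ℝ f q e₁) (fderiv ℝ f q e₂)) u y
      = G (f y) (J (f y) (covAlong (webster G η ξ Φ) f u (hess G η ξ Φ f u e₁) y)) (fderiv ℝ f y e₂)
        + 2 * G (f y) (J (f y) (hess G η ξ Φ f u e₁ y)) (hess G η ξ Φ f u e₂ y)
        + G (f y) (J (f y) (fderiv ℝ f y e₁))
          (covAlong (webster G η ξ Φ) f u (hess G η ξ Φ f u e₂) y) :=
    fun u => second_form_along (B := fun p => (G p).comp (J p)) h.isOpen h.chart.isOpen hC h.smooth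
      h.mapsTo h.chart.contDiffOn_form (fun p hp => h.chart.webster_form hp) (hT _) (hT _) hy u
  have dA : ∀ u, fderiv ℝ (fun z => areaSq (induced G f z) e₁ e₂) y u
      = fderiv ℝ (fun z => induced G f z e₁ e₁) y u + fderiv ℝ (fun z => induced G f z e₂ e₂) y u ∧
      second (fun z => areaSq (induced G f z) e₁ e₂) u y
      = second (fun z => induced G f z e₁ e₁) u y + second (fun z => induced G f z e₂ e₂) u y
        + 2 * (fderiv ℝ (fun z => induced G f z e₁ e₁) y u
          * fderiv ℝ (fun z => induced G f z e₂ e₂) y u)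
        - 2 * fderiv ℝ (fun z => induced G f z e₁ e₂) y u ^ 2 := by
    intro u
    have s : ∀ a b, ContDiffAt ℝ ∞ (fun z => induced G f z a b) y := fun a b =>
      (hIab a b).contDiffAt hn
    have e : (fun z => areaSq (induced G f z) e₁ e₂) = fun z =>
        induced G f z e₁ e₁ * induced G f z e₂ e₂ - induced G f z e₁ e₂ * induced G f z e₁ e₂ := by
      funext z; rw [areaSq]; ring
    have hd := fun a b => (s a b).differentiableAt (n := ∞) (by simp)
    constructor
    · rw [e, fderiv_fun_sub ((hd _ _).fun_mul (hd _ _)) ((hd _ _).fun_mul (hd _ _)),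
        fderiv_fun_mul (hd _ _) (hd _ _), fderiv_fun_mul (hd _ _) (hd _ _), h₁, h₂, h₁₂]
      simp only [one_smul, zero_smul, sub_apply, add_apply, zero_apply]
      ring
    · rw [e, second_sub ((s _ _).mul (s _ _)) ((s _ _).mul (s _ _)), second_mul (s _ _) (s _ _),
        second_mul (s _ _) (s _ _), h₁, h₂, h₁₂]
      ring
  have hΩd := deriv_div_sqrt (hN.contDiffAt hn) (hA.contDiffAt hn) hA1 hΩ
  have hΩs : ContDiffAt ℝ ∞ Ω y :=
    ((hN.contDiffAt hn).div ((hA.contDiffAt hn).sqrt (by rw [hA1]; norm_num))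
      (by rw [hA1]; norm_num)).congr_of_eventuallyEq hΩ
  have hΩy : G (f y) (J (f y) (fderiv ℝ f y e₁)) (fderiv ℝ f y e₂) = Ω y := by
    have := hΩ.self_of_nhds
    simp only [hA1, Real.sqrt_one, div_one] at this
    exact this.symm
  have hv : IsLegendrianFrame G η Φ (f y) (fderiv ℝ f y e₁) (fderiv ℝ f y e₂) :=
    ⟨h₁, h₂, h₁₂, h.legendrian y hy _, h.legendrian y hy _, h.lagrangian hy _ _⟩
  have hG : ∀ u v, christoffel (induced G f) y u v
      = G (f y) (hess G η ξ Φ f u v y) (fderiv ℝ f y e₁) • e₁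
        + G (f y) (hess G η ξ Φ f u v y) (fderiv ℝ f y e₂) • e₂ := by
    intro u v
    rw [← h.induced_christoffel hy, ← h.induced_christoffel hy]
    exact hspan _
  have hc : christoffel (induced G f) y e₁ e₁ + christoffel (induced G f) y e₂ e₂
      = (G (f y) (hess G η ξ Φ f e₁ e₁ y) (fderiv ℝ f y e₁)
          + G (f y) (hess G η ξ Φ f e₂ e₂ y) (fderiv ℝ f y e₁)) • e₁
        + (G (f y) (hess G η ξ Φ f e₁ e₁ y) (fderiv ℝ f y e₂)
          + G (f y) (hess G η ξ Φ f e₂ e₂ y) (fderiv ℝ f y e₂)) • e₂ := by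
    rw [hG, hG]; module
  have hSF : ∀ u v, secondFundLocal (induced G f) G f y u v = hess G η ξ Φ f u v y
      - G (f y) (hess G η ξ Φ f u v y) (fderiv ℝ f y e₁) • fderiv ℝ f y e₁
      - G (f y) (hess G η ξ Φ f u v y) (fderiv ℝ f y e₂) • fderiv ℝ f y e₂ := by
    intro u v
    rw [h.secondFundLocal_eq hy, hG, map_add, map_smul, map_smul, sub_sub]
  obtain ⟨t₁₁, t₁₂, hH₁⟩ := h.covAlong_meanCurv hy h₁ h₂ h₁₂ hc e₁
  obtain ⟨t₂₁, t₂₂, hH₂⟩ := h.covAlong_meanCurv hy h₁ h₂ h₁₂ hc e₂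
  have hlap := laplacian_orthonormal (b := induced G f) (h.induced_inner hy) h₁ h₂ h₁₂
    (a := Ω) ((hΩs.fderiv_right (m := 1) (by norm_cast)).differentiableAt one_ne_zero)
  rw [hc, map_add, map_smul, map_smul, smul_eq_mul, smul_eq_mul] at hlap
  have hanti := curvOf_antisymm (webster G η ξ Φ) (f y) (fderiv ℝ f y e₂) (fderiv ℝ f y e₁)
    (fderiv ℝ f y e₂)
  have cod₁ := h.covAlong_hess hy e₁ e₂
  have cod₂ := h.covAlong_hess hy e₂ e₁
  rw [hanti, ← sub_eq_add_neg] at cod₂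
  have s21 := h.hess_symm hy e₂ e₁
  have y1 := fun w => h.chart.symm hp (fderiv ℝ f y e₁) w
  have y2 := fun w => h.chart.symm hp (fderiv ℝ f y e₂) w
  have hd₁ := (dA e₁).1
  have hd₂ := (dA e₂).1
  rw [dI, dI, y1, y2] at hd₁ hd₂
  rw [hlap]
  refine IsLegendrianFrame.evolution_identity h.chart hp hv (B₁₁ := hess G η ξ Φ f e₁ e₁ y)
    (B₁₂ := hess G η ξ Φ f e₁ e₂ y) (B₂₂ := hess G η ξ Φ f e₂ e₂ y)
    (Q₁₁ := covAlong (webster G η ξ Φ) f e₁ (hess G η ξ Φ f e₁ e₁) y)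
    (Q₁₂ := covAlong (webster G η ξ Φ) f e₂ (hess G η ξ Φ f e₁ e₁) y)
    (Q₂₁ := covAlong (webster G η ξ Φ) f e₁ (hess G η ξ Φ f e₂ e₂) y)
    (Q₂₂ := covAlong (webster G η ξ Φ) f e₂ (hess G η ξ Φ f e₂ e₂) y)
    (d₁ := fderiv ℝ (fun z => areaSq (induced G f z) e₁ e₂) y e₁)
    (d₂ := fderiv ℝ (fun z => areaSq (induced G f z) e₁ e₂) y e₂)
    -- The terms added to `tᵢⱼ` replace the Hessians in the formula for `D H` by their normal parts.
    (t₁₁ := t₁₁ + (fderiv ℝ (fun z => induced G f z e₁ e₁) y e₁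
        * G (f y) (hess G η ξ Φ f e₁ e₁ y) (fderiv ℝ f y e₁)
      + 2 * fderiv ℝ (fun z => induced G f z e₁ e₂) y e₁
        * G (f y) (hess G η ξ Φ f e₁ e₂ y) (fderiv ℝ f y e₁)
      + fderiv ℝ (fun z => induced G f z e₂ e₂) y e₁
        * G (f y) (hess G η ξ Φ f e₂ e₂ y) (fderiv ℝ f y e₁)))
    (t₁₂ := t₁₂ + (fderiv ℝ (fun z => induced G f z e₁ e₁) y e₁
        * G (f y) (hess G η ξ Φ f e₁ e₁ y) (fderiv ℝ f y e₂)
      + 2 * fderiv ℝ (fun z => induced G f z e₁ e₂) y e₁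
        * G (f y) (hess G η ξ Φ f e₁ e₂ y) (fderiv ℝ f y e₂)
      + fderiv ℝ (fun z => induced G f z e₂ e₂) y e₁
        * G (f y) (hess G η ξ Φ f e₂ e₂ y) (fderiv ℝ f y e₂)))
    (t₂₁ := t₂₁ + (fderiv ℝ (fun z => induced G f z e₁ e₁) y e₂
        * G (f y) (hess G η ξ Φ f e₁ e₁ y) (fderiv ℝ f y e₁)
      + 2 * fderiv ℝ (fun z => induced G f z e₁ e₂) y e₂
        * G (f y) (hess G η ξ Φ f e₁ e₂ y) (fderiv ℝ f y e₁)
      + fderiv ℝ (fun z => induced G f z e₂ e₂) y e₂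
        * G (f y) (hess G η ξ Φ f e₂ e₂ y) (fderiv ℝ f y e₁)))
    (t₂₂ := t₂₂ + (fderiv ℝ (fun z => induced G f z e₁ e₁) y e₂
        * G (f y) (hess G η ξ Φ f e₁ e₁ y) (fderiv ℝ f y e₂)
      + 2 * fderiv ℝ (fun z => induced G f z e₁ e₂) y e₂
        * G (f y) (hess G η ξ Φ f e₁ e₂ y) (fderiv ℝ f y e₂)
      + fderiv ℝ (fun z => induced G f z e₂ e₂) y e₂
        * G (f y) (hess G η ξ Φ f e₂ e₂ y) (fderiv ℝ f y e₂)))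
    (h.eta_hess hy _ _) (h.eta_hess hy _ _) (h.eta_hess hy _ _) (h.hess_phi hy _ _ _) ?_ hΩy rfl
    rfl rfl ?_ ?_ ?_ ?_ ?_ ?_ ?_ ?_ (hA₁₁.trans (hSF _ _)) (hA₁₂.trans (hSF _ _))
    (hA₂₂.trans (hSF _ _))
  · rw [← s21, h.hess_phi hy]
  · rw [hd₁]; ring
  · rw [hd₂, s21]; ring
  · rw [(hΩd e₁).1, dN]
  · rw [(hΩd e₂).1, dN, s21]
  · rw [(hΩd e₁).2, ddN, (dA e₁).2, dI, dI, dI, ddI, ddI, cod₁]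
    simp only [y1, y2]
    ring
  · rw [(hΩd e₂).2, ddN, (dA e₂).2, dI, dI, dI, ddI, ddI, cod₂, s21]
    simp only [y1, y2]
    ring
  · rw [hX₁, hH₁, h.hess_symm hy e₂ e₁, dI, dI, dI]
    simp only [y1, y2]
    module
  · rw [hX₂, hH₂, dI, dI, dI, s21]
    simp only [y1, y2]
    module

end IsLegendrianChart

/-! ### The evolution equation in coordinates -/

section MixedPartials

variable {P E : Type*} [NormedAddCommGroup P] [NormedSpace ℝ P] [NormedAddCommGroup E]
  [NormedSpace ℝ E] {I : Set ℝ} {V : Set P} {f : ℝ → P → E}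

lemma hasFDerivAt_slice (hf : ContDiffOn ℝ ∞ (fun q : ℝ × P => f q.1 q.2) (I ×ˢ V)) (hV : IsOpen V)
    {s : ℝ} (hs : s ∈ I) {z : P} (hz : z ∈ V) :
    HasFDerivAt (f s) ((fderivWithin ℝ (fun q : ℝ × P => f q.1 q.2) (I ×ˢ V) (s, z)).comp
      (ContinuousLinearMap.inr ℝ ℝ P)) z := by
  have h1 := (hf.differentiableOn (by simp) (s, z) ⟨hs, hz⟩).hasFDerivWithinAt
  have h2 : HasFDerivWithinAt (fun w : P => (s, w)) (ContinuousLinearMap.inr ℝ ℝ P) V z :=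
    (hasFDerivAt_prodMk_right s z).hasFDerivWithinAt
  have h3 := h1.comp z h2 (fun w hw => ⟨hs, hw⟩)
  exact h3.hasFDerivAt (hV.mem_nhds hz)

lemma hasDerivWithinAt_slice (hf : ContDiffOn ℝ ∞ (fun q : ℝ × P => f q.1 q.2) (I ×ˢ V))
    {s : ℝ} (hs : s ∈ I) {z : P} (hz : z ∈ V) :
    HasDerivWithinAt (fun r => f r z)
      (fderivWithin ℝ (fun q : ℝ × P => f q.1 q.2) (I ×ˢ V) (s, z) (1, 0)) I s := by
  have h1 := (hf.differentiableOn (by simp) (s, z) ⟨hs, hz⟩).hasFDerivWithinAt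
  have h2 : HasDerivWithinAt (fun r : ℝ => (r, z)) ((1, 0) : ℝ × P) I s :=
    (hasDerivWithinAt_id s I).prodMk (hasDerivWithinAt_const s I z)
  exact h1.comp_hasDerivWithinAt (f := fun r : ℝ => (r, z)) s h2 (fun r hr => ⟨hr, hz⟩)

/-- The time derivative commutes with the space derivatives, also at the boundary of the time
interval. -/
lemma hasDerivWithinAt_fderiv (hf : ContDiffOn ℝ ∞ (fun q : ℝ × P => f q.1 q.2) (I ×ˢ V))
    (hV : IsOpen V) (hI : UniqueDiffOn ℝ I) {t : ℝ} (ht : t ∈ I) (htI : t ∈ closure (interior I))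
    {y : P} (hy : y ∈ V) (u : P) :
    HasDerivWithinAt (fun s => fderiv ℝ (f s) y u)
      (fderiv ℝ (fun z => derivWithin (fun s => f s z) I t) y u) I t := by
  set D := fderivWithin ℝ (fun q : ℝ × P => f q.1 q.2) (I ×ˢ V) with hD
  have hS : UniqueDiffOn ℝ (I ×ˢ V) := hI.prod hV.uniqueDiffOn
  have hDs : ContDiffOn ℝ ∞ D (I ×ˢ V) := hf.fderivWithin hS (by simp)
  have hDd := (hDs.differentiableOn (by simp) (t, y) ⟨ht, hy⟩).hasFDerivWithinAt
  have hsymm : IsSymmSndFDerivWithinAt ℝ (fun q : ℝ × P => f q.1 q.2) (I ×ˢ V) (t, y) := by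
    refine (hf (t, y) ⟨ht, hy⟩).isSymmSndFDerivWithinAt (by
      simpa using (by norm_cast : (2 : WithTop ℕ∞) ≤ ∞)) hS ?_ ⟨ht, hy⟩
    rw [interior_prod_eq, closure_prod_eq]
    exact ⟨htI, by rw [hV.interior_eq]; exact subset_closure hy⟩
  have h1 : HasDerivWithinAt (fun s => D (s, y) (0, u))
      (fderivWithin ℝ D (I ×ˢ V) (t, y) (1, 0) (0, u)) I t := by
    have h2 : HasDerivWithinAt (fun r : ℝ => (r, y)) ((1, 0) : ℝ × P) I t :=
      (hasDerivWithinAt_id t I).prodMk (hasDerivWithinAt_const t I y)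
    have h3 := hDd.comp_hasDerivWithinAt (f := fun r : ℝ => (r, y)) t h2 (fun r hr => ⟨hr, hy⟩)
    simpa using h3.clm_apply (hasDerivWithinAt_const t I ((0, u) : ℝ × P))
  have h4 : HasFDerivAt (fun z => D (t, z) (1, 0))
      (((fderivWithin ℝ D (I ×ˢ V) (t, y)).comp
        (ContinuousLinearMap.inr ℝ ℝ P)).flip (1, 0)) y := by
    have h2 : HasFDerivWithinAt (fun w : P => (t, w)) (ContinuousLinearMap.inr ℝ ℝ P) V y :=
      (hasFDerivAt_prodMk_right t y).hasFDerivWithinAt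
    have h3 := (hDd.comp y h2 (fun w hw => ⟨ht, hw⟩)).hasFDerivAt (hV.mem_nhds hy)
    have h5 := h3.clm_apply (hasFDerivAt_const ((1, 0) : ℝ × P) y)
    simpa using h5
  have h6 : (fun z => derivWithin (fun s => f s z) I t) =ᶠ[nhds y] fun z => D (t, z) (1, 0) := by
    filter_upwards [hV.mem_nhds hy] with z hz
    exact (hasDerivWithinAt_slice hf ht hz).derivWithin (hI t ht)
  rw [h6.fderiv_eq, h4.fderiv]
  have h7 := hsymm (1, 0) (0, u)
  refine (h1.congr_deriv h7).congr (fun s hs => ?_) ?_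
  · rw [(hasFDerivAt_slice hf hV hs hy).fderiv]; rfl
  · rw [(hasFDerivAt_slice hf hV ht hy).fderiv]; rfl

end MixedPartials

section Evolution

variable {V : Set (EuSp 2)} {U : Set (EuSp 5)} {G : EuSp 5 → EuSp 5 →L[ℝ] EuSp 5 →L[ℝ] ℝ}
  {η : EuSp 5 → EuSp 5 →L[ℝ] ℝ} {ξ : EuSp 5 → EuSp 5} {Φ J : EuSp 5 → EuSp 5 →L[ℝ] EuSp 5}

/-- The evolution equation of `Ω` in coordinates. The linearization of `Ω` only involves the time
derivative of `df`, which is `D H` up to a multiple of `ξ`; `g(J ·, ·)` annihilates that multiple,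
and `g` pairs it with tangent vectors to zero. -/
theorem evolution_local {I : Set ℝ} {f : ℝ → EuSp 2 → EuSp 5} {t : ℝ} {y : EuSp 2}
    (h : IsLegendrianChart V U G η ξ Φ J (f t)) (hy : y ∈ V)
    (hf : ContDiffOn ℝ ∞ (fun q : ℝ × EuSp 2 => f q.1 q.2) (I ×ˢ V))
    (hI : UniqueDiffOn ℝ I) (ht : t ∈ I) (htI : t ∈ closure (interior I))
    {α : EuSp 2 → ℝ} (hα : DifferentiableAt ℝ α y)
    (hev : ∀ z ∈ V, derivWithin (fun s => f s z) I t
      = meanCurvLocal (induced G (f t)) G (f t) z - (2 * α z) • ξ (f t z))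
    {e₁ e₂ : EuSp 2} (h₁ : induced G (f t) y e₁ e₁ = 1) (h₂ : induced G (f t) y e₂ e₂ = 1)
    (h₁₂ : induced G (f t) y e₁ e₂ = 0) {Ω : ℝ → EuSp 2 → ℝ}
    (hΩ : Ω t =ᶠ[nhds y] fun q => G (f t q) (J (f t q) (fderiv ℝ (f t) q e₁)) (fderiv ℝ (f t) q e₂)
      / Real.sqrt (areaSq (induced G (f t) q) e₁ e₂))
    (hΩ' : (fun s => Ω s y) =ᶠ[nhdsWithin t I] fun s =>
      G (f s y) (J (f s y) (fderiv ℝ (f s) y e₁)) (fderiv ℝ (f s) y e₂)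
      / Real.sqrt (areaSq (induced G (f s) y) e₁ e₂)) {A₁₁ A₁₂ A₂₂ : EuSp 5}
    (hA₁₁ : A₁₁ = secondFundLocal (induced G (f t)) G (f t) y e₁ e₁)
    (hA₁₂ : A₁₂ = secondFundLocal (induced G (f t)) G (f t) y e₁ e₂)
    (hA₂₂ : A₂₂ = secondFundLocal (induced G (f t)) G (f t) y e₂ e₂) :
    HasDerivWithinAt (fun s => Ω s y) (laplacian (induced G (f t)) (Ω t) y
        + (2 * (G (f t y) A₁₁ A₁₁ + 2 * G (f t y) A₁₂ A₁₂ + G (f t y) A₂₂ A₂₂)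
          - G (f t y) (A₁₁ + A₂₂) (A₁₁ + A₂₂)) * Ω t y
        + (1 - Ω t y ^ 2) * ricciTrans G η ξ (f t y) (J (f t y) (fderiv ℝ (f t) y e₁))
          (fderiv ℝ (f t) y e₂)) I t := by
  have hp := h.mapsTo hy
  have hn := h.isOpen.mem_nhds hy
  rw [← h.linearized_omega hy h₁ h₂ h₁₂ hΩ hA₁₁ hA₁₂ hA₂₂ rfl rfl]
  set C := webster G η ξ Φ with hC
  set H := meanCurvLocal (induced G (f t)) G (f t) with hH
  set W : EuSp 2 → EuSp 5 := fun z => derivWithin (fun s => f s z) I t with hW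
  have hWd : DifferentiableAt ℝ W y := by
    have hS : UniqueDiffOn ℝ (I ×ˢ V) := hI.prod h.isOpen.uniqueDiffOn
    have h1 : ContDiffOn ℝ ∞ (fun z => fderivWithin ℝ (fun q : ℝ × EuSp 2 => f q.1 q.2) (I ×ˢ V)
        (t, z) ((1, 0) : ℝ × EuSp 2)) V :=
      ((hf.fderivWithin hS (m := ∞) (by simp)).comp (contDiff_prodMk_right t).contDiffOn
        (fun z hz => ⟨ht, hz⟩)).clm_apply contDiffOn_const
    refine (h.diffAt hy h1).congr_of_eventuallyEq ?_
    filter_upwards [hn] with z hz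
    exact (hasDerivWithinAt_slice hf ht hz).derivWithin (hI t ht)
  have hξf : DifferentiableAt ℝ (fun z => ξ (f t z)) y :=
    h.diffAt hy (h.chart.smooth_ξ.comp h.smooth h.mapsTo)
  have hα2 : DifferentiableAt ℝ (fun z => 2 * α z) y := hα.const_mul 2
  have hHW : H =ᶠ[nhds y] fun z => W z + (2 * α z) • ξ (f t z) := by
    filter_upwards [hn] with z hz
    rw [hW]; simp only [hev z hz]; module
  have hξ0 : ∀ u, covAlong C (f t) u (fun z => ξ (f t z)) y = 0 := by
    intro u
    have h1 : fderiv ℝ (fun z => ξ (f t z)) y = _ := (HasFDerivAt.comp (g := ξ) y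
      (h.chart.diff_ξ hp).hasFDerivAt (h.diffAt hy h.smooth).hasFDerivAt).fderiv
    rw [covAlong, h1]
    exact h.chart.webster_reeb hp _
  -- The torsion and the Reeb component `-2 α ξ` of the velocity change the covariant time
  -- derivative of `df u` only by a multiple of `ξ`.
  have hX : ∀ u, ∃ l : ℝ, fderiv ℝ W y u + C (f t y) (W y) (fderiv ℝ (f t) y u)
      = covAlong C (f t) u H y + l • ξ (f t y) := by
    intro u
    have h1 := h.chart.webster_torsion hp (W y) (fderiv ℝ (f t) y u)
    rw [covAlong_congr hHW, covAlong_add hWd (hα2.fun_smul hξf), covAlong_smul hα2 hξf, hξ0,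
      covAlong]
    refine ⟨2 * G (f t y) (Φ (f t y) (W y)) (fderiv ℝ (f t) y u)
      - fderiv ℝ (fun z => 2 * α z) y u, ?_⟩
    rw [sub_smul, ← h1]
    module
  have hfs : HasFDerivWithinAt (fun s => f s y) (ContinuousLinearMap.toSpanSingleton ℝ (W y)) I t :=
    by
      have := hasDerivWithinAt_slice hf ht hy
      rw [← this.derivWithin (hI t ht)] at this
      exact this.hasFDerivWithinAt
  have hT : ∀ u, HasFDerivWithinAt (fun s => fderiv ℝ (f s) y u)
      (ContinuousLinearMap.toSpanSingleton ℝ (fderiv ℝ W y u)) I t := fun u =>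
    (hasDerivWithinAt_fderiv hf h.isOpen hI ht htI hy u).hasFDerivWithinAt
  obtain ⟨l₁, hl₁⟩ := hX e₁
  obtain ⟨l₂, hl₂⟩ := hX e₂
  set X₁ := covAlong C (f t) e₁ H y
  set X₂ := covAlong C (f t) e₂ H y
  have r1 := fun u => h.chart.metric_reeb _ hp u
  have r2 := fun u => h.chart.metric_reeb' hp u
  have leg := h.legendrian y hy
  have y1 := fun w => h.chart.symm hp (fderiv ℝ (f t) y e₁) w
  have y2 := fun w => h.chart.symm hp (fderiv ℝ (f t) y e₂) w
  have dN : HasDerivWithinAt (fun s => (G (f s y)).comp (J (f s y)) (fderiv ℝ (f s) y e₁)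
      (fderiv ℝ (f s) y e₂)) (G (f t y) (J (f t y) X₁) (fderiv ℝ (f t) y e₂)
        + G (f t y) (J (f t y) (fderiv ℝ (f t) y e₁)) X₂) I t := by
    obtain ⟨L, hL, hLu⟩ := hasFDerivWithinAt_form (f := fun s => f s y) (z := t)
      (B := fun p => (G p).comp (J p))
      ((h.chart.contDiffOn_form.contDiffAt (h.chart.isOpen.mem_nhds hp)).differentiableAt (by simp))
      (h.chart.webster_form hp) hfs (hT e₁) (hT e₂)
    refine hL.hasDerivWithinAt.congr_deriv ?_
    rw [hLu]
    simp only [ContinuousLinearMap.toSpanSingleton_apply, one_smul]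
    rw [hl₁, hl₂]
    simp [h.chart.J_reeb _ hp, r2, h.chart.eta_J hp]
  have dG : ∀ u v X Y : EuSp _, ∀ l l' : ℝ,
      fderiv ℝ W y u + C (f t y) (W y) (fderiv ℝ (f t) y u) = X + l • ξ (f t y) →
      fderiv ℝ W y v + C (f t y) (W y) (fderiv ℝ (f t) y v) = Y + l' • ξ (f t y) →
      HasDerivWithinAt (fun s => induced G (f s) y u v)
        (G (f t y) X (fderiv ℝ (f t) y v) + G (f t y) (fderiv ℝ (f t) y u) Y) I t := by
    intro u v X Y l l' hX hY
    obtain ⟨L, hL, hLu⟩ := hasFDerivWithinAt_form (f := fun s => f s y) (z := t) (B := G)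
      (h.chart.diff_G hp)
      (h.chart.webster_metric hp) hfs (hT u) (hT v)
    refine hL.hasDerivWithinAt.congr_deriv ?_
    rw [hLu]
    simp only [ContinuousLinearMap.toSpanSingleton_apply, one_smul]
    rw [hX, hY]
    simp [r1, r2, leg]
  have dA : HasDerivWithinAt (fun s => areaSq (induced G (f s) y) e₁ e₂)
      (2 * G (f t y) X₁ (fderiv ℝ (f t) y e₁) + 2 * G (f t y) X₂ (fderiv ℝ (f t) y e₂)) I t := by
    refine (((dG e₁ e₁ _ _ _ _ hl₁ hl₁).fun_mul (dG e₂ e₂ _ _ _ _ hl₂ hl₂)).fun_sub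
      ((dG e₁ e₂ _ _ _ _ hl₁ hl₂).fun_pow 2)).congr_deriv ?_
    rw [h₁, h₂, h₁₂, y1 X₁, y2 X₂]
    ring
  have hA1 : areaSq (induced G (f t) y) e₁ e₂ = 1 := by rw [areaSq, h₁, h₂, h₁₂]; norm_num
  have hΩy : G (f t y) (J (f t y) (fderiv ℝ (f t) y e₁)) (fderiv ℝ (f t) y e₂) = Ω t y := by
    have := hΩ.self_of_nhds
    simp only [hA1, Real.sqrt_one, div_one] at this
    exact this.symm
  have hquot := dN.fun_div (dA.sqrt (by rw [hA1]; norm_num)) (by rw [hA1]; norm_num)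
  refine (hquot.congr_deriv ?_).congr_of_eventuallyEq hΩ' (hΩ.self_of_nhds)
  rw [hA1, ContinuousLinearMap.comp_apply, hΩy]
  simp only [Real.sqrt_one]
  ring

end Evolution

/-! ### Smoothness of coordinate expressions -/

section ChartFrames

variable {n : ℕ} {M : Type*} [TopologicalSpace M] [ChartedSpace (EuSp n) M]
  [IsManifold 𝓘(ℝ, EuSp n) ∞ M] (p : M)

variable {p} {y : EuSp n} (hy : y ∈ (extChartAt 𝓘(ℝ, EuSp n) p).target)
include hy

omit [IsManifold 𝓘(ℝ, EuSp n) ∞ M] in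
lemma symm_mem_source : (extChartAt 𝓘(ℝ, EuSp n) p).symm y ∈ (chartAt (EuSp n) p).source := by
  rw [← extChartAt_source 𝓘(ℝ, EuSp n)]
  exact (extChartAt 𝓘(ℝ, EuSp n) p).map_target hy

lemma chartDiff_chartInvDiff (v : EuSp n) : chartDiff p y (chartInvDiff p y v) = v := by
  have : IsManifold 𝓘(ℝ, EuSp n) 1 M := .of_le (n := ∞) (by norm_cast)
  have := mfderiv_extChartAt_comp_mfderivWithin_extChartAt_symm (I := 𝓘(ℝ, EuSp n)) hy
  simp only [modelWithCornersSelf_coe, range_id, mfderivWithin_univ] at this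
  exact congrArg (fun L : EuSp n →L[ℝ] EuSp n => L v) this

lemma chartInvDiff_chartDiff (w : TangentSpace 𝓘(ℝ, EuSp n) ((extChartAt 𝓘(ℝ, EuSp n) p).symm y)) :
    chartInvDiff p y (chartDiff p y w) = w := by
  have : IsManifold 𝓘(ℝ, EuSp n) 1 M := .of_le (n := ∞) (by norm_cast)
  have := mfderivWithin_extChartAt_symm_comp_mfderiv_extChartAt (I := 𝓘(ℝ, EuSp n)) hy
  simp only [modelWithCornersSelf_coe, range_id, mfderivWithin_univ] at this
  exact congrArg (fun L : EuSp n →L[ℝ] EuSp n => L w) this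

lemma chartInvDiff_eq_symmL : chartInvDiff p y
    = (trivializationAt (EuSp n) (TangentSpace 𝓘(ℝ, EuSp n)) p).symmL ℝ
      ((extChartAt 𝓘(ℝ, EuSp n) p).symm y) := by
  have : IsManifold 𝓘(ℝ, EuSp n) 1 M := .of_le (n := ∞) (by norm_cast)
  rw [TangentBundle.symmL_trivializationAt (symm_mem_source hy)]
  simp only [modelWithCornersSelf_coe, range_id, mfderivWithin_univ]
  exact congrArg (fun z => (show EuSp n →L[ℝ] EuSp n from
    mfderiv 𝓘(ℝ, EuSp n) 𝓘(ℝ, EuSp n) (extChartAt 𝓘(ℝ, EuSp n) p).symm z))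
    ((extChartAt 𝓘(ℝ, EuSp n) p).right_inv hy).symm

lemma chartDiff_eq_trivialization : chartDiff p y
    = (trivializationAt (EuSp n) (TangentSpace 𝓘(ℝ, EuSp n)) p).continuousLinearMapAt ℝ
      ((extChartAt 𝓘(ℝ, EuSp n) p).symm y) := by
  have : IsManifold 𝓘(ℝ, EuSp n) 1 M := .of_le (n := ∞) (by norm_cast)
  rw [TangentBundle.continuousLinearMapAt_trivializationAt (symm_mem_source hy)]
  rfl

end ChartFrames

section ChartSmooth

variable {n : ℕ} {M : Type*} [TopologicalSpace M] [ChartedSpace (EuSp n) M]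
  [IsManifold 𝓘(ℝ, EuSp n) ∞ M] (p : M)

lemma contMDiffOn_chartInvDiff (v : EuSp n) : ContMDiffOn 𝓘(ℝ, EuSp n)
    (𝓘(ℝ, EuSp n).prod 𝓘(ℝ, EuSp n)) ∞ (fun y => TotalSpace.mk' (EuSp n)
      (E := fun q : M => TangentSpace 𝓘(ℝ, EuSp n) q)
      ((extChartAt 𝓘(ℝ, EuSp n) p).symm y) (chartInvDiff p y v))
    (extChartAt 𝓘(ℝ, EuSp n) p).target := by
  have h1 := (trivializationAt (EuSp n) (TangentSpace 𝓘(ℝ, EuSp n)) p).contMDiffOn_symm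
    (IB := 𝓘(ℝ, EuSp n)) (n := ∞)
  have h2 : ContMDiffOn 𝓘(ℝ, EuSp n) (𝓘(ℝ, EuSp n).prod 𝓘(ℝ, EuSp n)) ∞
      (fun y => ((extChartAt 𝓘(ℝ, EuSp n) p).symm y, v)) (extChartAt 𝓘(ℝ, EuSp n) p).target :=
    (contMDiffOn_extChartAt_symm p).prodMk contMDiffOn_const
  refine (h1.comp h2 fun y hy => ?_).congr fun y hy => ?_
  · rw [mem_preimage, Trivialization.mem_target]
    exact symm_mem_source hy
  · rw [chartInvDiff_eq_symmL hy]
    have hb : (extChartAt 𝓘(ℝ, EuSp n) p).symm y ∈ (trivializationAt (EuSp n)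
        (TangentSpace 𝓘(ℝ, EuSp n)) p).baseSet := symm_mem_source hy
    rw [Trivialization.symmL_apply _ hb]
    exact Trivialization.mk_symm _ hb v

variable {p}

lemma contDiffOn_chartDiff {X : ∀ y : EuSp n, TangentSpace 𝓘(ℝ, EuSp n)
      ((extChartAt 𝓘(ℝ, EuSp n) p).symm y)}
    (hX : ContMDiffOn 𝓘(ℝ, EuSp n) (𝓘(ℝ, EuSp n).prod 𝓘(ℝ, EuSp n)) ∞
      (fun y => TotalSpace.mk' (EuSp n) (E := fun q : M => TangentSpace 𝓘(ℝ, EuSp n) q)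
        ((extChartAt 𝓘(ℝ, EuSp n) p).symm y) (X y)) (extChartAt 𝓘(ℝ, EuSp n) p).target) :
    ContDiffOn ℝ ∞ (fun y => chartDiff p y (X y)) (extChartAt 𝓘(ℝ, EuSp n) p).target := by
  have h1 := ((trivializationAt (EuSp n) (TangentSpace 𝓘(ℝ, EuSp n)) p).contMDiffOn_iff
    (IB := 𝓘(ℝ, EuSp n)) (n := ∞) (fun y hy => by
      rw [Trivialization.mem_source]; exact symm_mem_source hy)).1 hX
  refine h1.2.contDiffOn.congr fun y hy => ?_
  rw [chartDiff_eq_trivialization hy]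
  rw [Trivialization.continuousLinearMapAt_apply, Trivialization.coe_linearMapAt_of_mem]
  exact symm_mem_source hy

lemma contDiffOn_locVec {ξ : ∀ q : M, TangentSpace 𝓘(ℝ, EuSp n) q}
    (hξ : ContMDiff 𝓘(ℝ, EuSp n) (𝓘(ℝ, EuSp n).prod 𝓘(ℝ, EuSp n)) ∞
    (fun p => TotalSpace.mk' (EuSp n) (E := fun q : M => TangentSpace 𝓘(ℝ, EuSp n) q) p (ξ p))) :
    ContDiffOn ℝ ∞ (locVec ξ p) (extChartAt 𝓘(ℝ, EuSp n) p).target :=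
  contDiffOn_chartDiff (hξ.comp_contMDiffOn (contMDiffOn_extChartAt_symm p))

lemma contDiffOn_locEnd {Φ : ∀ q : M, TangentSpace 𝓘(ℝ, EuSp n) q →L[ℝ] TangentSpace 𝓘(ℝ, EuSp n) q}
    (hΦ : ContMDiff 𝓘(ℝ, EuSp n) (𝓘(ℝ, EuSp n).prod 𝓘(ℝ, EuSp n →L[ℝ] EuSp n)) ∞
    (fun p => TotalSpace.mk' (EuSp n →L[ℝ] EuSp n)
      (E := fun q : M => TangentSpace 𝓘(ℝ, EuSp n) q →L[ℝ] TangentSpace 𝓘(ℝ, EuSp n) q) p (Φ p))) :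
    ContDiffOn ℝ ∞ (locEnd Φ p) (extChartAt 𝓘(ℝ, EuSp n) p).target :=
  contDiffOn_clm_apply.2 fun v => contDiffOn_chartDiff (ContMDiffOn.clm_bundle_apply
    (hΦ.comp_contMDiffOn (contMDiffOn_extChartAt_symm p)) (contMDiffOn_chartInvDiff p v))

lemma contDiffOn_locForm {η : ∀ q : M, TangentSpace 𝓘(ℝ, EuSp n) q →L[ℝ] ℝ}
    (hη : ContMDiff 𝓘(ℝ, EuSp n) (𝓘(ℝ, EuSp n).prod 𝓘(ℝ, EuSp n →L[ℝ] ℝ)) ∞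
    (fun p => TotalSpace.mk' (EuSp n →L[ℝ] ℝ)
      (E := fun q : M => TangentSpace 𝓘(ℝ, EuSp n) q →L[ℝ] ℝ) p (η p))) :
    ContDiffOn ℝ ∞ (locForm η p) (extChartAt 𝓘(ℝ, EuSp n) p).target := by
  refine contDiffOn_clm_apply.2 fun v => ?_
  have h1 := ContMDiffOn.clm_bundle_apply (E₂ := Bundle.Trivial M ℝ)
    (hη.comp_contMDiffOn (contMDiffOn_extChartAt_symm p)) (contMDiffOn_chartInvDiff p v)
  intro y hy
  exact ((contMDiffWithinAt_totalSpace.1 (h1 y hy)).2).contDiffWithinAt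

lemma contDiffOn_locBilin
    {B : ∀ q : M, TangentSpace 𝓘(ℝ, EuSp n) q →L[ℝ] TangentSpace 𝓘(ℝ, EuSp n) q →L[ℝ] ℝ}
    (hB : ContMDiff 𝓘(ℝ, EuSp n) (𝓘(ℝ, EuSp n).prod 𝓘(ℝ, EuSp n →L[ℝ] EuSp n →L[ℝ] ℝ)) ∞
    (fun x => TotalSpace.mk' (EuSp n →L[ℝ] EuSp n →L[ℝ] ℝ)
      (E := fun z : M => TangentSpace 𝓘(ℝ, EuSp n) z →L[ℝ] TangentSpace 𝓘(ℝ, EuSp n) z →L[ℝ] ℝ)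
      x (B x))) :
    ContDiffOn ℝ ∞ (locBilin B p) (extChartAt 𝓘(ℝ, EuSp n) p).target := by
  refine contDiffOn_clm_apply.2 fun u => contDiffOn_clm_apply.2 fun v => ?_
  have h1 := ContMDiffOn.clm_bundle_apply₂ (E₃ := Bundle.Trivial M ℝ)
    (hB.comp_contMDiffOn (contMDiffOn_extChartAt_symm p)) (contMDiffOn_chartInvDiff p u)
    (contMDiffOn_chartInvDiff p v)
  intro y hy
  exact ((contMDiffWithinAt_totalSpace.1 (h1 y hy)).2).contDiffWithinAt

end ChartSmooth

/-! ### From tensor fields on a manifold to their coordinate expressions -/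

section SasakianCharts

variable {n : ℕ} {M : Type*} [TopologicalSpace M] [ChartedSpace (EuSp n) M]
  [IsManifold 𝓘(ℝ, EuSp n) ∞ M]

lemma locBilin_comp {p : M} {y : EuSp n} (hy : y ∈ (extChartAt 𝓘(ℝ, EuSp n) p).target)
    (B : ∀ q : M, TangentSpace 𝓘(ℝ, EuSp n) q →L[ℝ] TangentSpace 𝓘(ℝ, EuSp n) q →L[ℝ] ℝ)
    (A : ∀ q : M, TangentSpace 𝓘(ℝ, EuSp n) q →L[ℝ] TangentSpace 𝓘(ℝ, EuSp n) q) (u v : EuSp n) :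
    locBilin (fun q => (B q).comp (A q)) p y u v = locBilin B p y (locEnd A p y u) v := by
  change B _ (A _ (chartInvDiff p y u)) (chartInvDiff p y v)
    = B _ (chartInvDiff p y (chartDiff p y (A _ (chartInvDiff p y u)))) (chartInvDiff p y v)
  rw [chartInvDiff_chartDiff hy]

lemma chartInvDiff_ne_zero {p : M} {y : EuSp n} (hy : y ∈ (extChartAt 𝓘(ℝ, EuSp n) p).target)
    {v : EuSp n} (hv : v ≠ 0) : chartInvDiff p y v ≠ 0 := by
  intro h0
  have := chartDiff_chartInvDiff hy v
  rw [h0, map_zero] at this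
  exact hv this.symm

set_option maxHeartbeats 1600000 in
/-- The coordinate expressions of a Sasakian structure with a parallel transverse Kähler form. -/
lemma isSasakianChart (𝓢 : SasakianStructure n M) (κ : ParallelTransverseKahlerForm 𝓢) (p : M) :
    IsSasakianChart (extChartAt 𝓘(ℝ, EuSp n) p).target (locBilin 𝓢.g.inner p) (locForm 𝓢.η p)
      (locVec 𝓢.ξ p) (locEnd 𝓢.Φ p) (locEnd κ.J p) where
  isOpen := isOpen_extChartAt_target p
  smooth_G := contDiffOn_locBilin 𝓢.g.contMDiff
  smooth_η := contDiffOn_locForm 𝓢.smooth_η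
  smooth_ξ := contDiffOn_locVec 𝓢.smooth_ξ
  smooth_Φ := contDiffOn_locEnd 𝓢.smooth_Φ
  smooth_J := contDiffOn_locEnd κ.smooth_J
  inner y hy :=
    { symm := fun u v => 𝓢.g.symm _ _ _
      pos := fun u hu => 𝓢.g.pos _ _ (chartInvDiff_ne_zero hy hu) }
  eta_reeb y hy := by
    change 𝓢.η _ (chartInvDiff p y (chartDiff p y (𝓢.ξ _))) = 1
    rw [chartInvDiff_chartDiff hy, 𝓢.eta_reeb]
  metric_reeb y hy v := by
    change 𝓢.g.inner _ (chartInvDiff p y (chartDiff p y (𝓢.ξ _))) (chartInvDiff p y v) = _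
    rw [chartInvDiff_chartDiff hy, 𝓢.metric_reeb]
    rfl
  phi_sq y hy v := by
    change chartDiff p y (𝓢.Φ _ (chartInvDiff p y (chartDiff p y (𝓢.Φ _ (chartInvDiff p y v)))))
      = -(v - 𝓢.η _ (chartInvDiff p y v) • chartDiff p y (𝓢.ξ _))
    rw [chartInvDiff_chartDiff hy, 𝓢.phi_sq, map_neg, map_sub, map_smul, chartDiff_chartInvDiff hy]
  phi_reeb y hy := by
    change chartDiff p y (𝓢.Φ _ (chartInvDiff p y (chartDiff p y (𝓢.ξ _)))) = 0
    rw [chartInvDiff_chartDiff hy, 𝓢.phi_reeb, map_zero]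
  metric_eq y hy u v := 𝓢.metric_eq p y hy u v
  nabla_phi y hy u v := 𝓢.nabla_phi p y hy u v
  J_reeb y hy := by
    change chartDiff p y (κ.J _ (chartInvDiff p y (chartDiff p y (𝓢.ξ _)))) = 0
    rw [chartInvDiff_chartDiff hy, κ.J_reeb, map_zero]
  J_sq y hy v := by
    change chartDiff p y (κ.J _ (chartInvDiff p y (chartDiff p y (κ.J _ (chartInvDiff p y v)))))
      = -(v - 𝓢.η _ (chartInvDiff p y v) • chartDiff p y (𝓢.ξ _))
    rw [chartInvDiff_chartDiff hy, κ.J_sq, map_neg, map_sub, map_smul, chartDiff_chartInvDiff hy]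
  J_orthogonal y hy v w := by
    change 𝓢.g.inner _ (chartInvDiff p y (chartDiff p y (κ.J _ (chartInvDiff p y v))))
      (chartInvDiff p y (chartDiff p y (κ.J _ (chartInvDiff p y w)))) = _
    rw [chartInvDiff_chartDiff hy, chartInvDiff_chartDiff hy, κ.J_orthogonal]
    rfl
  J_comm y hy v := by
    change chartDiff p y (κ.J _ (chartInvDiff p y (chartDiff p y (𝓢.Φ _ (chartInvDiff p y v)))))
      = chartDiff p y (𝓢.Φ _ (chartInvDiff p y (chartDiff p y (κ.J _ (chartInvDiff p y v)))))
    rw [chartInvDiff_chartDiff hy, chartInvDiff_chartDiff hy, κ.J_comm]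
  parallel y hy u v w := by
    have h1 := κ.parallel p y hy u v w
    rw [locBilin_comp hy, locBilin_comp hy] at h1
    rw [← h1]
    have h2 : (fun z => locBilin (fun q => (𝓢.g.inner q).comp (κ.J q)) p z
        (horiz (locForm 𝓢.η p) (locVec 𝓢.ξ p) z v) (horiz (locForm 𝓢.η p) (locVec 𝓢.ξ p) z w))
        =ᶠ[nhds y] fun z => locBilin 𝓢.g.inner p z (locEnd κ.J p z
          (horiz (locForm 𝓢.η p) (locVec 𝓢.ξ p) z v))
          (horiz (locForm 𝓢.η p) (locVec 𝓢.ξ p) z w) := by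
      filter_upwards [(isOpen_extChartAt_target p).mem_nhds hy] with z hz
      exact locBilin_comp hz _ _ _ _
    rw [h2.fderiv_eq]

end SasakianCharts

section Transport

variable {n : ℕ} {M : Type*} [TopologicalSpace M] [ChartedSpace (EuSp n) M]
  [IsManifold 𝓘(ℝ, EuSp n) ∞ M]

/-- The differential at `q` of the preferred chart at `p`. -/
abbrev chartD (p q : M) : TangentSpace 𝓘(ℝ, EuSp n) q →L[ℝ] EuSp n :=
  mfderiv 𝓘(ℝ, EuSp n) 𝓘(ℝ, EuSp n) (extChartAt 𝓘(ℝ, EuSp n) p) q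

variable {p q : M} (hq : q ∈ (extChartAt 𝓘(ℝ, EuSp n) p).source)
include hq

omit [IsManifold 𝓘(ℝ, EuSp n) ∞ M] in
/-- To prove a property of the point `q` of a chart domain, one may assume that `q` is given by its
coordinates. -/
lemma chart_induction {C : M → EuSp n → Prop}
    (h : ∀ y ∈ (extChartAt 𝓘(ℝ, EuSp n) p).target, C ((extChartAt 𝓘(ℝ, EuSp n) p).symm y) y) :
    C q (extChartAt 𝓘(ℝ, EuSp n) p q) := by
  have := h _ ((extChartAt 𝓘(ℝ, EuSp n) p).map_source hq)
  rwa [(extChartAt 𝓘(ℝ, EuSp n) p).left_inv hq] at this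

lemma locBilin_chartD
    (B : ∀ q : M, TangentSpace 𝓘(ℝ, EuSp n) q →L[ℝ] TangentSpace 𝓘(ℝ, EuSp n) q →L[ℝ] ℝ)
    (v w : TangentSpace 𝓘(ℝ, EuSp n) q) :
    locBilin B p (extChartAt 𝓘(ℝ, EuSp n) p q) (chartD p q v) (chartD p q w) = B q v w := by
  refine chart_induction hq (C := fun q y => ∀ v w : TangentSpace 𝓘(ℝ, EuSp n) q,
    locBilin B p y (chartD p q v) (chartD p q w) = B q v w) (fun y hy v w => ?_) v w
  change B _ (chartInvDiff p y (chartDiff p y v)) (chartInvDiff p y (chartDiff p y w)) = _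
  rw [chartInvDiff_chartDiff hy, chartInvDiff_chartDiff hy]

lemma locForm_chartD (η : ∀ q : M, TangentSpace 𝓘(ℝ, EuSp n) q →L[ℝ] ℝ)
    (v : TangentSpace 𝓘(ℝ, EuSp n) q) :
    locForm η p (extChartAt 𝓘(ℝ, EuSp n) p q) (chartD p q v) = η q v := by
  refine chart_induction hq (C := fun q y => ∀ v : TangentSpace 𝓘(ℝ, EuSp n) q,
    locForm η p y (chartD p q v) = η q v) (fun y hy v => ?_) v
  change η _ (chartInvDiff p y (chartDiff p y v)) = _
  rw [chartInvDiff_chartDiff hy]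

lemma locEnd_chartD
    (Φ : ∀ q : M, TangentSpace 𝓘(ℝ, EuSp n) q →L[ℝ] TangentSpace 𝓘(ℝ, EuSp n) q)
    (v : TangentSpace 𝓘(ℝ, EuSp n) q) :
    locEnd Φ p (extChartAt 𝓘(ℝ, EuSp n) p q) (chartD p q v) = chartD p q (Φ q v) := by
  refine chart_induction hq (C := fun q y => ∀ v : TangentSpace 𝓘(ℝ, EuSp n) q,
    locEnd Φ p y (chartD p q v) = chartD p q (Φ q v)) (fun y hy v => ?_) v
  change chartDiff p y (Φ _ (chartInvDiff p y (chartDiff p y v))) = _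
  rw [chartInvDiff_chartDiff hy]
  rfl

lemma chartD_injective : Function.Injective (chartD (n := n) p q) := by
  have : IsManifold 𝓘(ℝ, EuSp n) 1 M := .of_le (n := ∞) (by norm_cast)
  exact (isInvertible_mfderiv_extChartAt hq).injective

omit hq in
lemma chartD_self (v : TangentSpace 𝓘(ℝ, EuSp n) p) : chartD p p v = v := by
  have : IsManifold 𝓘(ℝ, EuSp n) 1 M := .of_le (n := ∞) (by norm_cast)
  exact congrArg (fun L : EuSp n →L[ℝ] EuSp n => L v)
    (mfderiv_extChartAt_self (I := 𝓘(ℝ, EuSp n)) (x := p))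

omit hq in
lemma chartInvDiff_self (v : EuSp n) :
    chartInvDiff p (extChartAt 𝓘(ℝ, EuSp n) p p) v = v := by
  have : IsManifold 𝓘(ℝ, EuSp n) 1 M := .of_le (n := ∞) (by norm_cast)
  have h := mfderivWithin_range_extChartAt_symm (I := 𝓘(ℝ, EuSp n)) (x := p)
  simp only [modelWithCornersSelf_coe, range_id, mfderivWithin_univ] at h
  exact congrArg (fun L : EuSp n →L[ℝ] EuSp n => L v) h

end Transport

section LocalMaps

variable {n : ℕ} {M : Type*} [TopologicalSpace M] [ChartedSpace (EuSp n) M]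
  [IsManifold 𝓘(ℝ, EuSp n) ∞ M]
  {S : Type*} [TopologicalSpace S] [ChartedSpace (EuSp 2) S] [IsManifold 𝓘(ℝ, EuSp 2) ∞ S]
  {F : S → M} {x₀ : S} {q₀ : M} {y : EuSp 2}

lemma fderiv_locMap (hy : y ∈ (extChartAt 𝓘(ℝ, EuSp 2) x₀).target)
    (hF : MDifferentiableAt 𝓘(ℝ, EuSp 2) 𝓘(ℝ, EuSp n) F ((extChartAt 𝓘(ℝ, EuSp 2) x₀).symm y))
    (hq : F ((extChartAt 𝓘(ℝ, EuSp 2) x₀).symm y) ∈ (extChartAt 𝓘(ℝ, EuSp n) q₀).source)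
    (u : EuSp 2) : fderiv ℝ (locMap F x₀ q₀) y u
      = chartD (n := n) q₀ (F ((extChartAt 𝓘(ℝ, EuSp 2) x₀).symm y))
        (diff (n := n) F ((extChartAt 𝓘(ℝ, EuSp 2) x₀).symm y) (chartInvDiff x₀ y u)) := by
  have : IsManifold 𝓘(ℝ, EuSp n) 1 M := .of_le (n := ∞) (by norm_cast)
  have : IsManifold 𝓘(ℝ, EuSp 2) 1 S := .of_le (n := ∞) (by norm_cast)
  have h1 : MDifferentiableAt 𝓘(ℝ, EuSp 2) 𝓘(ℝ, EuSp 2) (extChartAt 𝓘(ℝ, EuSp 2) x₀).symm y := by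
    have h0 := mdifferentiableWithinAt_extChartAt_symm (I := 𝓘(ℝ, EuSp 2)) hy
    rwa [modelWithCornersSelf_coe, range_id, mdifferentiableWithinAt_univ] at h0
  have h2 : MDifferentiableAt 𝓘(ℝ, EuSp n) 𝓘(ℝ, EuSp n) (extChartAt 𝓘(ℝ, EuSp n) q₀)
      (F ((extChartAt 𝓘(ℝ, EuSp 2) x₀).symm y)) :=
    mdifferentiableAt_extChartAt (by rwa [extChartAt_source] at hq)
  have h3 := (h2.hasMFDerivAt.comp _ hF.hasMFDerivAt).comp y h1.hasMFDerivAt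
  have h4 : HasFDerivAt (locMap F x₀ q₀) ((chartD (n := n) q₀ _).comp
      ((diff (n := n) F _).comp (chartInvDiff x₀ y)) : EuSp 2 →L[ℝ] EuSp n) y := h3.hasFDerivAt
  rw [h4.fderiv]
  rfl

lemma locBilin_pullback (hy : y ∈ (extChartAt 𝓘(ℝ, EuSp 2) x₀).target)
    (hF : MDifferentiableAt 𝓘(ℝ, EuSp 2) 𝓘(ℝ, EuSp n) F ((extChartAt 𝓘(ℝ, EuSp 2) x₀).symm y))
    (hq : F ((extChartAt 𝓘(ℝ, EuSp 2) x₀).symm y) ∈ (extChartAt 𝓘(ℝ, EuSp n) q₀).source)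
    (B : ∀ q : M, TangentSpace 𝓘(ℝ, EuSp n) q →L[ℝ] TangentSpace 𝓘(ℝ, EuSp n) q →L[ℝ] ℝ) :
    locBilin (pullback B F) x₀ y
      = pullForm (locBilin B q₀ (locMap F x₀ q₀ y)) (fderiv ℝ (locMap F x₀ q₀) y) := by
  ext u v
  change B _ (diff (n := n) F _ (chartInvDiff x₀ y u)) (diff (n := n) F _ (chartInvDiff x₀ y v))
    = locBilin B q₀ (locMap F x₀ q₀ y) (fderiv ℝ (locMap F x₀ q₀) y u)
      (fderiv ℝ (locMap F x₀ q₀) y v)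
  rw [fderiv_locMap hy hF hq, fderiv_locMap hy hF hq]
  exact (locBilin_chartD hq B _ _).symm

end LocalMaps

section Hodge

lemma eq_sum_coordVec (v : EuSp 2) : v = v 0 • coordVec 0 + v 1 • coordVec 1 := by
  conv_lhs => rw [← sum_smul_coordVec v, Fin.sum_univ_two]

lemma alternating_eq_det {b : EuSp 2 →L[ℝ] EuSp 2 →L[ℝ] ℝ} (hb : ∀ v, b v v = 0) (e₁ e₂ : EuSp 2) :
    b e₁ e₂ = (e₁ 0 * e₂ 1 - e₁ 1 * e₂ 0) * b (coordVec 0) (coordVec 1) := by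
  have h1 := hb (coordVec 0 + coordVec 1)
  simp only [map_add, add_apply, hb] at h1
  have h2 : b (coordVec 1) (coordVec 0) = -b (coordVec 0) (coordVec 1) := by linarith
  conv_lhs => rw [eq_sum_coordVec e₁, eq_sum_coordVec e₂]
  simp only [map_add, map_smul, add_apply, smul_apply, smul_eq_mul, hb, h2]
  ring

/-- The Hodge star in an arbitrary oriented basis. -/
lemma hodgeStar_eq {G μ β : EuSp 2 →L[ℝ] EuSp 2 →L[ℝ] ℝ} (hG : IsInner G) (hμ : ∀ v, μ v v = 0)
    (hβ : ∀ v, β v v = 0) {e₁ e₂ : EuSp 2} (hpos : 0 < μ e₁ e₂) :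
    hodgeStar G μ β = β e₁ e₂ / Real.sqrt (areaSq G e₁ e₂) := by
  have harea : areaSq G e₁ e₂
      = (e₁ 0 * e₂ 1 - e₁ 1 * e₂ 0) ^ 2 * areaSq G (coordVec 0) (coordVec 1) := by
    rw [areaSq]
    conv_lhs => rw [eq_sum_coordVec e₁, eq_sum_coordVec e₂]
    simp only [map_add, map_smul, add_apply, smul_apply, smul_eq_mul,
      hG.symm (coordVec 1) (coordVec 0), areaSq]
    ring
  rw [alternating_eq_det hμ] at hpos
  rw [alternating_eq_det hβ, harea, Real.sqrt_mul (sq_nonneg _), Real.sqrt_sq_eq_abs, hodgeStar]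
  change _ / (_ * Real.sqrt (areaSq G (coordVec 0) (coordVec 1))) = _
  generalize e₁ 0 * e₂ 1 - e₁ 1 * e₂ 0 = D at *
  rcases lt_trichotomy D 0 with hD | hD | hD
  · have h0 : μ (coordVec 0) (coordVec 1) < 0 := by
      by_contra h; push Not at h; nlinarith
    rw [Real.sign_of_neg h0, abs_of_neg hD, neg_mul, neg_mul, one_mul, div_neg, div_neg,
      mul_div_mul_left _ _ hD.ne]
  · rw [hD] at hpos; simp at hpos
  · have h0 : 0 < μ (coordVec 0) (coordVec 1) := by
      by_contra h; push Not at h; nlinarith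
    rw [Real.sign_of_pos h0, abs_of_pos hD, one_mul, mul_div_mul_left _ _ hD.ne']

end Hodge

/-! ### The flow in charts -/

section Boxes

variable {M : Type*} [TopologicalSpace M] [ChartedSpace (EuSp 5) M]
  [IsManifold 𝓘(ℝ, EuSp 5) ∞ M]
  {S : Type*} [TopologicalSpace S] [ChartedSpace (EuSp 2) S] [IsManifold 𝓘(ℝ, EuSp 2) ∞ S]

/-- A product `O × V` of a set of times and a set of coordinates, in the chart at `x`, that the
flow `F` maps to the chart domain at `q₀`. -/
structure IsFlowBox (T : ℝ) (F : ℝ → S → M) (x : S) (q₀ : M) (O : Set ℝ) (V : Set (EuSp 2)) :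
    Prop where
  isOpen_time : IsOpen O
  isOpen : IsOpen V
  subset : V ⊆ (extChartAt 𝓘(ℝ, EuSp 2) x).target
  maps : ∀ s ∈ Ico 0 T ∩ O, ∀ z ∈ V,
    F s ((extChartAt 𝓘(ℝ, EuSp 2) x).symm z) ∈ (extChartAt 𝓘(ℝ, EuSp 5) q₀).source

variable {𝓢 : SasakianStructure 5 M} {κ : ParallelTransverseKahlerForm 𝓢} {μ : AreaForm S}
  {T : ℝ} {F : ℝ → S → M} {α : ℝ → S → ℝ}

omit [IsManifold 𝓘(ℝ, EuSp 2) ∞ S] in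
lemma IsLegendrianMCF.exists_flowBox (hF : IsLegendrianMCF 𝓢 T F α) {t : ℝ} (ht : t ∈ Ico 0 T)
    (x : S) : ∃ O V, t ∈ O ∧ extChartAt 𝓘(ℝ, EuSp 2) x x ∈ V ∧ IsFlowBox T F x (F t x) O V := by
  set φ := extChartAt 𝓘(ℝ, EuSp 2) x with hφ
  have hT : IsOpen φ.target := isOpen_extChartAt_target x
  have hxT : φ x ∈ φ.target := mem_extChartAt_target x
  have h1 : ContinuousOn (fun q : ℝ × EuSp 2 => F q.1 (φ.symm q.2)) (Ico 0 T ×ˢ φ.target) := by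
    refine hF.smooth.continuousOn.comp (f := fun q : ℝ × EuSp 2 => (q.1, φ.symm q.2))
      (continuousOn_fst.prodMk ((continuousOn_extChartAt_symm x).comp continuousOn_snd
        fun q hq => hq.2)) fun q hq => ⟨hq.1, mem_univ _⟩
  have h2 := h1 (t, φ x) ⟨ht, hxT⟩
  have h3 : (extChartAt 𝓘(ℝ, EuSp 5) (F t x)).source ∈ nhds (F t (φ.symm (φ x))) := by
    rw [extChartAt_to_inv]
    exact extChartAt_source_mem_nhds _
  have h4 := h2 h3
  rw [nhdsWithin_prod_eq, Filter.mem_map, Filter.mem_prod_iff] at h4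
  obtain ⟨A, hA, B, hB, hAB⟩ := h4
  obtain ⟨O, hO, htO, hOA⟩ := mem_nhdsWithin.1 hA
  rw [hT.nhdsWithin_eq hxT] at hB
  obtain ⟨V, hVB, hV, hxV⟩ := mem_nhds_iff.1 (Filter.inter_mem hB (hT.mem_nhds hxT))
  exact ⟨O, V, htO, hxV, hO, hV, fun z hz => (hVB hz).2, fun s hs z hz =>
    hAB (mk_mem_prod (hOA ⟨hs.2, hs.1⟩) (hVB hz).1)⟩

omit [IsManifold 𝓘(ℝ, EuSp 2) ∞ S] in
lemma IsLegendrianMCF.contMDiff_slice (hF : IsLegendrianMCF 𝓢 T F α) {t : ℝ} (ht : t ∈ Ico 0 T) :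
    ContMDiff 𝓘(ℝ, EuSp 2) 𝓘(ℝ, EuSp 5) ∞ (F t) := by
  have h1 : ContMDiff 𝓘(ℝ, EuSp 2) (𝓘(ℝ, ℝ).prod 𝓘(ℝ, EuSp 2)) ∞ (fun x : S => (t, x)) :=
    contMDiff_const.prodMk contMDiff_id
  exact contMDiffOn_univ.1 (hF.smooth.comp h1.contMDiffOn fun x _ => ⟨ht, mem_univ _⟩)

omit [IsManifold 𝓘(ℝ, EuSp 2) ∞ S] in
lemma IsLegendrianMCF.mdiffAt (hF : IsLegendrianMCF 𝓢 T F α) {t : ℝ} (ht : t ∈ Ico 0 T) (x : S) :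
    MDifferentiableAt 𝓘(ℝ, EuSp 2) 𝓘(ℝ, EuSp 5) (F t) x :=
  ((hF.contMDiff_slice ht) x).mdifferentiableAt (by simp)

lemma IsLegendrianMCF.differentiableAt_angle (hF : IsLegendrianMCF 𝓢 T F α) {t : ℝ}
    (ht : t ∈ Ico 0 T) (x : S) {y : EuSp 2} (hy : y ∈ (extChartAt 𝓘(ℝ, EuSp 2) x).target) :
    DifferentiableAt ℝ (fun z => α t ((extChartAt 𝓘(ℝ, EuSp 2) x).symm z)) y := by
  have h1 : ContMDiffOn 𝓘(ℝ, EuSp 2) (𝓘(ℝ, ℝ).prod 𝓘(ℝ, EuSp 2)) ∞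
      (fun z => (t, (extChartAt 𝓘(ℝ, EuSp 2) x).symm z)) (extChartAt 𝓘(ℝ, EuSp 2) x).target :=
    contMDiffOn_const.prodMk (contMDiffOn_extChartAt_symm x)
  have h2 := (hF.smooth_angle.comp h1 fun z _ => ⟨ht, mem_univ _⟩).contDiffOn
  exact (h2.contDiffAt ((isOpen_extChartAt_target x).mem_nhds hy)).differentiableAt (by simp)

namespace IsFlowBox

variable {x : S} {q₀ : M} {O : Set ℝ} {V : Set (EuSp 2)} (hb : IsFlowBox T F x q₀ O V)
  (hF : IsLegendrianMCF 𝓢 T F α)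

include hb

omit [IsManifold 𝓘(ℝ, EuSp 5) ∞ M] [IsManifold 𝓘(ℝ, EuSp 2) ∞ S] in
lemma uniqueDiffOn : UniqueDiffOn ℝ (Ico 0 T ∩ O) :=
  (uniqueDiffOn_Ico 0 T).inter hb.isOpen_time

omit [IsManifold 𝓘(ℝ, EuSp 5) ∞ M] [IsManifold 𝓘(ℝ, EuSp 2) ∞ S] in
lemma mem_closure {t : ℝ} (ht : t ∈ Ico 0 T ∩ O) : t ∈ closure (interior (Ico 0 T ∩ O)) := by
  rw [interior_inter, hb.isOpen_time.interior_eq, interior_Ico, inter_comm]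
  refine hb.isOpen_time.inter_closure ⟨ht.2, ?_⟩
  rw [closure_Ioo (ht.1.1.trans_lt ht.1.2).ne]
  exact Ico_subset_Icc_self ht.1

include hF

lemma contDiffOn : ContDiffOn ℝ ∞ (fun q : ℝ × EuSp 2 => locMap (n := 5) (F q.1) x q₀ q.2)
    ((Ico 0 T ∩ O) ×ˢ V) := by
  have h1 : ContMDiffOn 𝓘(ℝ, ℝ × EuSp 2) (𝓘(ℝ, ℝ).prod 𝓘(ℝ, EuSp 2)) ∞
      (fun q : ℝ × EuSp 2 => (q.1, (extChartAt 𝓘(ℝ, EuSp 2) x).symm q.2)) ((Ico 0 T ∩ O) ×ˢ V) :=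
    contDiff_fst.contMDiff.contMDiffOn.prodMk ((contMDiffOn_extChartAt_symm x).comp
      contDiff_snd.contMDiff.contMDiffOn fun q hq => hb.subset hq.2)
  have h2 := hF.smooth.comp h1 fun q hq => ⟨hq.1.1, mem_univ _⟩
  have h3 := (contMDiffOn_extChartAt (I := 𝓘(ℝ, EuSp 5)) (n := ∞) (x := q₀)).comp h2 fun q hq => by
    rw [mem_preimage, ← extChartAt_source 𝓘(ℝ, EuSp 5)]
    exact hb.maps _ hq.1 _ hq.2
  exact h3.contDiffOn

variable {s : ℝ} (hs : s ∈ Ico 0 T ∩ O)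
include hs

lemma fderiv_locMap {z : EuSp 2} (hz : z ∈ V) (u : EuSp 2) :
    fderiv ℝ (locMap (n := 5) (F s) x q₀) z u
      = chartD (n := 5) q₀ (F s ((extChartAt 𝓘(ℝ, EuSp 2) x).symm z))
        (diff (n := 5) (F s) ((extChartAt 𝓘(ℝ, EuSp 2) x).symm z) (chartInvDiff x z u)) :=
  LegendrianFlow.fderiv_locMap (hb.subset hz) (hF.mdiffAt hs.1 _) (hb.maps s hs z hz) u

lemma locBilin_pullback {z : EuSp 2} (hz : z ∈ V) :
    locBilin (pullback 𝓢.g.inner (F s)) x z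
      = induced (locBilin 𝓢.g.inner q₀) (locMap (F s) x q₀) z :=
  LegendrianFlow.locBilin_pullback (hb.subset hz) (hF.mdiffAt hs.1 _) (hb.maps s hs z hz) _

lemma eventuallyEq_induced {z : EuSp 2} (hz : z ∈ V) :
    locBilin (pullback 𝓢.g.inner (F s)) x
      =ᶠ[nhds z] induced (locBilin 𝓢.g.inner q₀) (locMap (F s) x q₀) := by
  filter_upwards [hb.isOpen.mem_nhds hz] with w hw using hb.locBilin_pullback hF hs hw

lemma isLegendrianChart (κ : ParallelTransverseKahlerForm 𝓢) :
    IsLegendrianChart V (extChartAt 𝓘(ℝ, EuSp 5) q₀).target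
    (locBilin 𝓢.g.inner q₀) (locForm 𝓢.η q₀) (locVec 𝓢.ξ q₀) (locEnd 𝓢.Φ q₀) (locEnd κ.J q₀)
    (locMap (F s) x q₀) where
  chart := isSasakianChart 𝓢 κ q₀
  isOpen := hb.isOpen
  smooth := (hb.contDiffOn hF).comp (contDiff_prodMk_right s).contDiffOn fun _ hz => ⟨hs, hz⟩
  mapsTo z hz := (extChartAt 𝓘(ℝ, EuSp 5) q₀).map_source (hb.maps s hs z hz)
  legendrian z hz u := by
    rw [hb.fderiv_locMap hF hs hz]
    exact (locForm_chartD (hb.maps s hs z hz) 𝓢.η _).trans (hF.legendrian s hs.1 _ _)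
  injective z hz := by
    intro u v huv
    rw [hb.fderiv_locMap hF hs hz, hb.fderiv_locMap hF hs hz] at huv
    have h1 := hF.immersion s hs.1 _ (chartD_injective (hb.maps s hs z hz) huv)
    rw [← chartDiff_chartInvDiff (hb.subset hz) u, h1, chartDiff_chartInvDiff (hb.subset hz)]

/-- `Ω` in coordinates. -/
lemma starOmega_eq (κ : ParallelTransverseKahlerForm 𝓢) {z : EuSp 2} (hz : z ∈ V) {e₁ e₂ : EuSp 2}
    (hpos : 0 < locBilin μ.form x z e₁ e₂) :
    starOmega κ μ (F s) ((extChartAt 𝓘(ℝ, EuSp 2) x).symm z)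
      = locBilin 𝓢.g.inner q₀ (locMap (F s) x q₀ z) (locEnd κ.J q₀ (locMap (F s) x q₀ z)
          (fderiv ℝ (locMap (F s) x q₀) z e₁)) (fderiv ℝ (locMap (F s) x q₀) z e₂)
        / Real.sqrt (areaSq (induced (locBilin 𝓢.g.inner q₀) (locMap (F s) x q₀) z) e₁ e₂) := by
  have hq := hb.maps s hs z hz
  have hch := isSasakianChart 𝓢 κ q₀
  have hp := (hb.isLegendrianChart hF hs κ).mapsTo hz
  set x' := (extChartAt 𝓘(ℝ, EuSp 2) x).symm z with hx'
  have hG : IsInner (pullback 𝓢.g.inner (F s) x' : EuSp 2 →L[ℝ] EuSp 2 →L[ℝ] ℝ) :=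
    ⟨fun u v => 𝓢.g.symm _ _ _, fun u hu => 𝓢.g.pos _ _ fun h0 =>
      hu (hF.immersion s hs.1 x' (h0.trans (map_zero _).symm))⟩
  have hform : ∀ v w : TangentSpace 𝓘(ℝ, EuSp 5) (F s x'), κ.form (F s x') v w
      = locBilin 𝓢.g.inner q₀ (locMap (F s) x q₀ z) (locEnd κ.J q₀ (locMap (F s) x q₀ z)
        (chartD q₀ (F s x') v)) (chartD q₀ (F s x') w) := by
    intro v w
    have h1 := locEnd_chartD hq κ.J v
    have h2 := locBilin_chartD hq 𝓢.g.inner (κ.J _ v) w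
    exact (h2.symm.trans (congrArg (fun X => locBilin 𝓢.g.inner q₀ (locMap (F s) x q₀ z) X
        (chartD q₀ (F s x') w)) h1.symm))
  have hβ : ∀ v, (pullback κ.form (F s) x' : EuSp 2 →L[ℝ] EuSp 2 →L[ℝ] ℝ) v v = 0 := by
    intro v
    exact (hform _ _).trans (IsLegendrianFrame.form_self hch hp _)
  have h1 := hodgeStar_eq hG (μ.alternating x') hβ (e₁ := chartInvDiff x z e₁)
    (e₂ := chartInvDiff x z e₂) hpos
  have h2 : areaSq (pullback 𝓢.g.inner (F s) x') (chartInvDiff x z e₁) (chartInvDiff x z e₂)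
      = areaSq (locBilin (pullback 𝓢.g.inner (F s)) x z) e₁ e₂ := rfl
  rw [h2, hb.locBilin_pullback hF hs hz] at h1
  rw [hb.fderiv_locMap hF hs hz, hb.fderiv_locMap hF hs hz]
  refine h1.trans ?_
  congr 1
  exact hform _ _

end IsFlowBox

end Boxes

/-! ### The evolution equation on the surface -/

lemma areaSq_pos {b μ : EuSp 2 →L[ℝ] EuSp 2 →L[ℝ] ℝ} (hb : IsInner b) (hμ : ∀ v, μ v v = 0)
    {e₁ e₂ : EuSp 2} (hpos : 0 < μ e₁ e₂) : 0 < areaSq b e₁ e₂ := by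
  have h1 : e₁ ≠ 0 := by rintro rfl; simp at hpos
  have h11 := hb.pos e₁ h1
  have hw : b e₁ e₁ • e₂ - b e₁ e₂ • e₁ ≠ 0 := by
    intro h0
    have := congrArg (μ e₁) h0
    simp only [map_sub, map_smul, smul_eq_mul, hμ, mul_zero, sub_zero, map_zero] at this
    exact (mul_pos h11 hpos).ne' this
  have h2 := hb.pos _ hw
  simp only [map_sub, map_smul, sub_apply, smul_apply, smul_eq_mul, hb.symm e₂ e₁] at h2
  rw [areaSq]
  by_contra h
  push Not at h
  nlinarith

section Congr

variable {n m : ℕ} {G G' : EuSp n → EuSp n →L[ℝ] EuSp n →L[ℝ] ℝ}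
  {y : EuSp n} (h : G =ᶠ[nhds y] G')
include h

lemma secondFundLocal_congr (K : EuSp m → EuSp m →L[ℝ] EuSp m →L[ℝ] ℝ) (f : EuSp n → EuSp m)
    (u v : EuSp n) : secondFundLocal G K f y u v = secondFundLocal G' K f y u v := by
  rw [secondFundLocal, secondFundLocal, christoffel_congr h]

lemma meanCurvLocal_congr (K : EuSp m → EuSp m →L[ℝ] EuSp m →L[ℝ] ℝ) (f : EuSp n → EuSp m) :
    meanCurvLocal G K f y = meanCurvLocal G' K f y := by
  simp only [meanCurvLocal, secondFundLocal_congr h, h.self_of_nhds]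

lemma laplacian_congr (a : EuSp n → ℝ) : laplacian G a y = laplacian G' a y := by
  simp only [laplacian, christoffel_congr h, h.self_of_nhds]

end Congr

section Flow

variable {M : Type*} [TopologicalSpace M] [ChartedSpace (EuSp 5) M]
  [IsManifold 𝓘(ℝ, EuSp 5) ∞ M]
  {S : Type*} [TopologicalSpace S] [ChartedSpace (EuSp 2) S] [IsManifold 𝓘(ℝ, EuSp 2) ∞ S]
  {𝓢 : SasakianStructure 5 M} {T : ℝ} {F : ℝ → S → M} {α : ℝ → S → ℝ}

omit [IsManifold 𝓘(ℝ, EuSp 5) ∞ M] in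
lemma locBilin_self {N : Type*} {n : ℕ} [TopologicalSpace N] [ChartedSpace (EuSp n) N]
    [IsManifold 𝓘(ℝ, EuSp n) ∞ N]
    (B : ∀ q : N, TangentSpace 𝓘(ℝ, EuSp n) q →L[ℝ] TangentSpace 𝓘(ℝ, EuSp n) q →L[ℝ] ℝ)
    (q : N) (v w : TangentSpace 𝓘(ℝ, EuSp n) q) :
    locBilin B q (extChartAt 𝓘(ℝ, EuSp n) q q) v w = B q v w := by
  have h := locBilin_chartD (mem_extChartAt_source (I := 𝓘(ℝ, EuSp n)) q) B v w
  rwa [chartD_self, chartD_self] at h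

lemma locEnd_self (A : ∀ q : M, TangentSpace 𝓘(ℝ, EuSp 5) q →L[ℝ] TangentSpace 𝓘(ℝ, EuSp 5) q)
    (q : M) (v : TangentSpace 𝓘(ℝ, EuSp 5) q) :
    locEnd A q (extChartAt 𝓘(ℝ, EuSp 5) q q) v = A q v := by
  have h := locEnd_chartD (mem_extChartAt_source (I := 𝓘(ℝ, EuSp 5)) q) A v
  rwa [chartD_self, chartD_self] at h

lemma locForm_self (θ : ∀ q : M, TangentSpace 𝓘(ℝ, EuSp 5) q →L[ℝ] ℝ)
    (q : M) (v : TangentSpace 𝓘(ℝ, EuSp 5) q) :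
    locForm θ q (extChartAt 𝓘(ℝ, EuSp 5) q q) v = θ q v := by
  have h := locForm_chartD (mem_extChartAt_source (I := 𝓘(ℝ, EuSp 5)) q) θ v
  rwa [chartD_self] at h

lemma locBilin_locEnd_self
    (B : ∀ q : M, TangentSpace 𝓘(ℝ, EuSp 5) q →L[ℝ] TangentSpace 𝓘(ℝ, EuSp 5) q →L[ℝ] ℝ)
    (A : ∀ q : M, TangentSpace 𝓘(ℝ, EuSp 5) q →L[ℝ] TangentSpace 𝓘(ℝ, EuSp 5) q)
    (q : M) (u v : TangentSpace 𝓘(ℝ, EuSp 5) q) :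
    locBilin B q (extChartAt 𝓘(ℝ, EuSp 5) q q)
      (locEnd A q (extChartAt 𝓘(ℝ, EuSp 5) q q) u) v = B q (A q u) v :=
  (congrArg (fun X => locBilin B q _ X _) (locEnd_self A _ _)).trans (locBilin_self _ _ _ _)

lemma AreaForm.exists_pos (μ : AreaForm S) (x : S) :
    ∃ e₁ e₂ : TangentSpace 𝓘(ℝ, EuSp 2) x, 0 < μ.form x e₁ e₂ := by
  by_contra! h
  refine μ.nonzero x (ContinuousLinearMap.ext fun u => ContinuousLinearMap.ext fun v => ?_)
  have h1 := h u (-v)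
  rw [map_neg] at h1
  exact le_antisymm (h u v) (by simpa using h1)

lemma AreaForm.isOpen_pos (μ : AreaForm S) (x : S) (e₁ e₂ : EuSp 2) :
    IsOpen {z | z ∈ (extChartAt 𝓘(ℝ, EuSp 2) x).target ∧ 0 < locBilin μ.form x z e₁ e₂} := by
  have h1 : ContinuousOn (fun z => locBilin μ.form x z e₁ e₂)
      (extChartAt 𝓘(ℝ, EuSp 2) x).target :=
    (((contDiffOn_locBilin μ.smooth).clm_apply contDiffOn_const).clm_apply
      contDiffOn_const).continuousOn
  exact h1.isOpen_inter_preimage (isOpen_extChartAt_target x) isOpen_Ioi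

lemma IsLegendrianMCF.fderiv_locMap_self (hF : IsLegendrianMCF 𝓢 T F α) {t : ℝ} (ht : t ∈ Ico 0 T)
    (x : S) (u : TangentSpace 𝓘(ℝ, EuSp 2) x) :
    fderiv ℝ (locMap (n := 5) (F t) x (F t x)) (extChartAt 𝓘(ℝ, EuSp 2) x x) u
      = diff (n := 5) (F t) x u := by
  have h1 := fderiv_locMap (n := 5) (q₀ := F t x) (mem_extChartAt_target (I := 𝓘(ℝ, EuSp 2)) x)
    (hF.mdiffAt ht _) (by rw [extChartAt_to_inv]; exact mem_extChartAt_source _) u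
  refine h1.trans (((congrArg (fun X : EuSp 2 => chartD (n := 5) (F t x) _
    (diff (n := 5) (F t) _ X)) (chartInvDiff_self (p := x) u)).trans ?_).trans (chartD_self _))
  exact congrArg (fun x' => chartD (n := 5) (F t x) (F t x') (diff (n := 5) (F t) x' u))
    (extChartAt_to_inv x)

set_option maxHeartbeats 1600000 in
/-- The evolution equation of `Ω`: `evolution_local` in the charts centred at `x` and `F t x`. At
the centre of a chart the coordinate expression of a tensor is the tensor itself. -/
theorem IsLegendrianMCF.hasDerivWithinAt_starOmega (hF : IsLegendrianMCF 𝓢 T F α)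
    (κ : ParallelTransverseKahlerForm 𝓢) (μ : AreaForm S) {t : ℝ} (ht : t ∈ Ico 0 T) {x : S}
    {e₁ e₂ : TangentSpace 𝓘(ℝ, EuSp 2) x} (he : IsOrientedFrame 𝓢 μ (F t) x e₁ e₂) :
    HasDerivWithinAt (fun s => starOmega κ μ (F s) x)
        (surfaceLaplacian 𝓢 (F t) (starOmega κ μ (F t)) x
          + (2 * normSqSecondFund 𝓢 (F t) x e₁ e₂ - normSqMeanCurv 𝓢 (F t) x e₁ e₂)
            * starOmega κ μ (F t) x
          + (1 - starOmega κ μ (F t) x ^ 2)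
            * 𝓢.ricT (F t x) (κ.J (F t x) (diff (F t) x e₁)) (diff (F t) x e₂))
        (Ico 0 T) t := by
  obtain ⟨O, V, htO, hxV, hb⟩ := hF.exists_flowBox ht x
  have hI : t ∈ Ico 0 T ∩ O := ⟨ht, htO⟩
  set y := extChartAt 𝓘(ℝ, EuSp 2) x x with hy
  have hyx : (extChartAt 𝓘(ℝ, EuSp 2) x).symm y = x := extChartAt_to_inv x
  have hfy : locMap (F t) x (F t x) y = extChartAt 𝓘(ℝ, EuSp 5) (F t x) (F t x) := by
    rw [locMap, hyx]
  have hLC := hb.isLegendrianChart hF hI κ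
  have hind := hb.locBilin_pullback hF hI hxV
  have hindn := hb.eventuallyEq_induced hF hI hxV
  have hpull : ∀ u v : EuSp 2, induced (locBilin 𝓢.g.inner (F t x)) (locMap (F t) x (F t x)) y u v
      = pullback 𝓢.g.inner (F t) x u v := by
    intro u v
    rw [← hind]
    exact locBilin_self _ x u v
  have hμ : 0 < locBilin μ.form x y e₁ e₂ := by
    have h1 := locBilin_self μ.form x e₁ e₂
    rw [h1]
    exact he.2.2.2
  have hμn : ∀ᶠ z in nhds y, 0 < locBilin μ.form x z e₁ e₂ :=
    Filter.mem_of_superset ((μ.isOpen_pos x e₁ e₂).mem_nhds ⟨hb.subset hxV, hμ⟩) fun _ h => h.2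
  have key := evolution_local (f := fun s => locMap (n := 5) (F s) x (F t x))
    (α := fun z => α t ((extChartAt 𝓘(ℝ, EuSp 2) x).symm z)) (e₁ := e₁) (e₂ := e₂)
    (Ω := fun s z => starOmega κ μ (F s)
      ((extChartAt 𝓘(ℝ, EuSp 2) x).symm z)) hLC hxV (hb.contDiffOn hF) hb.uniqueDiffOn hI
    (hb.mem_closure hI) (hF.differentiableAt_angle ht x (hb.subset hxV)) (fun z hz => by
      have h1 := hF.evolves t ht x (F t x) z (hb.subset hz) (hb.maps t hI z hz)
      rw [meanCurvLocal_congr (hb.eventuallyEq_induced hF hI hz)] at h1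
      rw [← h1]
      exact derivWithin_inter (hb.isOpen_time.mem_nhds htO))
    ((hpull e₁ e₁).trans he.1) ((hpull e₂ e₂).trans he.2.1) ((hpull e₁ e₂).trans he.2.2.1)
    (by
      filter_upwards [hb.isOpen.mem_nhds hxV, hμn] with z hz hz0
      exact hb.starOmega_eq hF hI κ hz hz0)
    (by
      filter_upwards [self_mem_nhdsWithin] with s hs
      exact hb.starOmega_eq hF hs κ hxV hμ)
    (A₁₁ := secondFund 𝓢 (F t) x e₁ e₁) (A₁₂ := secondFund 𝓢 (F t) x e₁ e₂)
    (A₂₂ := secondFund 𝓢 (F t) x e₂ e₂) (secondFundLocal_congr hindn _ _ _ _)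
    (secondFundLocal_congr hindn _ _ _ _) (secondFundLocal_congr hindn _ _ _ _)
  rw [hasDerivWithinAt_inter (hb.isOpen_time.mem_nhds htO)] at key
  simp only [← laplacian_congr hindn, hyx] at key
  refine key.congr_deriv ?_
  rw [hfy]
  have hs : ∀ u v : EuSp 2, secondFundLocal (induced (locBilin 𝓢.g.inner (F t x))
        (locMap (F t) x (F t x))) (locBilin 𝓢.g.inner (F t x)) (locMap (F t) x (F t x)) y u v
      = secondFundLocal (induced (locBilin 𝓢.g.inner (F t x))
        (locMap (F t) x (F t x))) (locBilin 𝓢.g.inner (F t x)) (locMap (F t) x (F t x)) y v u := by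
    intro u v
    rw [hLC.secondFundLocal_eq hxV, hLC.secondFundLocal_eq hxV, hLC.hess_symm hxV,
      christoffel_symm (hLC.induced_inner hxV) (hLC.diffAt hxV hLC.contDiffOn_induced) (by
      filter_upwards [hb.isOpen.mem_nhds hxV] with q hq using (hLC.induced_inner hq).symm)]
  have s21 : secondFund 𝓢 (F t) x e₂ e₁ = secondFund 𝓢 (F t) x e₁ e₂ :=
    (secondFundLocal_congr hindn _ _ _ _).trans
      ((hs e₂ e₁).trans (secondFundLocal_congr hindn _ _ _ _).symm)
  have hg : locBilin 𝓢.g.inner (F t x) (extChartAt 𝓘(ℝ, EuSp 5) (F t x) (F t x))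
      = 𝓢.g.inner (F t x) :=
    ContinuousLinearMap.ext fun v => ContinuousLinearMap.ext fun w => locBilin_self _ _ v w
  have hR : ricciTrans (locBilin 𝓢.g.inner (F t x)) (locForm 𝓢.η (F t x)) (locVec 𝓢.ξ (F t x))
      (extChartAt 𝓘(ℝ, EuSp 5) (F t x) (F t x))
      (locEnd κ.J (F t x) (extChartAt 𝓘(ℝ, EuSp 5) (F t x) (F t x))
        (fderiv ℝ (locMap (F t) x (F t x)) y e₁)) (fderiv ℝ (locMap (F t) x (F t x)) y e₂)
      = 𝓢.ricT (F t x) (κ.J (F t x) (diff (F t) x e₁)) (diff (F t) x e₂) := by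
    rw [hF.fderiv_locMap_self ht, hF.fderiv_locMap_self ht]
    exact congrArg (fun X => ricciTrans _ _ _ _ X _) (locEnd_self κ.J _ _)
  rw [hR]
  have hA : normSqSecondFund 𝓢 (F t) x e₁ e₂
      = 𝓢.g.inner (F t x) (secondFund 𝓢 (F t) x e₁ e₁) (secondFund 𝓢 (F t) x e₁ e₁)
        + 2 * 𝓢.g.inner (F t x) (secondFund 𝓢 (F t) x e₁ e₂) (secondFund 𝓢 (F t) x e₁ e₂)
        + 𝓢.g.inner (F t x) (secondFund 𝓢 (F t) x e₂ e₂) (secondFund 𝓢 (F t) x e₂ e₂) := by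
    simp only [normSqSecondFund, Fin.sum_univ_two, Matrix.cons_val_zero, Matrix.cons_val_one, s21]
    ring
  rw [hA, normSqMeanCurv]
  rw [hg]
  rfl

/-- In a flow box `Ω = g(J V₁, V₂) / √area²` for the images `Vᵢ` of a fixed positively oriented pair
of coordinate vectors, a quotient of smooth functions with positive radicand. -/
theorem IsLegendrianMCF.contMDiffOn_starOmega (hF : IsLegendrianMCF 𝓢 T F α)
    (κ : ParallelTransverseKahlerForm 𝓢) (μ : AreaForm S) :
    ContMDiffOn (𝓘(ℝ, ℝ).prod 𝓘(ℝ, EuSp 2)) 𝓘(ℝ, ℝ) ∞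
        (fun q : ℝ × S => starOmega κ μ (F q.1) q.2) (Ico 0 T ×ˢ univ) := by
  rintro ⟨t, x⟩ ⟨ht, -⟩
  change t ∈ Ico 0 T at ht
  obtain ⟨O, V, htO, hxV, hb⟩ := hF.exists_flowBox ht x
  obtain ⟨e₁, e₂, he⟩ := μ.exists_pos x
  have hμ : 0 < locBilin μ.form x (extChartAt 𝓘(ℝ, EuSp 2) x x) e₁ e₂ := by
    have h1 := locBilin_self μ.form x e₁ e₂
    rw [h1]
    exact he
  set V' := V ∩ {z | z ∈ (extChartAt 𝓘(ℝ, EuSp 2) x).target ∧ 0 < locBilin μ.form x z e₁ e₂}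
    with hV'
  have hV'o : IsOpen V' := hb.isOpen.inter (μ.isOpen_pos x e₁ e₂)
  set f : ℝ × EuSp 2 → EuSp 5 := fun q => locMap (F q.1) x (F t x) q.2 with hf
  set I := Ico 0 T ∩ O with hI
  have hfs : ContDiffOn ℝ ∞ f (I ×ˢ V) := hb.contDiffOn hF
  have hS : UniqueDiffOn ℝ (I ×ˢ V) := hb.uniqueDiffOn.prod hb.isOpen.uniqueDiffOn
  have hfU : MapsTo f (I ×ˢ V) (extChartAt 𝓘(ℝ, EuSp 5) (F t x)).target := fun q hq =>
    (hb.isLegendrianChart hF hq.1 κ).mapsTo hq.2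
  have hch := isSasakianChart 𝓢 κ (F t x)
  have hT : ∀ u : EuSp 2, ContDiffOn ℝ ∞
      (fun q : ℝ × EuSp 2 => fderiv ℝ (locMap (n := 5) (F q.1) x (F t x)) q.2 u) (I ×ˢ V) := by
    intro u
    refine ((hfs.fderivWithin hS (m := ∞) (by simp)).clm_apply
      (contDiffOn_const (c := ((0, u) : ℝ × EuSp 2)))).congr fun q hq => ?_
    rw [(hasFDerivAt_slice (f := fun s z => locMap (n := 5) (F s) x (F t x) z) hfs hb.isOpen
      hq.1 hq.2).fderiv]
    rfl
  have hGf := hch.smooth_G.comp hfs hfU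
  have hN : ContDiffOn ℝ ∞ (fun q : ℝ × EuSp 2 =>
      locBilin 𝓢.g.inner (F t x) (f q) (locEnd κ.J (F t x) (f q)
          (fderiv ℝ (locMap (n := 5) (F q.1) x (F t x)) q.2 e₁))
          (fderiv ℝ (locMap (n := 5) (F q.1) x (F t x)) q.2 e₂)) (I ×ˢ V) :=
    (hGf.clm_apply ((hch.smooth_J.comp hfs hfU).clm_apply (hT e₁))).clm_apply (hT e₂)
  have hg : ∀ u v : EuSp 2, ContDiffOn ℝ ∞ (fun q : ℝ × EuSp 2 =>
      induced (locBilin 𝓢.g.inner (F t x)) (locMap (F q.1) x (F t x)) q.2 u v) (I ×ˢ V) :=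
    fun u v => (hGf.clm_apply (hT u)).clm_apply (hT v)
  have hA : ContDiffOn ℝ ∞ (fun q : ℝ × EuSp 2 => areaSq (induced (locBilin 𝓢.g.inner (F t x))
      (locMap (F q.1) x (F t x)) q.2) e₁ e₂) (I ×ˢ V) :=
    ((hg _ _).mul (hg _ _)).sub ((hg _ _).pow 2)
  have hsub : I ×ˢ V' ⊆ I ×ˢ V := prod_mono_right inter_subset_left
  have hApos : ∀ q ∈ I ×ˢ V', 0 < areaSq (induced (locBilin 𝓢.g.inner (F t x))
      (locMap (F q.1) x (F t x)) q.2) e₁ e₂ := fun q hq =>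
    areaSq_pos (μ := locBilin μ.form x q.2)
      ((hb.isLegendrianChart hF hq.1 κ).induced_inner hq.2.1) (fun v => μ.alternating _ _)
      hq.2.2.2
  have hloc := (hN.mono hsub).div ((hA.mono hsub).sqrt fun q hq => (hApos q hq).ne')
    (fun q hq => (Real.sqrt_pos.2 (hApos q hq)).ne')
  -- Apply the chart of `S` in the second factor of `ℝ × S` to pull back the smooth local
  -- expression.
  have hchart : ContMDiffOn (𝓘(ℝ, ℝ).prod 𝓘(ℝ, EuSp 2)) 𝓘(ℝ, ℝ × EuSp 2) ∞
      (fun q : ℝ × S => (q.1, extChartAt 𝓘(ℝ, EuSp 2) x q.2))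
      (univ ×ˢ (extChartAt 𝓘(ℝ, EuSp 2) x).source) :=
    contMDiffOn_fst.prodMk_space ((contMDiffOn_extChartAt (I := 𝓘(ℝ, EuSp 2))).comp
      contMDiffOn_snd fun q hq => by
        rw [mem_preimage, ← extChartAt_source 𝓘(ℝ, EuSp 2)]; exact hq.2)
  have hW : I ×ˢ ((extChartAt 𝓘(ℝ, EuSp 2) x).source ∩ extChartAt 𝓘(ℝ, EuSp 2) x ⁻¹' V')
      ∈ nhdsWithin (t, x) (Ico 0 T ×ˢ (univ : Set S)) := by
    rw [nhdsWithin_prod_eq, nhdsWithin_univ]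
    refine Filter.prod_mem_prod (inter_mem_nhdsWithin _ (hb.isOpen_time.mem_nhds htO)) ?_
    exact (continuousOn_extChartAt x).isOpen_inter_preimage (isOpen_extChartAt_source x) hV'o
      |>.mem_nhds ⟨mem_extChartAt_source x, hxV, hb.subset hxV, hμ⟩
  have hcomp := (contMDiffOn_iff_contDiffOn.2 hloc).comp
    (hchart.mono (prod_mono (subset_univ I) (inter_subset_left
      (t := extChartAt 𝓘(ℝ, EuSp 2) x ⁻¹' V'))))
    (fun q hq => ⟨hq.1, hq.2.2⟩)
  have hmem : (t, x) ∈ I ×ˢ ((extChartAt 𝓘(ℝ, EuSp 2) x).source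
      ∩ extChartAt 𝓘(ℝ, EuSp 2) x ⁻¹' V') :=
    ⟨⟨ht, htO⟩, mem_extChartAt_source x, hxV, hb.subset hxV, hμ⟩
  refine ((hcomp.congr fun q hq => ?_) (t, x) hmem).mono_of_mem_nhdsWithin hW
  have h1 := hb.starOmega_eq hF hq.1 κ hq.2.2.1 hq.2.2.2.2
  rw [(extChartAt 𝓘(ℝ, EuSp 2) x).left_inv hq.2.1] at h1
  exact h1

end Flow

/-! ### The maximum principle -/

section Maximum

/-- The scalar maximum principle in the form used here: a function on a compact space that starts
positive stays positive, provided that at each positive spatial minimum it decreases at most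
exponentially. -/
lemma pos_of_deriv_at_min {X : Type*} [TopologicalSpace X] [CompactSpace X] {T c : ℝ}
    {w : ℝ → X → ℝ} (hw : ContinuousOn (fun q : ℝ × X => w q.1 q.2) (Ico 0 T ×ˢ univ))
    (h0 : ∀ x, 0 < w 0 x)
    (hd : ∀ t ∈ Ico 0 T, ∀ x, 0 < w t x → (∀ x', w t x ≤ w t x') →
      ∃ D, HasDerivWithinAt (fun s => w s x) D (Ico 0 T) t ∧ -c * w t x ≤ D)
    {t : ℝ} (ht : t ∈ Ico 0 T) (x : X) : 0 < w t x := by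
  have hsub : Icc 0 t ⊆ Ico 0 T := fun s hs => ⟨hs.1, hs.2.trans_lt ht.2⟩
  obtain ⟨x₁, -, hx₁⟩ := isCompact_univ.exists_isMinOn (f := w 0) ⟨x, mem_univ x⟩
    (hw.comp (f := fun x : X => ((0 : ℝ), x)) (by fun_prop)
      fun x _ => ⟨hsub ⟨le_rfl, ht.1⟩, mem_univ x⟩)
  -- After the exponential rescaling the time derivative at a spatial minimum is positive.
  set v : ℝ × X → ℝ := fun q => Real.exp ((c + 1) * q.1) * w q.1 q.2 with hv
  have hvc : ContinuousOn v (Icc 0 t ×ˢ univ) :=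
    ContinuousOn.mul (by fun_prop) (hw.mono (prod_mono hsub subset_rfl))
  set m := w 0 x₁ / 2 with hm
  have hm0 : 0 < m := half_pos (h0 x₁)
  by_contra hneg
  have hK : IsCompact (Icc 0 t ×ˢ (univ : Set X)) := isCompact_Icc.prod isCompact_univ
  have hB : IsCompact (Icc 0 t ×ˢ (univ : Set X) ∩ v ⁻¹' Iic m) :=
    hK.of_isClosed_subset (hvc.preimage_isClosed_of_isClosed (isClosed_Icc.prod isClosed_univ)
      isClosed_Iic) inter_subset_left
  -- The first time at which the rescaled function reaches half of its initial minimum.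
  obtain ⟨⟨s, x₀⟩, ⟨⟨hs, -⟩, hsm⟩, hmin⟩ := hB.exists_isMinOn (f := fun q : ℝ × X => q.1)
    ⟨(t, x), ⟨⟨ht.1, le_rfl⟩, mem_univ x⟩, (mul_nonpos_of_nonneg_of_nonpos (Real.exp_pos _).le
      (not_lt.1 hneg)).trans hm0.le⟩ continuous_fst.continuousOn
  change s ∈ Icc 0 t at hs
  change v (s, x₀) ≤ m at hsm
  have hbefore : ∀ r ∈ Ico 0 s, ∀ x', m < v (r, x') := by
    intro r hr x'
    by_contra! h
    exact absurd hr.2 (not_lt.2 (hmin (a := (r, x'))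
      ⟨⟨⟨hr.1, hr.2.le.trans hs.2⟩, mem_univ x'⟩, h⟩))
  have hs0 : 0 < s := by
    refine lt_of_le_of_ne hs.1 fun h => ?_
    have h1 : v (s, x₀) = w 0 x₀ := by simp [hv, ← h]
    have h2 : w 0 x₁ ≤ w 0 x₀ := hx₁ (mem_univ x₀)
    have h3 := h0 x₁
    rw [h1] at hsm
    linarith
  have hat : ∀ x', m ≤ v (s, x') := by
    intro x'
    have h1 : ContinuousWithinAt (fun r => v (r, x')) (Icc 0 t) s :=
      (hvc.comp (f := fun r : ℝ => (r, x')) (by fun_prop) fun r hr => ⟨hr, mem_univ x'⟩) s hs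
    have h2 : ContinuousWithinAt (fun r => v (r, x')) (Ico 0 s) s :=
      h1.mono fun r hr => ⟨hr.1, hr.2.le.trans hs.2⟩
    have : (nhdsWithin s (Ico 0 s)).NeBot := by
      rw [← mem_closure_iff_nhdsWithin_neBot, closure_Ico hs0.ne]
      exact ⟨hs.1, le_rfl⟩
    refine ge_of_tendsto h2 ?_
    filter_upwards [self_mem_nhdsWithin] with r hr using (hbefore r hr x').le
  have hpos : 0 < w s x₀ := (mul_pos_iff_of_pos_left (Real.exp_pos _)).1 (hm0.trans_le (hat x₀))
  obtain ⟨D, hD, hDc⟩ := hd s (hsub hs) x₀ hpos fun x' =>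
    le_of_mul_le_mul_left (hsm.trans (hat x')) (Real.exp_pos _)
  have h1 : HasDerivWithinAt (fun r => v (r, x₀)) (Real.exp ((c + 1) * s) * (c + 1) * w s x₀
      + Real.exp ((c + 1) * s) * D) (Icc 0 s) s := by
    have h2 : HasDerivAt (fun r : ℝ => Real.exp ((c + 1) * r))
        (Real.exp ((c + 1) * s) * (c + 1)) s := by
      simpa using ((hasDerivAt_id s).const_mul (c + 1)).exp
    exact h2.hasDerivWithinAt.mul (hD.mono ((Icc_subset_Icc_right hs.2).trans hsub))
  have h2 : IsLocalMinOn (fun r => v (r, x₀)) (Icc 0 s) s := by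
    filter_upwards [self_mem_nhdsWithin] with r hr
    rcases hr.2.lt_or_eq with h | h
    · exact hsm.trans (hbefore r ⟨hr.1, h⟩ x₀).le
    · rw [h]
  -- The rescaled function is larger before time `s`, so that its derivative is not positive.
  have h3 := h2.hasFDerivWithinAt_nonneg h1.hasFDerivWithinAt (y := -s)
    (mem_posTangentConeAt_of_segment_subset (by
      rw [add_neg_cancel, segment_symm, segment_eq_Icc hs.1]))
  simp only [ContinuousLinearMap.toSpanSingleton_apply, smul_eq_mul] at h3
  have h4 : 0 < Real.exp ((c + 1) * s) * (c + 1) * w s x₀ + Real.exp ((c + 1) * s) * D := by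
    have := mul_pos (Real.exp_pos ((c + 1) * s)) (show 0 < (c + 1) * w s x₀ + D by linarith)
    linarith
  nlinarith

lemma second_nonneg_of_isLocalMin {a : EuSp 2 → ℝ} {y : EuSp 2} (ha : ContDiffAt ℝ ∞ a y)
    (h : IsLocalMin a y) (e : EuSp 2) : 0 ≤ second a e y := by
  by_contra! hneg
  set l : ℝ → ℝ := fun s => a (y + s • e) with hl
  have hline : ∀ s : ℝ, HasDerivAt (fun s : ℝ => y + s • e) e s := fun s => by
    simpa using ((hasDerivAt_id s).smul_const e).const_add y
  have hc : Filter.Tendsto (fun s : ℝ => y + s • e) (nhds 0) (nhds y) := by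
    simpa using (hline 0).continuousAt.tendsto
  have hev : ∀ᶠ z in nhds y, DifferentiableAt ℝ a z := by
    filter_upwards [(ha.of_le (m := 1) (by norm_cast)).eventually (by simp)] with q hq
    exact hq.differentiableAt one_ne_zero
  have hd1 : deriv l =ᶠ[nhds 0] fun s => fderiv ℝ a (y + s • e) e := by
    filter_upwards [hc.eventually hev] with s hs
    exact (hs.hasFDerivAt.comp_hasDerivAt s (hline s)).deriv
  have hd2 : deriv (deriv l) 0 = second a e y := by
    have h1 : DifferentiableAt ℝ (fun z => fderiv ℝ a z e) (y + (0 : ℝ) • e) := by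
      rw [zero_smul, add_zero]
      exact ((ha.fderiv_right (m := 1) (by norm_cast)).clm_apply
        contDiffAt_const).differentiableAt one_ne_zero
    have h2 := (h1.hasFDerivAt.comp_hasDerivAt 0 (hline 0)).deriv
    rw [zero_smul, add_zero] at h2
    rw [hd1.deriv_eq]
    exact h2
  have hmin : IsLocalMin l 0 := by
    have : y + (0 : ℝ) • e = y := by simp
    filter_upwards [hc.eventually h] with s hs
    simpa only [hl, this] using hs
  have hmax : IsLocalMax l 0 := isLocalMax_of_deriv_deriv_neg (by rwa [hd2]) hmin.deriv_eq_zero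
    (by
      have := hev.self_of_nhds.continuousAt
      exact ContinuousAt.comp (by simpa using this) (hline 0).continuousAt)
  -- Then `a` is constant along the line, so that its second derivative vanishes.
  have hconst : l =ᶠ[nhds 0] fun _ => l 0 := by
    filter_upwards [hmin, hmax] with s h1 h2 using le_antisymm h2 h1
  have h0 : deriv (deriv l) 0 = 0 := by
    have : deriv l =ᶠ[nhds 0] fun _ => 0 := by
      filter_upwards [hconst.eventuallyEq_nhds] with s hs
      rw [hs.deriv_eq, deriv_const]
    rw [this.deriv_eq, deriv_const]
  rw [← hd2, h0] at hneg
  exact lt_irrefl _ hneg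

lemma laplacian_nonneg_of_isLocalMin {b : EuSp 2 → EuSp 2 →L[ℝ] EuSp 2 →L[ℝ] ℝ} {y e₁ e₂ : EuSp 2}
    (hb : IsInner (b y)) (h₁ : b y e₁ e₁ = 1) (h₂ : b y e₂ e₂ = 1) (h₁₂ : b y e₁ e₂ = 0)
    {a : EuSp 2 → ℝ} (ha : ContDiffAt ℝ ∞ a y) (h : IsLocalMin a y) : 0 ≤ laplacian b a y := by
  rw [laplacian_orthonormal hb h₁ h₂ h₁₂
    ((ha.fderiv_right (m := 1) (by norm_cast)).differentiableAt one_ne_zero), h.fderiv_eq_zero,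
    zero_apply, sub_zero]
  exact add_nonneg (second_nonneg_of_isLocalMin ha h e₁) (second_nonneg_of_isLocalMin ha h e₂)

end Maximum

/-! ### Positivity of `Ω` and the graph property -/

section Positivity

variable {M : Type*} [TopologicalSpace M] [ChartedSpace (EuSp 5) M]
  [IsManifold 𝓘(ℝ, EuSp 5) ∞ M]
  {S : Type*} [TopologicalSpace S] [ChartedSpace (EuSp 2) S] [IsManifold 𝓘(ℝ, EuSp 2) ∞ S]
  {𝓢 : SasakianStructure 5 M} {κ : ParallelTransverseKahlerForm 𝓢} {μ : AreaForm S}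
  {T : ℝ} {F : ℝ → S → M} {α : ℝ → S → ℝ}

omit [IsManifold 𝓘(ℝ, EuSp 2) ∞ S] in
/-- `|H|² ≤ 2 |A|²` for surfaces, by the parallelogram identity. -/
lemma normSqMeanCurv_le (𝓢 : SasakianStructure 5 M) (f : S → M) (x : S)
    (e₁ e₂ : TangentSpace 𝓘(ℝ, EuSp 2) x) :
    normSqMeanCurv 𝓢 f x e₁ e₂ ≤ 2 * normSqSecondFund 𝓢 f x e₁ e₂ := by
  have hnn : ∀ v : TangentSpace 𝓘(ℝ, EuSp 5) (f x), 0 ≤ 𝓢.g.inner (f x) v v := by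
    intro v
    by_cases hv : v = 0
    · simp [hv]
    · exact (𝓢.g.pos _ v hv).le
  simp only [normSqMeanCurv, normSqSecondFund, Fin.sum_univ_two, Matrix.cons_val_zero,
    Matrix.cons_val_one]
  have h1 := hnn (secondFund 𝓢 f x e₁ e₂)
  have h2 := hnn (secondFund 𝓢 f x e₂ e₁)
  have h3 := hnn (secondFund 𝓢 f x e₁ e₁ - secondFund 𝓢 f x e₂ e₂)
  have h4 := 𝓢.g.symm (f x) (secondFund 𝓢 f x e₁ e₁) (secondFund 𝓢 f x e₂ e₂)
  simp only [map_add, map_sub, add_apply, sub_apply] at h3 ⊢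
  linarith

/-- A nonzero vector of an oriented Euclidean plane is, up to a scalar, the first vector of an
oriented orthonormal basis. -/
lemma exists_orthonormal_of_ne_zero {b ν : EuSp 2 →L[ℝ] EuSp 2 →L[ℝ] ℝ} (hb : IsInner b)
    (hν : ∀ v, ν v v = 0) (hν0 : ν ≠ 0) {v : EuSp 2} (hv : v ≠ 0) :
    ∃ (r : ℝ) (e₂ : EuSp 2), b (r • v) (r • v) = 1 ∧ b e₂ e₂ = 1 ∧ b (r • v) e₂ = 0 ∧
      0 < ν (r • v) e₂ := by
  have hnorm : ∀ u : EuSp 2, u ≠ 0 →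
      b ((Real.sqrt (b u u))⁻¹ • u) ((Real.sqrt (b u u))⁻¹ • u) = 1 := by
    intro u hu
    have h1 := hb.pos u hu
    simp only [map_smul, smul_apply, smul_eq_mul]
    rw [← mul_assoc, ← mul_inv, Real.mul_self_sqrt h1.le, inv_mul_cancel₀ h1.ne']
  set r := (Real.sqrt (b v v))⁻¹ with hr
  have hr0 : 0 < r := inv_pos.2 (Real.sqrt_pos.2 (hb.pos v hv))
  obtain ⟨u, hu⟩ : ∃ u, 0 < ν (r • v) u := by
    by_contra! h
    -- An alternating form on the plane with a null vector vanishes.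
    have h0 : ∀ u, ν v u = 0 := by
      intro u
      have h1 := h u
      have h2 := h (-u)
      simp only [map_neg, map_smul, smul_apply, smul_eq_mul] at h1 h2
      have h3 : r * ν v u = 0 := by linarith
      exact (mul_eq_zero.1 h3).resolve_left hr0.ne'
    have hrot := h0 (!₂[-v 1, v 0])
    rw [alternating_eq_det hν] at hrot
    have hsq : v 0 * v 0 + v 1 * v 1 ≠ 0 := by
      intro h1
      refine hv (PiLp.ext fun i => ?_)
      fin_cases i
      · change v 0 = 0
        nlinarith [mul_self_nonneg (v 0), mul_self_nonneg (v 1)]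
      · change v 1 = 0
        nlinarith [mul_self_nonneg (v 0), mul_self_nonneg (v 1)]
    have h2 : ν (coordVec 0) (coordVec 1) = 0 := by
      refine (mul_eq_zero.1 hrot).resolve_left ?_
      simpa using hsq
    refine hν0 (ContinuousLinearMap.ext fun x => ContinuousLinearMap.ext fun y => ?_)
    rw [alternating_eq_det hν, h2, mul_zero]
    rfl
  have h1 : b (r • v) (r • v) = 1 := hnorm v hv
  set u' := u - b (r • v) u • (r • v) with hu'
  have hνu : 0 < ν (r • v) u' := by
    rw [hu', map_sub, map_smul _ (b (r • v) u), hν, smul_zero, sub_zero]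
    exact hu
  have hu0 : u' ≠ 0 := by
    intro h
    rw [h, map_zero] at hνu
    exact lt_irrefl _ hνu
  refine ⟨r, (Real.sqrt (b u' u'))⁻¹ • u', h1, hnorm u' hu0, ?_, ?_⟩
  · have h2 : b (r • v) u' = 0 := by
      rw [hu', map_sub, map_smul _ (b (r • v) u), h1, smul_eq_mul, mul_one, sub_self]
    rw [map_smul, h2, smul_zero]
  · rw [map_smul, smul_eq_mul]
    exact mul_pos (inv_pos.2 (Real.sqrt_pos.2 (hb.pos _ hu0))) hνu

namespace IsLegendrianMCF

variable (hF : IsLegendrianMCF 𝓢 T F α) {t : ℝ} (ht : t ∈ Ico 0 T)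
include hF ht

omit [IsManifold 𝓘(ℝ, EuSp 2) ∞ S] in
lemma isInner_pullback (x : S) :
    IsInner (pullback 𝓢.g.inner (F t) x : EuSp 2 →L[ℝ] EuSp 2 →L[ℝ] ℝ) :=
  ⟨fun _ _ => 𝓢.g.symm _ _ _, fun _ hu => 𝓢.g.pos _ _ fun h0 =>
    hu (hF.immersion t ht x (h0.trans (map_zero _).symm))⟩

lemma exists_isOrientedFrame (μ : AreaForm S) (x : S) {v : TangentSpace 𝓘(ℝ, EuSp 2) x}
    (hv : v ≠ 0) : ∃ (r : ℝ) (e₂ : TangentSpace 𝓘(ℝ, EuSp 2) x),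
      IsOrientedFrame 𝓢 μ (F t) x (r • v) e₂ :=
  exists_orthonormal_of_ne_zero (hF.isInner_pullback ht x) (μ.alternating x) (μ.nonzero x) hv

/-- The tangent planes are Lagrangian for the transverse Kähler form of `Φ`. -/
lemma inner_phi (κ : ParallelTransverseKahlerForm 𝓢) (x : S)
    (u v : TangentSpace 𝓘(ℝ, EuSp 2) x) :
    𝓢.g.inner (F t x) (𝓢.Φ (F t x) (diff (F t) x u)) (diff (F t) x v) = 0 := by
  obtain ⟨O, V, htO, hxV, hb⟩ := hF.exists_flowBox ht x
  have h1 := (hb.isLegendrianChart hF ⟨ht, htO⟩ κ).lagrangian hxV u v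
  have hfy : locMap (F t) x (F t x) (extChartAt 𝓘(ℝ, EuSp 2) x x)
      = extChartAt 𝓘(ℝ, EuSp 5) (F t x) (F t x) := by rw [locMap, extChartAt_to_inv]
  rw [hfy, hF.fderiv_locMap_self ht, hF.fderiv_locMap_self ht] at h1
  exact (locBilin_locEnd_self 𝓢.g.inner 𝓢.Φ (F t x) _ _).symm.trans h1

variable {x : S} {e₁ e₂ : TangentSpace 𝓘(ℝ, EuSp 2) x}

/-- An orthonormal tangent basis, in the chart at the image point. -/
lemma isLegendrianFrame (κ : ParallelTransverseKahlerForm 𝓢)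
    (he : IsOrientedFrame 𝓢 μ (F t) x e₁ e₂) :
    IsLegendrianFrame (locBilin 𝓢.g.inner (F t x)) (locForm 𝓢.η (F t x)) (locEnd 𝓢.Φ (F t x))
      (extChartAt 𝓘(ℝ, EuSp 5) (F t x) (F t x)) (diff (F t) x e₁) (diff (F t) x e₂) where
  norm₁ := (locBilin_self _ _ _ _).trans he.1
  norm₂ := (locBilin_self _ _ _ _).trans he.2.1
  orth := (locBilin_self _ _ _ _).trans he.2.2.1
  horiz₁ := (locForm_self _ _ _).trans (hF.legendrian t ht x _)
  horiz₂ := (locForm_self _ _ _).trans (hF.legendrian t ht x _)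
  lagr := (locBilin_locEnd_self 𝓢.g.inner 𝓢.Φ (F t x) _ _).trans (hF.inner_phi ht κ x e₁ e₂)

lemma starOmega_eq_form (κ : ParallelTransverseKahlerForm 𝓢)
    (he : IsOrientedFrame 𝓢 μ (F t) x e₁ e₂) :
    starOmega κ μ (F t) x
      = 𝓢.g.inner (F t x) (κ.J (F t x) (diff (F t) x e₁)) (diff (F t) x e₂) := by
  have hp := mem_extChartAt_target (I := 𝓘(ℝ, EuSp 5)) (F t x)
  have h1 := hodgeStar_eq (β := pullback κ.form (F t) x) (hF.isInner_pullback ht x)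
    (μ.alternating x) (fun v =>
      (locBilin_locEnd_self 𝓢.g.inner κ.J (F t x) _ _).symm.trans
        (IsLegendrianFrame.form_self (isSasakianChart 𝓢 κ (F t x)) hp (diff (F t) x v)))
    he.2.2.2
  refine h1.trans ?_
  have h2 : areaSq (pullback 𝓢.g.inner (F t) x) e₁ e₂ = 1 := by
    have h3 : pullback 𝓢.g.inner (F t) x e₁ e₁ * pullback 𝓢.g.inner (F t) x e₂ e₂
        - pullback 𝓢.g.inner (F t) x e₁ e₂ ^ 2 = 1 := by
      rw [he.1, he.2.1, he.2.2.1]; norm_num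
    exact h3
  rw [h2, Real.sqrt_one, div_one]
  rfl

lemma starOmega_sq_le (κ : ParallelTransverseKahlerForm 𝓢)
    (he : IsOrientedFrame 𝓢 μ (F t) x e₁ e₂) : starOmega κ μ (F t) x ^ 2 ≤ 1 := by
  have hp := mem_extChartAt_target (I := 𝓘(ℝ, EuSp 5)) (F t x)
  have h1 := (IsLegendrianFrame.J_relations (isSasakianChart 𝓢 κ (F t x)) hp
    (hF.isLegendrianFrame ht κ he) rfl rfl rfl rfl).1
  rw [hF.starOmega_eq_form ht κ he]
  have h2 := locBilin_locEnd_self 𝓢.g.inner κ.J (F t x) (diff (F t) x e₁) (diff (F t) x e₂)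
  rw [← h2]
  rw [← h1, add_assoc]
  exact le_add_of_nonneg_right (add_nonneg (sq_nonneg _) (sq_nonneg _))

/-- On the tangent planes of a Legendrian surface in an `η`-Einstein manifold the curvature term
of the evolution equation is a multiple of `Ω`. -/
lemma ricT_eq {K : ℝ} (hK : 𝓢.IsEtaEinstein K) (κ : ParallelTransverseKahlerForm 𝓢)
    (he : IsOrientedFrame 𝓢 μ (F t) x e₁ e₂) :
    𝓢.ricT (F t x) (κ.J (F t x) (diff (F t) x e₁)) (diff (F t) x e₂)
      = (K + 2) * starOmega κ μ (F t) x := by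
  have hp := mem_extChartAt_target (I := 𝓘(ℝ, EuSp 5)) (F t x)
  have hch := isSasakianChart 𝓢 κ (F t x)
  have hJ : 𝓢.η (F t x) (κ.J (F t x) (diff (F t) x e₁)) = 0 := by
    rw [← locForm_self, ← locEnd_self]
    exact hch.eta_J hp _
  have hη := hF.legendrian t ht x e₂
  have h1 := hch.ricci_eq hp (IsLegendrianFrame.frame hch hp (hF.isLegendrianFrame ht κ he))
    ((locForm_self _ _ _).trans hJ) ((locForm_self _ _ _).trans hη)
  have h2 := hK (F t x) (κ.J (F t x) (diff (F t) x e₁)) (diff (F t) x e₂)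
  rw [hJ, zero_mul, mul_zero, add_zero] at h2
  have h3 := locBilin_self 𝓢.g.inner (F t x) (κ.J (F t x) (diff (F t) x e₁)) (diff (F t) x e₂)
  have h4 := hF.starOmega_eq_form ht κ he
  have h5 : 𝓢.ricT (F t x) (κ.J (F t x) (diff (F t) x e₁)) (diff (F t) x e₂)
      = K * 𝓢.g.inner (F t x) (κ.J (F t x) (diff (F t) x e₁)) (diff (F t) x e₂)
        + 2 * 𝓢.g.inner (F t x) (κ.J (F t x) (diff (F t) x e₁)) (diff (F t) x e₂) := by
    rw [← h2, ← h3, h1]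
    exact (sub_add_cancel _ _).symm
  rw [h5, h4]
  ring

/-- At a positive spatial minimum the reaction terms bound the decrease of `Ω`. -/
lemma exists_hasDerivWithinAt_at_min {K : ℝ} (hK : 𝓢.IsEtaEinstein K)
    (κ : ParallelTransverseKahlerForm 𝓢) (μ : AreaForm S) (x : S)
    (hpos : 0 < starOmega κ μ (F t) x)
    (hmin : ∀ x', starOmega κ μ (F t) x ≤ starOmega κ μ (F t) x') :
    ∃ D, HasDerivWithinAt (fun s => starOmega κ μ (F s) x) D (Ico 0 T) t
      ∧ -|K + 2| * starOmega κ μ (F t) x ≤ D := by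
  obtain ⟨v, hv⟩ : ∃ v : TangentSpace 𝓘(ℝ, EuSp 2) x, v ≠ 0 := by
    obtain ⟨e₁, e₂, he⟩ := μ.exists_pos x
    exact ⟨e₁, fun h => by simp [h] at he⟩
  obtain ⟨r, e₂, he⟩ := hF.exists_isOrientedFrame ht μ x hv
  refine ⟨_, hF.hasDerivWithinAt_starOmega κ μ ht he, ?_⟩
  rw [hF.ricT_eq ht hK κ he]
  have hlap : 0 ≤ surfaceLaplacian 𝓢 (F t) (starOmega κ μ (F t)) x := by
    have hG : (locBilin (pullback 𝓢.g.inner (F t)) x (extChartAt 𝓘(ℝ, EuSp 2) x x))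
        = pullback 𝓢.g.inner (F t) x :=
      ContinuousLinearMap.ext fun u => ContinuousLinearMap.ext fun w => locBilin_self _ _ u w
    have hI := hF.isInner_pullback ht x
    rw [← hG] at hI
    refine laplacian_nonneg_of_isLocalMin hI ((locBilin_self _ _ _ _).trans he.1)
      ((locBilin_self _ _ _ _).trans he.2.1) ((locBilin_self _ _ _ _).trans he.2.2.1) ?_
      (Filter.Eventually.of_forall fun z => ?_)
    · have h1 : ContMDiffOn 𝓘(ℝ, EuSp 2) (𝓘(ℝ, ℝ).prod 𝓘(ℝ, EuSp 2)) ∞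
          (fun z => (t, (extChartAt 𝓘(ℝ, EuSp 2) x).symm z)) (extChartAt 𝓘(ℝ, EuSp 2) x).target :=
        contMDiffOn_const.prodMk (contMDiffOn_extChartAt_symm x)
      have h2 := ((hF.contMDiffOn_starOmega κ μ).comp h1 fun z _ => ⟨ht, mem_univ _⟩).contDiffOn
      exact h2.contDiffAt (extChartAt_target_mem_nhds x)
    · change starOmega κ μ (F t) ((extChartAt 𝓘(ℝ, EuSp 2) x).symm _) ≤ starOmega κ μ (F t) _
      rw [extChartAt_to_inv]
      exact hmin _
  have hA := normSqMeanCurv_le 𝓢 (F t) x (r • v) e₂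
  have h1 := mul_nonneg (sub_nonneg.2 hA) hpos.le
  have h2 := hF.starOmega_sq_le ht κ he
  have h3 : -|K + 2| ≤ (1 - starOmega κ μ (F t) x ^ 2) * (K + 2) := by
    nlinarith [neg_abs_le (K + 2), abs_nonneg (K + 2), sq_nonneg (starOmega κ μ (F t) x)]
  have h4 := mul_le_mul_of_nonneg_right h3 hpos.le
  linarith

/-- If `J v = ± Φ v` for a tangent vector `v`, then `Ω` is the restriction of `± g(Φ ·, ·)` in a
frame that starts with `v`, hence zero. -/
lemma isTransverseGraph (κ : ParallelTransverseKahlerForm 𝓢) (μ : AreaForm S)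
    (hpos : ∀ x, 0 < starOmega κ μ (F t) x) : IsTransverseGraph κ (F t) := by
  intro x v hv
  obtain ⟨r, e₂, he⟩ := hF.exists_isOrientedFrame ht μ x hv
  have h1 := hpos x
  rw [hF.starOmega_eq_form ht κ he, map_smul, map_smul, map_smul, smul_apply, smul_eq_mul] at h1
  have h2 := hF.inner_phi ht κ x v e₂
  constructor
  · intro h
    rw [h, h2, mul_zero] at h1
    exact lt_irrefl _ h1
  · intro h
    rw [h, map_neg, neg_apply, h2, neg_zero, mul_zero] at h1
    exact lt_irrefl _ h1

end IsLegendrianMCF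

/-- On an `η`-Einstein manifold the reaction term `(1 - Ω²) Ricᵀ(J e₁, e₂)` is `(K + 2)(1 - Ω²) Ω`,
and `2|A|² - |H|² ≥ 0`; the maximum principle applies. -/
theorem IsLegendrianMCF.starOmega_pos (hF : IsLegendrianMCF 𝓢 T F α) [CompactSpace S] {K : ℝ}
    (hK : 𝓢.IsEtaEinstein K) (h0 : ∀ x, 0 < starOmega κ μ (F 0) x) {t : ℝ} (ht : t ∈ Ico 0 T)
    (x : S) : 0 < starOmega κ μ (F t) x :=
  pos_of_deriv_at_min (hF.contMDiffOn_starOmega κ μ).continuousOn h0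
    (fun _ hs x hx hmin => hF.exists_hasDerivWithinAt_at_min hs hK κ μ x hx hmin) ht x

end Positivity

end LegendrianFlow

end

theorem mainTheorem8
    {M : Type*} [TopologicalSpace M] [ChartedSpace (EuSp 5) M] [IsManifold 𝓘(ℝ, EuSp 5) ∞ M]
    {S : Type*} [TopologicalSpace S] [ChartedSpace (EuSp 2) S] [IsManifold 𝓘(ℝ, EuSp 2) ∞ S]
    (𝓢 : LegendrianFlow.SasakianStructure 5 M)
    (κ : LegendrianFlow.ParallelTransverseKahlerForm 𝓢)
    (μ : LegendrianFlow.AreaForm S)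
    (T : ℝ) (F : ℝ → S → M) (α : ℝ → S → ℝ)
    (hF : LegendrianFlow.IsLegendrianMCF 𝓢 T F α) :
    ContMDiffOn (𝓘(ℝ, ℝ).prod 𝓘(ℝ, EuSp 2)) 𝓘(ℝ, ℝ) ∞
        (fun q : ℝ × S => LegendrianFlow.starOmega κ μ (F q.1) q.2) (Set.Ico 0 T ×ˢ Set.univ) ∧
    (∀ t ∈ Set.Ico 0 T, ∀ (x : S) (e₁ e₂ : TangentSpace 𝓘(ℝ, EuSp 2) x),
      LegendrianFlow.IsOrientedFrame 𝓢 μ (F t) x e₁ e₂ →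
      HasDerivWithinAt (fun s => LegendrianFlow.starOmega κ μ (F s) x)
        (LegendrianFlow.surfaceLaplacian 𝓢 (F t) (LegendrianFlow.starOmega κ μ (F t)) x
          + (2 * LegendrianFlow.normSqSecondFund 𝓢 (F t) x e₁ e₂
              - LegendrianFlow.normSqMeanCurv 𝓢 (F t) x e₁ e₂)
            * LegendrianFlow.starOmega κ μ (F t) x
          + (1 - LegendrianFlow.starOmega κ μ (F t) x ^ 2)
            * 𝓢.ricT (F t x) (κ.J (F t x) (LegendrianFlow.diff (F t) x e₁))
                (LegendrianFlow.diff (F t) x e₂))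
        (Set.Ico 0 T) t) ∧
    ((∃ K : ℝ, 𝓢.IsEtaEinstein K) → CompactSpace S →
      (∀ x, 0 < LegendrianFlow.starOmega κ μ (F 0) x) →
      ∀ t ∈ Set.Ico 0 T,
        (∀ x, 0 < LegendrianFlow.starOmega κ μ (F t) x) ∧
          LegendrianFlow.IsTransverseGraph κ (F t)) := by
  refine ⟨hF.contMDiffOn_starOmega κ μ, fun t ht x e₁ e₂ he =>
    hF.hasDerivWithinAt_starOmega κ μ ht he, ?_⟩
  rintro ⟨K, hK⟩ hS h0 t ht
  have hpos := fun x => hF.starOmega_pos hK h0 ht x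
  exact ⟨hpos, hF.isTransverseGraph ht κ μ hpos⟩
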